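/- Let $\mathbb G$ be a compact quantum group of Kac type, given by its Hopf $*$-algebra $\mathrm{Pol}(\mathbb G)$ (a Hopf $*$-algebra spanned by the coefficients of its finite-dimensional unitary representations), with coproduct $\Delta$, antipode $S$ and Haar state $h$; Kac type means that $h$ is a trace. Let $\mathrm{Irr}(\mathbb G)$ be the set of equivalence classes of irreducible unitary representations, with fixed representatives $u^\alpha=[u^\alpha_{ij}]\in M_{n_\alpha}(\mathrm{Pol}(\mathbb G))$. Put $\ell^\infty(\widehat{\mathbb G})=\ell^\infty\text{-}\bigoplus_\alpha M_{n_\alpha}$, let $\mathrm A(\mathbb G)=\ell^1(\widehat{\mathbb G})$ be its predual with the operator space structure $M_k(\mathrm A(\mathbb G))\subseteq CB(\ell^\infty(\widehat{\mathbb G}),M_k)$, and for a finitely supported family $X=(X_\alpha)_\alpha\in c_{00}(\widehat{\mathbb G})$ let $X\cdot\widehat h\in \mathrm A(\mathbb G)$ be the functional $a\mapsto \widehat h(aX)=\sum_\alpha n_\alpha \mathrm{Tr}(a_\alpha X_\alpha)$. Embed $\mathrm{Pol}(\mathbb G)$ into $\mathrm A(\mathbb G)$ by $x\mapsto \mathcal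 F(x)\cdot\widehat h$, where $\mathcal F(x)_\alpha=\big(h((u^\alpha_{ji})^*x)\big)_{i,j}$. For $a,b\in\mathrm{Pol}(\mathbb G)$ let $a\star b=(h\otimes \mathrm{id})\big((S\otimes\mathrm{id})(\Delta(b))(a\otimes 1)\big)$. Then the map $a\otimes b\mapsto a\star S(b)$ on $\mathrm{Pol}(\mathbb G)\odot\mathrm{Pol}(\mathbb G)$ extends uniquely to a bounded linear map (the twisted convolution) $\Phi:\mathrm A(\mathbb G)\widehat\otimes \mathrm A(\mathbb G)\to \mathrm A(\mathbb G)$ on the operator space projective tensor product. Let $\mathrm A_\Delta(\mathbb G)$ be the range of $\Phi$, with the operator space structure that makes $\Phi$ a complete quotient map onto it. There is a completely isometric linear isomorphism $$\mathrm A_\Delta(\mathbb G)\;\cong\;\ell^1\text{-}\bigoplus_{\alpha\in\mathrm{Irr}(\mathbb G)} n_\alpha^{3/2}\,(S^2_{n_\alpha})_r ,$$ where $(S^2_n)_r$ is the space of $n\times n$ matrices with the Hilbert–Schmidt norm and the row operator space structure, $c\,E$ is the operator space $E$ with all matrix norms multiplied by $c$, and the direct sum is the operator space $\ell^1$-direct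 sum. Moreover, for every $X\in c_{00}(\widehat{\mathbb G})$ the element $X\cdot\widehat h$ lies in $\mathrm A_\Delta(\mathbb G)$, this isomorphism sends it to $(X_\alpha)_\alpha$, and $$\|X\cdot\widehat h\|_{\mathrm A_\Delta(\mathbb G)}=\sum_\alpha n_\alpha^{3/2}\,\|X_\alpha\|_{S^2_{n_\alpha}} .$$ -/

import Mathlib

open scoped Matrix.Norms.L2Operator TensorProduct ComplexOrder

namespace OpSp

theorem l2_le {m n : Type*} [Fintype m] [Fintype n] [DecidableEq n] (M : Matrix m n ℂ) {C : ℝ}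
    (hC : 0 ≤ C) (h : ∀ v : n → ℂ, ∑ i, ‖(M.mulVec v) i‖ ^ 2 ≤ C ^ 2 * ∑ j, ‖v j‖ ^ 2) :
    ‖M‖ ≤ C := by
  rw [Matrix.l2_opNorm_def]
  refine ContinuousLinearMap.opNorm_le_bound _ hC fun v => ?_
  refine le_of_sq_le_sq ?_ (by positivity)
  rw [mul_pow, EuclideanSpace.norm_sq_eq, EuclideanSpace.norm_sq_eq]
  exact h v.ofLp

theorem l2_apply {m n : Type*} [Fintype m] [Fintype n] [DecidableEq n] (M : Matrix m n ℂ)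
    (v : n → ℂ) : ∑ i, ‖(M.mulVec v) i‖ ^ 2 ≤ ‖M‖ ^ 2 * ∑ j, ‖v j‖ ^ 2 := by
  have h := Matrix.l2_opNorm_mulVec M (WithLp.toLp 2 v)
  have h2 := pow_le_pow_left₀ (norm_nonneg _) h 2
  rw [mul_pow, EuclideanSpace.norm_sq_eq, EuclideanSpace.norm_sq_eq] at h2
  exact h2

open Matrix in
theorem l2_kron_one {m n J : Type*} [Fintype m] [Fintype n] [Fintype J] [DecidableEq n]
    [DecidableEq J] (M : Matrix m n ℂ) :
    ‖(Matrix.of fun (p : m × J) (q : n × J) => if p.2 = q.2 then M p.1 q.1 else 0)‖ ≤ ‖M‖ := by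
  refine l2_le _ (norm_nonneg _) fun v => ?_
  have h : ∀ (i : m) (j : J), ((Matrix.of fun (p : m × J) (q : n × J) =>
      if p.2 = q.2 then M p.1 q.1 else 0).mulVec v) (i, j) = (M.mulVec fun k => v (k, j)) i := by
    intro i j
    simp [Matrix.mulVec, dotProduct, Fintype.sum_prod_type]
  rw [Fintype.sum_prod_type_right, Fintype.sum_prod_type_right, Finset.mul_sum]
  refine Finset.sum_le_sum fun j _ => ?_
  simp only [h]
  exact l2_apply M _

/-- The norm of a block diagonal matrix, in any indexing. -/
theorem l2_block {m₁ m₂ n₁ n₂ m n : Type*} [Fintype m₁] [Fintype n₁] [DecidableEq n₁] [Fintype m₂]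
    [Fintype n₂] [DecidableEq n₂] [Fintype m] [Fintype n] [DecidableEq n]
    (e : m ≃ m₁ ⊕ m₂) (f : n ≃ n₁ ⊕ n₂) (A : Matrix m₁ n₁ ℂ) (B : Matrix m₂ n₂ ℂ) :
    ‖(Matrix.fromBlocks A 0 0 B).submatrix e f‖ ≤ max ‖A‖ ‖B‖ := by
  refine l2_le _ (by positivity) fun v => ?_
  have h1 := l2_apply A fun j => v (f.symm (Sum.inl j))
  have h2 := l2_apply B fun j => v (f.symm (Sum.inr j))
  have key : ∀ i, (((Matrix.fromBlocks A 0 0 B).submatrix e f).mulVec v) i =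
      Sum.elim (A.mulVec fun j => v (f.symm (Sum.inl j)))
        (B.mulVec fun j => v (f.symm (Sum.inr j))) (e i) := by
    intro i
    rw [Matrix.submatrix_mulVec_equiv, Function.comp_apply, Matrix.fromBlocks_mulVec]
    simp [Function.comp_def]
  simp only [key]
  rw [Equiv.sum_comp e (fun s => ‖Sum.elim (A.mulVec fun j => v (f.symm (Sum.inl j)))
        (B.mulVec fun j => v (f.symm (Sum.inr j))) s‖ ^ 2),
    ← Equiv.sum_comp f.symm (fun j => ‖v j‖ ^ 2), Fintype.sum_sum_type, Fintype.sum_sum_type,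
    mul_add]
  simp only [Sum.elim_inl, Sum.elim_inr]
  have hA : ‖A‖ ^ 2 ≤ (max ‖A‖ ‖B‖) ^ 2 := by gcongr; exact le_max_left _ _
  have hB : ‖B‖ ^ 2 ≤ (max ‖A‖ ‖B‖) ^ 2 := by gcongr; exact le_max_right _ _
  gcongr
  · exact h1.trans (by gcongr)
  · exact h2.trans (by gcongr)

/-- Data of a norm on each space `M_ι(E)` of square matrices over `E`. Matrices may be indexed by any
finite type; `OperatorSpace` makes the norm independent of the choice of indices. -/
class MatrixNorm (E : Type*) where
  mnorm : ∀ {ι : Type} [Fintype ι] [DecidableEq ι], Matrix ι ι E → ℝ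

open MatrixNorm (mnorm)

/-- The bimodule product `α x β` of a matrix `x` over `E` with scalar matrices `α`, `β`. -/
def sandwich {E ι κ : Type*} [AddCommGroup E] [Module ℂ E] [Fintype κ]
    (α : Matrix ι κ ℂ) (x : Matrix κ κ E) (β : Matrix κ ι ℂ) : Matrix ι ι E :=
  Matrix.of fun a b => ∑ s, ∑ t, (α a s * β t b) • x s t

/-- Ruan's axioms: `E` with its matrix norms is an (abstract) operator space. The norm `‖α‖` of a
scalar matrix is its operator norm between Euclidean spaces. -/
class OperatorSpace (E : Type*) [AddCommGroup E] [Module ℂ E] [MatrixNorm E] : Prop where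
  mnorm_add_le : ∀ {ι : Type} [Fintype ι] [DecidableEq ι] (x y : Matrix ι ι E),
    mnorm (x + y) ≤ mnorm x + mnorm y
  mnorm_smul : ∀ {ι : Type} [Fintype ι] [DecidableEq ι] (c : ℂ) (x : Matrix ι ι E),
    mnorm (c • x) = ‖c‖ * mnorm x
  eq_zero_of_mnorm : ∀ {ι : Type} [Fintype ι] [DecidableEq ι] (x : Matrix ι ι E),
    mnorm x = 0 → x = 0
  mnorm_fromBlocks_le : ∀ {ι κ : Type} [Fintype ι] [DecidableEq ι] [Fintype κ] [DecidableEq κ]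
    (x : Matrix ι ι E) (y : Matrix κ κ E),
    mnorm (Matrix.fromBlocks x 0 0 y) ≤ max (mnorm x) (mnorm y)
  mnorm_sandwich_le : ∀ {ι κ : Type} [Fintype ι] [DecidableEq ι] [Fintype κ] [DecidableEq κ]
    (α : Matrix ι κ ℂ) (x : Matrix κ κ E) (β : Matrix κ ι ℂ),
    mnorm (sandwich α x β) ≤ ‖α‖ * mnorm x * ‖β‖

namespace OperatorSpace
variable {E : Type*} [AddCommGroup E] [Module ℂ E] [MatrixNorm E] [OperatorSpace E]
variable {ι : Type} [Fintype ι] [DecidableEq ι]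

theorem mnorm_zero : mnorm (0 : Matrix ι ι E) = 0 := by
  have := mnorm_smul (0 : ℂ) (0 : Matrix ι ι E)
  simpa using this

theorem mnorm_nonneg (x : Matrix ι ι E) : 0 ≤ mnorm x := by
  have h := mnorm_add_le x ((-1 : ℂ) • x)
  have h2 := mnorm_smul (-1 : ℂ) x
  have h3 : x + (-1 : ℂ) • x = 0 := by simp
  rw [h3, mnorm_zero, h2] at h
  simp at h
  linarith
end OperatorSpace

/-- The operator space structure of `M_k`: a matrix over `M_k` is normed as a scalar matrix. -/
noncomputable instance instMatrixNormMatrix {k : Type*} [Fintype k] [DecidableEq k] :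
    MatrixNorm (Matrix k k ℂ) where
  mnorm {ι} _ _ x := ‖Matrix.comp ι ι k k ℂ x‖

theorem mnorm_matrix_def {ι : Type} [Fintype ι] [DecidableEq ι] {k : Type*} [Fintype k]
    [DecidableEq k] (x : Matrix ι ι (Matrix k k ℂ)) : mnorm x = ‖Matrix.comp ι ι k k ℂ x‖ := rfl

instance {k : Type*} [Fintype k] [DecidableEq k] : OperatorSpace (Matrix k k ℂ) where
  mnorm_add_le x y := norm_add_le (Matrix.comp _ _ _ _ ℂ x) (Matrix.comp _ _ _ _ ℂ y)
  mnorm_smul c x := norm_smul c (Matrix.comp _ _ _ _ ℂ x)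
  eq_zero_of_mnorm x h := by
    have : Matrix.comp _ _ _ _ ℂ x = 0 := norm_eq_zero.mp h
    ext i j a b
    exact congrFun (congrFun this (i, a)) (j, b)
  mnorm_fromBlocks_le {ι κ} _ _ _ _ x y := by
    rw [mnorm_matrix_def]
    have := l2_block (Equiv.sumProdDistrib ι κ k) (Equiv.sumProdDistrib ι κ k)
      (Matrix.comp _ _ _ _ ℂ x) (Matrix.comp _ _ _ _ ℂ y)
    have h : Matrix.comp _ _ k k ℂ (Matrix.fromBlocks x 0 0 y) =
        (Matrix.fromBlocks (Matrix.comp _ _ _ _ ℂ x) 0 0 (Matrix.comp _ _ _ _ ℂ y)).submatrix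
          (Equiv.sumProdDistrib ι κ k) (Equiv.sumProdDistrib ι κ k) := by
      ext ⟨i | i, a⟩ ⟨j | j, b⟩ <;> simp
    rw [h]
    exact this
  mnorm_sandwich_le {ι κ} _ _ _ _ α x β := by
    rw [mnorm_matrix_def, mnorm_matrix_def]
    have h : Matrix.comp ι ι k k ℂ (sandwich α x β) =
        (Matrix.of fun (p : ι × k) (q : κ × k) => if p.2 = q.2 then α p.1 q.1 else 0) *
        Matrix.comp κ κ k k ℂ x *
        (Matrix.of fun (p : κ × k) (q : ι × k) => if p.2 = q.2 then β p.1 q.1 else 0) := by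
      ext ⟨i, a⟩ ⟨j, b⟩
      simp [sandwich, Matrix.mul_apply, Fintype.sum_prod_type, Matrix.sum_apply, Finset.sum_mul]
      rw [Finset.sum_comm]
      refine Finset.sum_congr rfl fun _ _ => Finset.sum_congr rfl fun _ _ => by ring
    rw [h]
    refine (Matrix.l2_opNorm_mul _ _).trans ?_
    gcongr
    · refine (Matrix.l2_opNorm_mul _ _).trans ?_
      gcongr
      exact l2_kron_one α
    · exact l2_kron_one β


theorem l2_submatrix_le {m n m' n' : Type*} [Fintype m] [Fintype n] [DecidableEq n] [Fintype m']
    [Fintype n'] [DecidableEq n'] (e : m' ≃ m) (f : n' ≃ n) (A : Matrix m n ℂ) :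
    ‖A.submatrix e f‖ ≤ ‖A‖ := by
  refine l2_le _ (norm_nonneg _) fun v => ?_
  have h := l2_apply A (v ∘ f.symm)
  rw [Matrix.submatrix_mulVec_equiv, ← Equiv.sum_comp f.symm (fun j => ‖v j‖ ^ 2)]
  simp only [Function.comp_apply]
  rw [Equiv.sum_comp e (fun i => ‖(A.mulVec (v ∘ f.symm)) i‖ ^ 2)]
  exact h

theorem l2_col_le {m : Type*} [Fintype m] (v : m → ℂ) :
    ‖(Matrix.of fun i (_ : Unit) => v i)‖ ≤ √(∑ i, ‖v i‖ ^ 2) := by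
  refine l2_le _ (by positivity) fun w => ?_
  rw [Real.sq_sqrt (by positivity)]
  simp [Matrix.mulVec, dotProduct, mul_pow, Finset.sum_mul]

theorem l2_row_le {m : Type*} [Fintype m] [DecidableEq m] (v : m → ℂ) :
    ‖(Matrix.of fun (_ : Unit) i => v i)‖ ≤ √(∑ i, ‖v i‖ ^ 2) := by
  have h := Matrix.l2_opNorm_conjTranspose (Matrix.of fun (_ : Unit) i => v i)
  rw [← h]
  refine (l2_col_le fun i => star (v i)).trans ?_
  simp

/-- The `1 × 1` matrix with entry `v`; `mnorm (oneByOne E v)` is the norm of `v` in `E`. -/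
def oneByOne (E : Type*) (v : E) : Matrix Unit Unit E := Matrix.of fun _ _ => v

theorem mnorm_one_matrix {k : Type*} [Fintype k] [DecidableEq k] (A : Matrix k k ℂ) :
    mnorm (oneByOne _ A) = ‖A‖ := by
  rw [mnorm_matrix_def]
  apply le_antisymm
  · exact l2_submatrix_le (Equiv.punitProd k) (Equiv.punitProd k) A
  · exact l2_submatrix_le (Equiv.punitProd k).symm (Equiv.punitProd k).symm
      (Matrix.comp _ _ _ _ ℂ (oneByOne _ A))

theorem OperatorSpace.mnorm_le_sum {E : Type*} [AddCommGroup E] [Module ℂ E] [MatrixNorm E]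
    [OperatorSpace E] {ι : Type} [Fintype ι] [DecidableEq ι] (x : Matrix ι ι E) :
    mnorm x ≤ ∑ i, ∑ j, mnorm (oneByOne E (x i j)) := by
  have hs : ∀ (s : Finset (ι × ι)) (y : ι × ι → Matrix ι ι E),
      mnorm (∑ p ∈ s, y p) ≤ ∑ p ∈ s, mnorm (y p) := by
    classical
    intro s y
    induction s using Finset.induction_on with
    | empty => simp [OperatorSpace.mnorm_zero]
    | insert a s ha ih =>
      rw [Finset.sum_insert ha, Finset.sum_insert ha]
      exact (OperatorSpace.mnorm_add_le _ _).trans (by gcongr)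
  have hx : x = ∑ p : ι × ι, sandwich (Matrix.of fun i (_ : Unit) => (Pi.single p.1 1 : ι → ℂ) i)
      (oneByOne E (x p.1 p.2)) (Matrix.of fun (_ : Unit) i => (Pi.single p.2 1 : ι → ℂ) i) := by
    ext i j
    simp [Matrix.sum_apply, sandwich, oneByOne, Fintype.sum_prod_type, Pi.single_apply]
  conv_lhs => rw [hx]
  rw [← Fintype.sum_prod_type']
  refine (hs _ _).trans (Finset.sum_le_sum fun p _ => ?_)
  refine (OperatorSpace.mnorm_sandwich_le _ _ _).trans ?_
  have h1 := l2_col_le (Pi.single p.1 1 : ι → ℂ)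
  have h2 := l2_row_le (Pi.single p.2 1 : ι → ℂ)
  have e : ∀ k : ι, √(∑ i, ‖(Pi.single k 1 : ι → ℂ) i‖ ^ 2) = 1 := by
    intro k; simp [Pi.single_apply, apply_ite norm, ite_pow]
  rw [e] at h1 h2
  have h0 := OperatorSpace.mnorm_nonneg (oneByOne E (x p.1 p.2))
  calc _ ≤ 1 * mnorm (oneByOne E (x p.1 p.2)) * 1 := by gcongr
    _ = _ := by ring

/-- Bounded functionals are completely bounded. -/
theorem norm_map_functional_le {E : Type*} [NormedAddCommGroup E] [NormedSpace ℂ E]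
    [MatrixNorm E] [OperatorSpace E] (hone : ∀ a : E, ‖a‖ ≤ mnorm (oneByOne E a))
    (f : StrongDual ℂ E) {κ : Type} [Fintype κ] [DecidableEq κ]
    (x : Matrix κ κ E) : ‖(x.map f : Matrix κ κ ℂ)‖ ≤ ‖f‖ * mnorm x := by
  refine l2_le _ (mul_nonneg (norm_nonneg f) (OperatorSpace.mnorm_nonneg x)) fun v => ?_
  set w : κ → ℂ := (x.map f).mulVec v with hw
  set N := ∑ c, ‖w c‖ ^ 2 with hN
  set V := ∑ d, ‖v d‖ ^ 2 with hV
  have hN0 : 0 ≤ N := by positivity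
  have hV0 : 0 ≤ V := by positivity
  set y : E := ∑ c, ∑ d, (star (w c) * v d) • x c d with hy
  have h1 : (N : ℂ) = f y := by
    rw [hy, map_sum, hN]
    push_cast
    refine Finset.sum_congr rfl fun c _ => ?_
    rw [map_sum, ← Complex.conj_mul' (w c)]
    conv_lhs => rw [hw]
    simp only [Matrix.mulVec, dotProduct, Matrix.map_apply, Finset.mul_sum, map_smul, smul_eq_mul]
    refine Finset.sum_congr rfl fun d _ => ?_
    simp only [hw, Matrix.mulVec, dotProduct, Matrix.map_apply]
    simp only [RCLike.star_def]
    ring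
  have h2 : ‖y‖ ≤ √N * mnorm x * √V := by
    have h := OperatorSpace.mnorm_sandwich_le (Matrix.of fun (_ : Unit) i => star (w i)) x
      (Matrix.of fun i (_ : Unit) => v i)
    refine (hone y).trans (h.trans ?_)
    have a1 := l2_row_le fun i => star (w i)
    have a2 := l2_col_le v
    simp only [norm_star] at a1
    have := OperatorSpace.mnorm_nonneg x
    gcongr
  have h3 : N ≤ ‖f‖ * (√N * mnorm x * √V) := by
    have : ‖(N : ℂ)‖ ≤ ‖f‖ * ‖y‖ := h1 ▸ f.le_opNorm y
    rw [Complex.norm_real, Real.norm_of_nonneg hN0] at this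
    exact this.trans (by gcongr)
  have h4 : √N ≤ ‖f‖ * mnorm x * √V := by
    rcases hN0.eq_or_lt with h | h
    · rw [← h]; have := OperatorSpace.mnorm_nonneg x; simp; positivity
    · have hs : 0 < √N := Real.sqrt_pos.mpr h
      refine le_of_mul_le_mul_left ?_ hs
      rw [Real.mul_self_sqrt hN0]
      linarith
  have h5 := pow_le_pow_left₀ (Real.sqrt_nonneg N) h4 2
  rw [Real.sq_sqrt hN0, mul_pow, Real.sq_sqrt hV0] at h5
  exact h5



section proj
variable {E F : Type*} [AddCommGroup E] [Module ℂ E] [MatrixNorm E]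
  [AddCommGroup F] [Module ℂ F] [MatrixNorm F]

open scoped Kronecker

/-- The operator space projective tensor norm on matrices over the algebraic tensor product:
`‖u‖ = inf { ‖α‖ ‖v‖ ‖w‖ ‖β‖ : u = α (v ⊗ w) β }`. -/
noncomputable def projNorm {ι : Type} [Fintype ι] [DecidableEq ι] (u : Matrix ι ι (E ⊗[ℂ] F)) : ℝ :=
  sInf {r | ∃ (p q : Type) (_ : Fintype p) (_ : DecidableEq p) (_ : Fintype q) (_ : DecidableEq q)
    (α : Matrix ι (p × q) ℂ) (v : Matrix p p E) (w : Matrix q q F) (β : Matrix (p × q) ι ℂ),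
    u = sandwich α (v ⊗ₖₜ[ℂ] w) β ∧ r = ‖α‖ * mnorm v * mnorm w * ‖β‖}

/-- Normalised representations `u = α (v ⊗ w) β`. -/
def ProjRep {ι : Type} [Fintype ι] [DecidableEq ι] (u : Matrix ι ι (E ⊗[ℂ] F)) (s : ℝ) : Prop :=
  0 < s ∧ ∃ (p q : Type) (_ : Fintype p) (_ : DecidableEq p) (_ : Fintype q) (_ : DecidableEq q)
    (α : Matrix ι (p × q) ℂ) (v : Matrix p p E) (w : Matrix q q F) (β : Matrix (p × q) ι ℂ),
    u = sandwich α (v ⊗ₖₜ[ℂ] w) β ∧ ‖α‖ ≤ √s ∧ mnorm v ≤ 1 ∧ mnorm w ≤ 1 ∧ ‖β‖ ≤ √s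

variable [OperatorSpace E] [OperatorSpace F] {ι : Type} [Fintype ι] [DecidableEq ι]

theorem projNorm_nonneg (u : Matrix ι ι (E ⊗[ℂ] F)) : 0 ≤ projNorm u := by
  refine Real.sInf_nonneg ?_
  rintro r ⟨p, q, _, _, _, _, α, v, w, β, -, rfl⟩
  have := OperatorSpace.mnorm_nonneg v
  have := OperatorSpace.mnorm_nonneg w
  positivity

theorem projNorm_le_of_eq {u : Matrix ι ι (E ⊗[ℂ] F)} {p q : Type} [Fintype p] [DecidableEq p]
    [Fintype q] [DecidableEq q] (α : Matrix ι (p × q) ℂ) (v : Matrix p p E) (w : Matrix q q F)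
    (β : Matrix (p × q) ι ℂ) (h : u = sandwich α (v ⊗ₖₜ[ℂ] w) β) :
    projNorm u ≤ ‖α‖ * mnorm v * mnorm w * ‖β‖ := by
  refine csInf_le ⟨0, ?_⟩ ⟨p, q, _, _, _, _, α, v, w, β, h, rfl⟩
  rintro r ⟨p, q, _, _, _, _, α, v, w, β, -, rfl⟩
  have := OperatorSpace.mnorm_nonneg v
  have := OperatorSpace.mnorm_nonneg w
  positivity

theorem ProjRep.le {u : Matrix ι ι (E ⊗[ℂ] F)} {s : ℝ} (h : ProjRep u s) : projNorm u ≤ s := by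
  obtain ⟨hs, p, q, _, _, _, _, α, v, w, β, hu, hα, hv, hw, hβ⟩ := h
  refine (projNorm_le_of_eq α v w β hu).trans ?_
  have := OperatorSpace.mnorm_nonneg v
  have := OperatorSpace.mnorm_nonneg w
  calc _ ≤ √s * 1 * 1 * √s := by gcongr
    _ = s := by rw [mul_one, mul_one, Real.mul_self_sqrt hs.le]

theorem sandwich_smul {E ι κ : Type*} [AddCommGroup E] [Module ℂ E] [Fintype κ] (a b c : ℂ)
    (α : Matrix ι κ ℂ) (x : Matrix κ κ E) (β : Matrix κ ι ℂ) :
    sandwich (a • α) (c • x) (b • β) = (a * b * c) • sandwich α x β := by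
  ext i j
  simp only [sandwich, Matrix.of_apply, Matrix.smul_apply, Finset.smul_sum, smul_smul, smul_eq_mul]
  refine Finset.sum_congr rfl fun _ _ => Finset.sum_congr rfl fun _ _ => ?_
  congr 1
  ring

theorem ProjRep.of_eq {u : Matrix ι ι (E ⊗[ℂ] F)} {p q : Type} [Fintype p] [DecidableEq p]
    [Fintype q] [DecidableEq q] (α : Matrix ι (p × q) ℂ) (v : Matrix p p E) (w : Matrix q q F)
    (β : Matrix (p × q) ι ℂ) (h : u = sandwich α (v ⊗ₖₜ[ℂ] w) β) {s : ℝ}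
    (hs : ‖α‖ * mnorm v * mnorm w * ‖β‖ < s) : ProjRep u s := by
  have hv := OperatorSpace.mnorm_nonneg v
  have hw := OperatorSpace.mnorm_nonneg w
  have hs0 : 0 < s := lt_of_le_of_lt (by positivity) hs
  obtain ⟨δ, hδ, hδs⟩ : ∃ δ > 0,
      (‖α‖ + δ) * (mnorm v + δ) * (mnorm w + δ) * (‖β‖ + δ) < s := by
    have hc : Continuous fun δ : ℝ =>
        (‖α‖ + δ) * (mnorm v + δ) * (mnorm w + δ) * (‖β‖ + δ) := by fun_prop
    have h0 : ∀ᶠ δ in nhds (0 : ℝ),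
        (‖α‖ + δ) * (mnorm v + δ) * (mnorm w + δ) * (‖β‖ + δ) < s :=
      hc.continuousAt.eventually (Iio_mem_nhds (by simpa using hs))
    have h1 : ∀ᶠ δ in nhdsWithin (0 : ℝ) (Set.Ioi 0), 0 < δ ∧
        (‖α‖ + δ) * (mnorm v + δ) * (mnorm w + δ) * (‖β‖ + δ) < s := by
      filter_upwards [h0.filter_mono nhdsWithin_le_nhds, self_mem_nhdsWithin] with δ a b
      exact ⟨b, a⟩
    exact h1.exists
  set V := mnorm v + δ with hV
  set W := mnorm w + δ with hW
  set X := ‖α‖ + δ with hX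
  set Y := ‖β‖ + δ with hY
  have hV0 : 0 < V := by positivity
  have hW0 : 0 < W := by positivity
  have hX0 : 0 < X := by positivity
  have hY0 : 0 < Y := by positivity
  have hr : 0 < √s := Real.sqrt_pos.mpr hs0
  have hrr : √s * √s = s := Real.mul_self_sqrt hs0.le
  refine ⟨hs0, p, q, inferInstance, inferInstance, inferInstance, inferInstance, ((√s / X : ℝ) : ℂ) • α, ((V⁻¹ : ℝ) : ℂ) • v,
    ((W⁻¹ : ℝ) : ℂ) • w, ((V * W * X / √s : ℝ) : ℂ) • β, ?_, ?_, ?_, ?_, ?_⟩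
  · have e : (((V⁻¹ : ℝ) : ℂ) • v) ⊗ₖₜ[ℂ] (((W⁻¹ : ℝ) : ℂ) • w) =
        (((V⁻¹ * W⁻¹ : ℝ)) : ℂ) • (v ⊗ₖₜ[ℂ] w) := by
      ext a b
      simp [TensorProduct.smul_tmul', TensorProduct.tmul_smul, smul_smul,
        mul_comm]
    rw [e, sandwich_smul, ← h, ← Complex.ofReal_mul, ← Complex.ofReal_mul]
    have : √s / X * (V * W * X / √s) * (V⁻¹ * W⁻¹) = 1 := by field_simp
    rw [this]; simp
  · rw [norm_smul, Complex.norm_real, Real.norm_of_nonneg (by positivity), div_mul_eq_mul_div,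
      div_le_iff₀ hX0]
    gcongr
    linarith
  · rw [OperatorSpace.mnorm_smul, Complex.norm_real, Real.norm_of_nonneg (by positivity),
      inv_mul_le_iff₀ hV0]
    linarith
  · rw [OperatorSpace.mnorm_smul, Complex.norm_real, Real.norm_of_nonneg (by positivity),
      inv_mul_le_iff₀ hW0]
    linarith
  · rw [norm_smul, Complex.norm_real, Real.norm_of_nonneg (by positivity), div_mul_eq_mul_div,
      div_le_iff₀ hr, hrr]
    have : ‖β‖ ≤ Y := by linarith
    calc V * W * X * ‖β‖ ≤ V * W * X * Y := by gcongr
      _ = X * V * W * Y := by ring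
      _ ≤ s := hδs.le

/-- Two columns indexed by products, put in the diagonal blocks. -/
def diagCol {ι p p' q q' : Type} (β : Matrix (p × q) ι ℂ) (β' : Matrix (p' × q') ι ℂ) :
    Matrix ((p ⊕ p') × (q ⊕ q')) ι ℂ := Matrix.of fun s b => match s with
  | (Sum.inl i, Sum.inl j) => β (i, j) b
  | (Sum.inr i, Sum.inr j) => β' (i, j) b
  | _ => 0

theorem norm_diagCol_le {ι p p' q q' : Type} [Fintype ι] [DecidableEq ι] [Fintype p] [Fintype p']
    [Fintype q] [Fintype q'] (β : Matrix (p × q) ι ℂ) (β' : Matrix (p' × q') ι ℂ) {s s' : ℝ}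
    (h0 : 0 ≤ s) (h0' : 0 ≤ s') (h : ‖β‖ ≤ √s) (h' : ‖β'‖ ≤ √s') :
    ‖diagCol β β'‖ ≤ √(s + s') := by
  refine l2_le _ (by positivity) fun v => ?_
  have h1 := l2_apply β v
  have h2 := l2_apply β' v
  rw [Real.sq_sqrt (by positivity), add_mul]
  have e1 : ‖β‖ ^ 2 ≤ s := (pow_le_pow_left₀ (norm_nonneg _) h 2).trans (Real.sq_sqrt h0).le
  have e2 : ‖β'‖ ^ 2 ≤ s' := (pow_le_pow_left₀ (norm_nonneg _) h' 2).trans (Real.sq_sqrt h0').le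
  have e3 : ∑ i, ‖((diagCol β β').mulVec v) i‖ ^ 2 =
      ∑ i, ‖(β.mulVec v) i‖ ^ 2 + ∑ i, ‖(β'.mulVec v) i‖ ^ 2 := by
    simp [Fintype.sum_prod_type, diagCol, Matrix.mulVec, dotProduct]
  rw [e3]
  gcongr
  · exact h1.trans (by gcongr)
  · exact h2.trans (by gcongr)

theorem ProjRep.add {u u' : Matrix ι ι (E ⊗[ℂ] F)} {s s' : ℝ} (h : ProjRep u s)
    (h' : ProjRep u' s') : ProjRep (u + u') (s + s') := by
  obtain ⟨hs, p, q, _, _, _, _, α, v, w, β, hu, hα, hv, hw, hβ⟩ := h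
  obtain ⟨hs', p', q', _, _, _, _, α', v', w', β', hu', hα', hv', hw', hβ'⟩ := h'
  refine ⟨by positivity, p ⊕ p', q ⊕ q', inferInstance, inferInstance, inferInstance,
    inferInstance, (diagCol α.transpose α'.transpose).transpose, Matrix.fromBlocks v 0 0 v',
    Matrix.fromBlocks w 0 0 w', diagCol β β', ?_, ?_, ?_, ?_, ?_⟩
  · rw [hu, hu']
    ext a b
    simp [sandwich, diagCol, Fintype.sum_prod_type]
  · have e : (diagCol α.transpose α'.transpose).transpose =
        (diagCol α.conjTranspose α'.conjTranspose).conjTranspose := by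
      ext a ⟨i | i, j | j⟩ <;> simp [diagCol]
    rw [e, Matrix.l2_opNorm_conjTranspose]
    refine norm_diagCol_le _ _ hs.le hs'.le ?_ ?_
    · rwa [Matrix.l2_opNorm_conjTranspose]
    · rwa [Matrix.l2_opNorm_conjTranspose]
  · exact (OperatorSpace.mnorm_fromBlocks_le _ _).trans (max_le hv hv')
  · exact (OperatorSpace.mnorm_fromBlocks_le _ _).trans (max_le hw hw')
  · exact norm_diagCol_le _ _ hs.le hs'.le hβ hβ'

theorem ProjRep.of_lt {u : Matrix ι ι (E ⊗[ℂ] F)} {s₀ s : ℝ} (h₀ : ProjRep u s₀)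
    (h : projNorm u < s) : ProjRep u s := by
  obtain ⟨-, p, q, _, _, _, _, α, v, w, β, hu, -⟩ := h₀
  unfold projNorm at h
  obtain ⟨r, hr, hrs⟩ := exists_lt_of_csInf_lt (by
    exact ⟨_, p, q, inferInstance, inferInstance, inferInstance, inferInstance,
      α, v, w, β, hu, rfl⟩) h
  obtain ⟨p, q, _, _, _, _, α, v, w, β, hu, rfl⟩ := hr
  exact ProjRep.of_eq α v w β hu hrs

theorem exists_projRep (u : E ⊗[ℂ] F) : ∃ s, ProjRep (oneByOne _ u) s := by
  have tm : ∀ (a : E) (b : F), oneByOne _ (a ⊗ₜ[ℂ] b) = sandwich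
      (Matrix.of fun (_ : Unit) (_ : Unit × Unit) => 1) (oneByOne E a ⊗ₖₜ[ℂ] oneByOne F b)
      (Matrix.of fun (_ : Unit × Unit) (_ : Unit) => 1) := by
    intro a b
    ext i j
    simp [sandwich, oneByOne]
  induction u using TensorProduct.induction_on with
  | zero =>
    have := tm 0 0
    rw [TensorProduct.zero_tmul] at this
    exact ⟨_, ProjRep.of_eq _ _ _ _ this (lt_add_one _)⟩
  | tmul a b => exact ⟨_, ProjRep.of_eq _ _ _ _ (tm a b) (lt_add_one _)⟩
  | add u u' h h' =>
    obtain ⟨s, h⟩ := h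
    obtain ⟨s', h'⟩ := h'
    exact ⟨s + s', h.add h'⟩

theorem projNorm_one_add_le (u u' : E ⊗[ℂ] F) :
    projNorm (oneByOne _ (u + u')) ≤ projNorm (oneByOne _ u) + projNorm (oneByOne _ u') := by
  refine le_of_forall_pos_le_add fun ε hε => ?_
  obtain ⟨s, h⟩ := exists_projRep u
  obtain ⟨s', h'⟩ := exists_projRep u'
  have h1 := h.of_lt (lt_add_of_pos_right _ (half_pos hε))
  have h2 := h'.of_lt (lt_add_of_pos_right _ (half_pos hε))
  have h3 := (h1.add h2).le
  have e : oneByOne _ u + oneByOne _ u' = oneByOne _ (u + u') := rfl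
  rw [e] at h3
  linarith

theorem projNorm_one_smul_le (c : ℂ) (u : E ⊗[ℂ] F) :
    projNorm (oneByOne _ (c • u)) ≤ ‖c‖ * projNorm (oneByOne _ u) := by
  have key : ∀ s, projNorm (oneByOne _ u) < s → projNorm (oneByOne _ (c • u)) ≤ ‖c‖ * s := by
    intro s hs
    obtain ⟨s₀, h⟩ := exists_projRep u
    obtain ⟨hs0, p, q, _, _, _, _, α, v, w, β, hu, hα, hv, hw, hβ⟩ := h.of_lt hs
    have e : oneByOne _ (c • u) = sandwich (c • α) (v ⊗ₖₜ[ℂ] w) β := by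
      have := sandwich_smul c 1 1 α (v ⊗ₖₜ[ℂ] w) β
      simp only [one_smul, mul_one] at this
      rw [this, ← hu]
      rfl
    refine (projNorm_le_of_eq _ _ _ _ e).trans ?_
    have := OperatorSpace.mnorm_nonneg v
    have := OperatorSpace.mnorm_nonneg w
    rw [norm_smul]
    calc _ ≤ ‖c‖ * √s * 1 * 1 * √s := by gcongr
      _ = ‖c‖ * (√s * √s) := by ring
      _ = ‖c‖ * s := by rw [Real.mul_self_sqrt hs0.le]
  refine ge_of_tendsto (x := nhdsWithin (projNorm (oneByOne _ u)) (Set.Ioi (projNorm (oneByOne _ u))))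
    (f := fun s => ‖c‖ * s) ?_ ?_
  · exact (Continuous.tendsto (by fun_prop) _).mono_left nhdsWithin_le_nhds
  · filter_upwards [self_mem_nhdsWithin] with s hs using key s hs

variable (E F) in
/-- The algebraic tensor product, to be normed by the operator space projective tensor norm. -/
def AlgTensor : Type _ := E ⊗[ℂ] F

noncomputable instance : AddCommGroup (AlgTensor E F) := inferInstanceAs (AddCommGroup (E ⊗[ℂ] F))

noncomputable instance : Module ℂ (AlgTensor E F) := inferInstanceAs (Module ℂ (E ⊗[ℂ] F))

noncomputable instance : MatrixNorm (AlgTensor E F) where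
  mnorm u := projNorm (E := E) (F := F) u

noncomputable instance : SeminormedAddCommGroup (AlgTensor E F) :=
  AddGroupSeminorm.toSeminormedAddCommGroup
    { toFun := fun u => projNorm (E := E) (F := F) (oneByOne _ u)
      map_zero' := le_antisymm (by
        have h := projNorm_one_smul_le (0 : ℂ) (0 : E ⊗[ℂ] F)
        rw [zero_smul, norm_zero, zero_mul] at h
        exact h) (projNorm_nonneg _)
      add_le' := projNorm_one_add_le (E := E) (F := F)
      neg' := by
        have key : ∀ u : E ⊗[ℂ] F, projNorm (oneByOne _ (-u)) ≤ projNorm (oneByOne _ u) := by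
          intro u
          have h := projNorm_one_smul_le (-1 : ℂ) u
          rwa [neg_one_smul, norm_neg, norm_one, one_mul] at h
        have key' : ∀ u : E ⊗[ℂ] F, projNorm (oneByOne _ (-u)) = projNorm (oneByOne _ u) := by
          intro u
          refine le_antisymm (key u) ?_
          have h := key (-u)
          rwa [neg_neg] at h
        exact key' }

noncomputable instance : NormedSpace ℂ (AlgTensor E F) where
  norm_smul_le c u := projNorm_one_smul_le (E := E) (F := F) c u

end proj

/-! ### Completely bounded maps, completions and quotients -/

/-- The completely bounded norm of a (completely bounded) map. -/
noncomputable def cbNorm {E F : Type*} [AddCommGroup E] [Module ℂ E] [MatrixNorm E]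
    [AddCommGroup F] [Module ℂ F] [MatrixNorm F] (T : E →ₗ[ℂ] F) : ℝ :=
  sInf {C | 0 ≤ C ∧ ∀ (κ : Type) [Fintype κ] [DecidableEq κ] (x : Matrix κ κ E),
    mnorm (x.map T) ≤ C * mnorm x}

/-- Complete contractions: every amplification is contractive. -/
def IsCompleteContraction {E F : Type*} [AddCommGroup E] [Module ℂ E] [MatrixNorm E]
    [AddCommGroup F] [Module ℂ F] [MatrixNorm F] (T : E →ₗ[ℂ] F) : Prop :=
  ∀ (κ : Type) [Fintype κ] [DecidableEq κ] (x : Matrix κ κ E), mnorm (x.map T) ≤ mnorm x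

/-- Complete isometries: every amplification is isometric. -/
def IsCompleteIsometry {E F : Type*} [AddCommGroup E] [Module ℂ E] [MatrixNorm E]
    [AddCommGroup F] [Module ℂ F] [MatrixNorm F] (T : E →ₗ[ℂ] F) : Prop :=
  ∀ (κ : Type) [Fintype κ] [DecidableEq κ] (x : Matrix κ κ E), mnorm (x.map T) = mnorm x

/-- The matrix norms of a completion: the closed ball of radius `r` in `M_ι` of the completion is
(up to arbitrarily small increase of `r`) the closure of the ball of radius `r` in `M_ι(V)`. -/
noncomputable instance {V : Type*} [SeminormedAddCommGroup V] [MatrixNorm V] :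
    MatrixNorm (UniformSpace.Completion V) where
  mnorm {ι} _ _ U := sInf {r | 0 ≤ r ∧
    U ∈ closure ((fun u : Matrix ι ι V => u.map fun v => (v : UniformSpace.Completion V)) ''
      {u | mnorm u ≤ r})}

/-- The operator space projective tensor product. -/
abbrev ProjTensor (E F : Type*) [AddCommGroup E] [Module ℂ E] [MatrixNorm E] [OperatorSpace E]
    [AddCommGroup F] [Module ℂ F] [MatrixNorm F] [OperatorSpace F] : Type _ :=
  UniformSpace.Completion (AlgTensor E F)

/-- Elementary tensors in the algebraic tensor product. -/
def AlgTensor.tmul {E F : Type*} [AddCommGroup E] [Module ℂ E] [AddCommGroup F] [Module ℂ F]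
    (a : E) (b : F) : AlgTensor E F := a ⊗ₜ[ℂ] b

/-- Elementary tensors in the projective tensor product. -/
noncomputable def ProjTensor.tmul {E F : Type*} [AddCommGroup E] [Module ℂ E] [MatrixNorm E]
    [OperatorSpace E] [AddCommGroup F] [Module ℂ F] [MatrixNorm F] [OperatorSpace F] (a : E) (b : F) :
    ProjTensor E F := ((AlgTensor.tmul a b : AlgTensor E F) : UniformSpace.Completion _)

section
variable {T V : Type*} [NormedAddCommGroup T] [NormedSpace ℂ T] [NormedAddCommGroup V]
  [NormedSpace ℂ V] (Φ : T →L[ℂ] V)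

/-- The range of `Φ`, with the operator space structure that makes `Φ` a complete quotient map onto
it (and not the one inherited from `V`). -/
def QuotientRange : Type _ := LinearMap.range Φ.toLinearMap

noncomputable instance : AddCommGroup (QuotientRange Φ) :=
  inferInstanceAs (AddCommGroup (LinearMap.range Φ.toLinearMap))

noncomputable instance : Module ℂ (QuotientRange Φ) :=
  inferInstanceAs (Module ℂ (LinearMap.range Φ.toLinearMap))

/-- The inclusion of the range of `Φ` into the codomain. -/
def QuotientRange.incl : QuotientRange Φ →ₗ[ℂ] V := (LinearMap.range Φ.toLinearMap).subtype

/-- The quotient matrix norms: the infimum of the norms of the preimages. -/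
noncomputable instance [MatrixNorm T] : MatrixNorm (QuotientRange Φ) where
  mnorm {ι} _ _ y := sInf {r | ∃ U : Matrix ι ι T,
    U.map Φ = y.map (QuotientRange.incl Φ) ∧ r = mnorm U}
end

/-! ### Row Hilbert spaces, weights and direct sums -/

/-- The space `(S²_m)_r` of `m × m` matrices with the Hilbert-Schmidt norm, as a row operator
space. -/
def HSRow (m : ℕ) : Type := Matrix (Fin m) (Fin m) ℂ

noncomputable instance (m : ℕ) : AddCommGroup (HSRow m) :=
  inferInstanceAs (AddCommGroup (Matrix (Fin m) (Fin m) ℂ))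

noncomputable instance (m : ℕ) : Module ℂ (HSRow m) :=
  inferInstanceAs (Module ℂ (Matrix (Fin m) (Fin m) ℂ))

/-- A matrix over the row Hilbert space as a block row matrix: the entry `x a b`, listed in the
orthonormal basis of matrix units, is a row of scalars. -/
def HSRow.row {m : ℕ} {ι : Type} (x : Matrix ι ι (HSRow m)) :
    Matrix ι (ι × (Fin m × Fin m)) ℂ :=
  Matrix.of fun a s => (x a s.1 : Matrix (Fin m) (Fin m) ℂ) s.2.1 s.2.2

noncomputable instance (m : ℕ) : MatrixNorm (HSRow m) where
  mnorm x := ‖HSRow.row x‖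

theorem mnorm_hsRow_def {m : ℕ} {ι : Type} [Fintype ι] [DecidableEq ι] (x : Matrix ι ι (HSRow m)) :
    mnorm x = ‖HSRow.row x‖ := rfl

instance (m : ℕ) : OperatorSpace (HSRow m) where
  mnorm_add_le x y := norm_add_le (HSRow.row x) (HSRow.row y)
  mnorm_smul c x := norm_smul c (HSRow.row x)
  eq_zero_of_mnorm x h := by
    have h0 : HSRow.row x = 0 := norm_eq_zero.mp h
    refine Matrix.ext fun i j => Matrix.ext fun a b => ?_
    exact congrFun (congrFun h0 i) (j, (a, b))
  mnorm_fromBlocks_le {ι κ} _ _ _ _ x y := by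
    have h : HSRow.row (Matrix.fromBlocks x 0 0 y) =
        (Matrix.fromBlocks (HSRow.row x) 0 0 (HSRow.row y)).submatrix
          (Equiv.refl _) (Equiv.sumProdDistrib ι κ (Fin m × Fin m)) := by
      ext (i | i) ⟨j | j, a⟩ <;> rfl
    rw [mnorm_hsRow_def, h]
    exact l2_block _ _ (HSRow.row x) (HSRow.row y)
  mnorm_sandwich_le {ι κ} _ _ _ _ α x β := by
    have h : HSRow.row (sandwich α x β) = α * HSRow.row x *
        (Matrix.of fun (p : κ × (Fin m × Fin m)) (q : ι × (Fin m × Fin m)) =>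
          if p.2 = q.2 then β p.1 q.1 else 0) := by
      ext i ⟨j, a⟩
      let L : HSRow m →ₗ[ℂ] ℂ :=
        { toFun := fun y => (y : Matrix (Fin m) (Fin m) ℂ) a.1 a.2
          map_add' := fun _ _ => rfl
          map_smul' := fun _ _ => rfl }
      have e1 : HSRow.row (sandwich α x β) i (j, a) = L (∑ s, ∑ t, (α i s * β t j) • x s t) := rfl
      have e2 : ∀ s t, HSRow.row x s (t, a) = L (x s t) := fun _ _ => rfl
      rw [e1]
      simp only [map_sum, map_smul, smul_eq_mul, ← e2, Matrix.mul_apply, Matrix.of_apply,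
        Fintype.sum_prod_type, mul_ite, mul_zero, Finset.sum_ite_eq', Finset.mem_univ, if_true,
        Finset.sum_mul]
      rw [Finset.sum_comm]
      exact Finset.sum_congr rfl fun _ _ => Finset.sum_congr rfl fun _ _ => by ring
    rw [mnorm_hsRow_def, mnorm_hsRow_def, h]
    refine (Matrix.l2_opNorm_mul _ _).trans ?_
    gcongr
    · exact Matrix.l2_opNorm_mul _ _
    · exact l2_kron_one β

/-- The space `E` with all matrix norms multiplied by `c`. -/
def Scaled (_c : ℝ) (E : Type*) : Type _ := E

section
variable (c : ℝ) (E : Type*) [AddCommGroup E] [Module ℂ E]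

instance : AddCommGroup (Scaled c E) := inferInstanceAs (AddCommGroup E)

instance : Module ℂ (Scaled c E) := inferInstanceAs (Module ℂ E)

noncomputable instance [MatrixNorm E] : MatrixNorm (Scaled c E) where
  mnorm x := c * mnorm (E := E) x

instance [MatrixNorm E] [OperatorSpace E] [hc : Fact (0 < c)] : OperatorSpace (Scaled c E) where
  mnorm_add_le x y := by
    have := OperatorSpace.mnorm_add_le (E := E) x y
    exact (mul_le_mul_of_nonneg_left this hc.out.le).trans (mul_add _ _ _).le
  mnorm_smul a x := by
    have := OperatorSpace.mnorm_smul (E := E) a x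
    exact (congrArg (c * ·) this).trans (mul_left_comm _ _ _)
  eq_zero_of_mnorm x h := OperatorSpace.eq_zero_of_mnorm (E := E) x
    ((mul_eq_zero.mp h).resolve_left hc.out.ne')
  mnorm_fromBlocks_le x y := by
    have := OperatorSpace.mnorm_fromBlocks_le (E := E) x y
    exact (mul_le_mul_of_nonneg_left this hc.out.le).trans (mul_max_of_nonneg _ _ hc.out.le).le
  mnorm_sandwich_le α x β := by
    have := OperatorSpace.mnorm_sandwich_le (E := E) α x β
    refine (mul_le_mul_of_nonneg_left this hc.out.le).trans (le_of_eq ?_)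
    change c * (‖α‖ * mnorm (E := E) x * ‖β‖) = ‖α‖ * (c * mnorm (E := E) x) * ‖β‖
    ring
end

section l1
variable {I : Type*} (E : I → Type*) [∀ i, AddCommGroup (E i)] [∀ i, Module ℂ (E i)]
  [∀ i, MatrixNorm (E i)] [∀ i, OperatorSpace (E i)]

/-- The absolutely summable families. -/
def l1Sum : Submodule ℂ (∀ i, E i) where
  carrier := {x | Summable fun i => mnorm (oneByOne (E i) (x i))}
  zero_mem' := by
    have : ∀ i, mnorm (oneByOne (E i) 0) = 0 := fun i => OperatorSpace.mnorm_zero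
    simp [this, summable_zero]
  add_mem' {x y} hx hy := Summable.of_nonneg_of_le (fun i => OperatorSpace.mnorm_nonneg _)
    (fun i => OperatorSpace.mnorm_add_le (oneByOne (E i) (x i)) (oneByOne (E i) (y i)))
    (Summable.add hx hy)
  smul_mem' c x hx := by
    have h : ∀ i, mnorm (oneByOne (E i) ((c • x) i)) = ‖c‖ * mnorm (oneByOne (E i) (x i)) :=
      fun i => OperatorSpace.mnorm_smul c (oneByOne (E i) (x i))
    simp only [Set.mem_ofPred_eq, h]
    exact Summable.mul_left _ hx

/-- The operator space structure of an `ℓ¹`-direct sum, given by its universal property: families of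
complete contractions `T i : E i → M_k` are the complete contractions of the sum into `M_k`. -/
noncomputable instance : MatrixNorm (l1Sum E) where
  mnorm {ι} _ _ x := sSup {r | ∃ (k : ℕ) (T : ∀ i, E i →ₗ[ℂ] Matrix (Fin k) (Fin k) ℂ),
    (∀ i, IsCompleteContraction (T i)) ∧
    r = mnorm (Matrix.of fun a b : ι => ∑' i, T i ((x a b : ∀ i, E i) i))}
end l1

/-! ### The dual von Neumann algebra and the Fourier algebra -/

section linf
variable {I : Type*} (n : I → ℕ)

/-- The von Neumann algebra `ℓ^∞-⨁_α M_{n_α}` of bounded families of matrices. -/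
def LInfDual : Type _ := lp (fun α : I => Matrix (Fin (n α)) (Fin (n α)) ℂ) ⊤

noncomputable instance : NormedAddCommGroup (LInfDual n) :=
  inferInstanceAs (NormedAddCommGroup (lp (fun α : I => Matrix (Fin (n α)) (Fin (n α)) ℂ) ⊤))

noncomputable instance : NormedSpace ℂ (LInfDual n) :=
  inferInstanceAs (NormedSpace ℂ (lp (fun α : I => Matrix (Fin (n α)) (Fin (n α)) ℂ) ⊤))

variable {n}

/-- The component of a bounded family at `α`. -/
def LInfDual.coord (α : I) : LInfDual n →ₗ[ℂ] Matrix (Fin (n α)) (Fin (n α)) ℂ where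
  toFun a := (show lp (fun α : I => Matrix (Fin (n α)) (Fin (n α)) ℂ) ⊤ from a).1 α
  map_add' _ _ := rfl
  map_smul' _ _ := rfl

theorem LInfDual.ext {a b : LInfDual n} (h : ∀ α, LInfDual.coord α a = LInfDual.coord α b) :
    a = b := lp.ext (E := fun α : I => Matrix (Fin (n α)) (Fin (n α)) ℂ) (p := ⊤) (funext h)

theorem LInfDual.norm_coord_le (a : LInfDual n) (α : I) : ‖LInfDual.coord α a‖ ≤ ‖a‖ :=
  lp.norm_apply_le_norm (E := fun α : I => Matrix (Fin (n α)) (Fin (n α)) ℂ) (p := ⊤) (by simp) a α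

theorem LInfDual.norm_le {a : LInfDual n} {C : ℝ} (hC : 0 ≤ C)
    (h : ∀ α, ‖LInfDual.coord α a‖ ≤ C) : ‖a‖ ≤ C :=
  lp.norm_le_of_forall_le (E := fun α : I => Matrix (Fin (n α)) (Fin (n α)) ℂ) hC h

/-- The operator space structure of the von Neumann algebra `ℓ^∞-⨁_α M_{n_α}`. -/
noncomputable instance : MatrixNorm (LInfDual n) where
  mnorm x := ⨆ α : I, mnorm (x.map (LInfDual.coord α))

theorem mnorm_linf_def {ι : Type} [Fintype ι] [DecidableEq ι] (x : Matrix ι ι (LInfDual n)) :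
    mnorm x = ⨆ α : I, mnorm (x.map (LInfDual.coord α)) := rfl

theorem linf_bdd {ι : Type} [Fintype ι] [DecidableEq ι] (x : Matrix ι ι (LInfDual n)) :
    BddAbove (Set.range fun α : I => mnorm (x.map (LInfDual.coord α))) := by
  refine ⟨∑ i, ∑ j, ‖x i j‖, ?_⟩
  rintro _ ⟨α, rfl⟩
  refine (OperatorSpace.mnorm_le_sum _).trans ?_
  gcongr with i _ j _
  rw [mnorm_one_matrix]
  exact LInfDual.norm_coord_le (x i j) α

theorem linf_le {ι : Type} [Fintype ι] [DecidableEq ι] (x : Matrix ι ι (LInfDual n)) (α : I) :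
    mnorm (x.map (LInfDual.coord α)) ≤ mnorm x := le_ciSup (linf_bdd x) α

theorem linf_nonneg {ι : Type} [Fintype ι] [DecidableEq ι] (x : Matrix ι ι (LInfDual n)) :
    0 ≤ mnorm x := Real.iSup_nonneg fun _ => OperatorSpace.mnorm_nonneg _

theorem linf_mnorm_le {ι : Type} [Fintype ι] [DecidableEq ι] (x : Matrix ι ι (LInfDual n)) {C : ℝ}
    (hC : 0 ≤ C) (h : ∀ α : I, mnorm (x.map (LInfDual.coord α)) ≤ C) : mnorm x ≤ C :=
  Real.iSup_le h hC

instance : OperatorSpace (LInfDual n) where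
  mnorm_add_le x y := by
    refine linf_mnorm_le _ (add_nonneg (linf_nonneg x) (linf_nonneg y)) fun α => ?_
    have e : (x + y).map (LInfDual.coord α) = x.map (LInfDual.coord α) + y.map (LInfDual.coord α) := by
      ext : 2; simp
    rw [e]
    exact (OperatorSpace.mnorm_add_le (x.map (LInfDual.coord α)) (y.map (LInfDual.coord α))).trans
      (add_le_add (linf_le x α) (linf_le y α))
  mnorm_smul c x := by
    rw [mnorm_linf_def, mnorm_linf_def, Real.mul_iSup_of_nonneg (norm_nonneg c)]
    congr 1
    ext α
    have e : (c • x).map (LInfDual.coord α) = c • x.map (LInfDual.coord α) := by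
      ext : 2; simp
    rw [e]
    exact OperatorSpace.mnorm_smul c (x.map (LInfDual.coord α))
  eq_zero_of_mnorm x h := by
    refine Matrix.ext fun i j => LInfDual.ext fun α => ?_
    have h1 := le_antisymm ((linf_le x α).trans h.le) (OperatorSpace.mnorm_nonneg _)
    simpa using congrFun (congrFun (OperatorSpace.eq_zero_of_mnorm _ h1) i) j
  mnorm_fromBlocks_le x y := by
    refine linf_mnorm_le _ (le_max_of_le_left (linf_nonneg x)) fun α => ?_
    have h := OperatorSpace.mnorm_fromBlocks_le (x.map (LInfDual.coord α)) (y.map (LInfDual.coord α))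
    have e : (Matrix.fromBlocks x 0 0 y).map (LInfDual.coord α) =
        Matrix.fromBlocks (x.map (LInfDual.coord α)) 0 0 (y.map (LInfDual.coord α)) := by
      rw [Matrix.fromBlocks_map]; simp
    rw [e]
    exact h.trans (max_le_max (linf_le x α) (linf_le y α))
  mnorm_sandwich_le α x β := by
    refine linf_mnorm_le _
      (mul_nonneg (mul_nonneg (norm_nonneg _) (linf_nonneg x)) (norm_nonneg _)) fun i => ?_
    have h := OperatorSpace.mnorm_sandwich_le α (x.map (LInfDual.coord i)) β
    have e : (sandwich α x β).map (LInfDual.coord i) =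
        sandwich α (x.map (LInfDual.coord i)) β := by
      ext a b : 2
      simp only [sandwich, Matrix.map_apply, Matrix.of_apply, map_sum, map_smul]
    rw [e]
    refine h.trans ?_
    gcongr
    exact linf_le x i

theorem mnorm_one_linf (a : LInfDual n) : mnorm (oneByOne _ a) = ‖a‖ := by
  apply le_antisymm
  · refine linf_mnorm_le _ (norm_nonneg _) fun α => ?_
    exact (mnorm_one_matrix (LInfDual.coord α a)).le.trans (LInfDual.norm_coord_le a α)
  · refine LInfDual.norm_le (linf_nonneg _) fun α => ?_
    exact (mnorm_one_matrix (LInfDual.coord α a)).ge.trans (linf_le (oneByOne _ a) α)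

theorem linf_functional (f : StrongDual ℂ (LInfDual n)) {κ : Type} [Fintype κ] [DecidableEq κ]
    (x : Matrix κ κ (LInfDual n)) : ‖(x.map f : Matrix κ κ ℂ)‖ ≤ ‖f‖ * mnorm x :=
  norm_map_functional_le (fun a => (mnorm_one_linf a).ge) f x

/-- The functional `a ↦ n_α Tr(a_α Y)`, that is `a ↦ ĥ(a Y)` with `ĥ(a) = ∑_α n_α Tr(a_α)` and `Y`
in the block `α`. -/
noncomputable def blockFunctional (α : I) (Y : Matrix (Fin (n α)) (Fin (n α)) ℂ) :
    StrongDual ℂ (LInfDual n) :=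
  LinearMap.mkContinuousOfExistsBound
    (((n α : ℂ) • (Matrix.traceLinearMap (Fin (n α)) ℂ ℂ ∘ₗ LinearMap.mulRight ℂ Y)) ∘ₗ
      LInfDual.coord α) (by
    let L : Matrix (Fin (n α)) (Fin (n α)) ℂ →L[ℂ] ℂ := LinearMap.toContinuousLinearMap
      ((n α : ℂ) • (Matrix.traceLinearMap (Fin (n α)) ℂ ℂ ∘ₗ LinearMap.mulRight ℂ Y))
    obtain ⟨C, hC, h⟩ := L.bound
    exact ⟨C, fun a => (h (LInfDual.coord α a)).trans
      (mul_le_mul_of_nonneg_left (LInfDual.norm_coord_le a α) hC.le)⟩)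

theorem blockFunctional_apply (α : I) (Y : Matrix (Fin (n α)) (Fin (n α)) ℂ) (a : LInfDual n) :
    blockFunctional α Y a = n α * (LInfDual.coord α a * Y).trace := rfl

variable (n) in
/-- The predual of `ℓ^∞-⨁_α M_{n_α}` inside its dual: the norm closure of the functionals supported
on finitely many blocks. -/
noncomputable def fourierSubmodule : Submodule ℂ (StrongDual ℂ (LInfDual n)) :=
  (Submodule.span ℂ {ω | ∃ (α : I) (Y : Matrix (Fin (n α)) (Fin (n α)) ℂ),
    ω = blockFunctional α Y}).topologicalClosure

variable (n) in
/-- The Fourier algebra `A(G)`, the predual of `ℓ^∞(Ĝ) = ℓ^∞-⨁_α M_{n_α}`. -/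
def FourierAlgebra : Type _ := fourierSubmodule n

noncomputable instance : NormedAddCommGroup (FourierAlgebra n) :=
  Submodule.normedAddCommGroup (fourierSubmodule n)

noncomputable instance : NormedSpace ℂ (FourierAlgebra n) :=
  Submodule.normedSpace (fourierSubmodule n)

variable (n) in
/-- The inclusion of the predual into the dual. -/
noncomputable def FourierAlgebra.toDual : FourierAlgebra n →ₗ[ℂ] StrongDual ℂ (LInfDual n) :=
  (fourierSubmodule n).subtype

/-- A matrix over the predual as a map `ℓ^∞(Ĝ) → M_ι`. -/
noncomputable def toMatrixMap {ι : Type} (f : Matrix ι ι (FourierAlgebra n)) :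
    LInfDual n →ₗ[ℂ] Matrix ι ι ℂ where
  toFun a := Matrix.of fun i j => (FourierAlgebra.toDual n (f i j)) a
  map_add' a b := by ext i j; simp
  map_smul' c a := by ext i j; simp

/-- The operator space structure of a predual, from `M_ι(M_*) ⊆ CB(M, M_ι)`. -/
noncomputable instance : MatrixNorm (FourierAlgebra n) where
  mnorm f := cbNorm (toMatrixMap f)

section
variable {ι κ : Type} [Fintype ι] [DecidableEq ι] [Fintype κ] [DecidableEq κ]

theorem mnorm_map_toMatrixMap (f : Matrix ι ι (FourierAlgebra n)) (x : Matrix κ κ (LInfDual n)) :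
    mnorm (x.map (toMatrixMap f)) =
      mnorm (Matrix.of fun i j => x.map (FourierAlgebra.toDual n (f i j))) :=
  le_antisymm
    (l2_submatrix_le (Equiv.prodComm _ _) (Equiv.prodComm _ _)
      (Matrix.comp _ _ _ _ ℂ (Matrix.of fun i j => x.map (FourierAlgebra.toDual n (f i j)))))
    (l2_submatrix_le (Equiv.prodComm _ _) (Equiv.prodComm _ _)
      (Matrix.comp _ _ _ _ ℂ (x.map (toMatrixMap f))))

theorem toMatrixMap_cb (f : Matrix ι ι (FourierAlgebra n)) (x : Matrix κ κ (LInfDual n)) :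
    mnorm (x.map (toMatrixMap f)) ≤ (∑ i, ∑ j, ‖f i j‖) * mnorm x := by
  rw [mnorm_map_toMatrixMap]
  refine (OperatorSpace.mnorm_le_sum _).trans ?_
  rw [Finset.sum_mul]
  refine Finset.sum_le_sum fun i _ => ?_
  rw [Finset.sum_mul]
  refine Finset.sum_le_sum fun j _ => ?_
  rw [mnorm_one_matrix]
  exact linf_functional (FourierAlgebra.toDual n (f i j)) x

theorem fourier_nonneg (f : Matrix ι ι (FourierAlgebra n)) : 0 ≤ mnorm f :=
  Real.sInf_nonneg fun _ h => h.1

theorem fourier_le (f : Matrix ι ι (FourierAlgebra n)) {C : ℝ} (hC : 0 ≤ C)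
    (h : ∀ (κ : Type) [Fintype κ] [DecidableEq κ] (x : Matrix κ κ (LInfDual n)),
      mnorm (x.map (toMatrixMap f)) ≤ C * mnorm x) : mnorm f ≤ C :=
  csInf_le ⟨0, fun _ h => h.1⟩ ⟨hC, h⟩

theorem fourier_apply (f : Matrix ι ι (FourierAlgebra n)) (x : Matrix κ κ (LInfDual n)) :
    mnorm (x.map (toMatrixMap f)) ≤ mnorm f * mnorm x := by
  have hne : {C : ℝ | 0 ≤ C ∧ ∀ (κ : Type) [Fintype κ] [DecidableEq κ]
      (x : Matrix κ κ (LInfDual n)), mnorm (x.map (toMatrixMap f)) ≤ C * mnorm x}.Nonempty :=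
    ⟨_, by positivity, fun κ _ _ x => toMatrixMap_cb f x⟩
  rcases (linf_nonneg x).eq_or_lt with h | h
  · obtain ⟨C, -, hC⟩ := hne
    have := hC κ x
    rw [← h] at this ⊢
    simpa using this
  · rw [← div_le_iff₀ h]
    refine le_csInf hne ?_
    rintro C ⟨-, hC⟩
    rw [div_le_iff₀ h]
    exact hC κ x

end

instance : OperatorSpace (FourierAlgebra n) where
  mnorm_add_le f g := by
    refine fourier_le _ (add_nonneg (fourier_nonneg f) (fourier_nonneg g)) fun κ _ _ x => ?_
    have e : x.map (toMatrixMap (f + g)) = x.map (toMatrixMap f) + x.map (toMatrixMap g) := by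
      ext; simp [toMatrixMap]
    rw [e, add_mul]
    exact (OperatorSpace.mnorm_add_le _ _).trans (add_le_add (fourier_apply f x) (fourier_apply g x))
  mnorm_smul {ι} _ _ c f := by
    have key : ∀ (c : ℂ) (f : Matrix ι ι (FourierAlgebra n)), mnorm (c • f) ≤ ‖c‖ * mnorm f := by
      intro c f
      refine fourier_le _ (mul_nonneg (norm_nonneg c) (fourier_nonneg f)) fun κ _ _ x => ?_
      have e : x.map (toMatrixMap (c • f)) = c • x.map (toMatrixMap f) := by
        ext; simp [toMatrixMap]
      rw [e, OperatorSpace.mnorm_smul, mul_assoc]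
      gcongr
      exact fourier_apply f x
    refine le_antisymm (key c f) ?_
    rcases eq_or_ne c 0 with rfl | hc
    · simpa using fourier_nonneg ((0 : ℂ) • f)
    · have h := key c⁻¹ (c • f)
      rw [inv_smul_smul₀ hc, norm_inv] at h
      rwa [← le_inv_mul_iff₀ (norm_pos_iff.mpr hc)]
  eq_zero_of_mnorm f h := by
    refine Matrix.ext fun i j => Subtype.ext (ContinuousLinearMap.ext fun a => ?_)
    change FourierAlgebra.toDual n (f i j) a = 0
    have h1 := fourier_apply f (oneByOne _ a)
    rw [h, zero_mul] at h1
    have h2 := OperatorSpace.eq_zero_of_mnorm _ (le_antisymm h1 (OperatorSpace.mnorm_nonneg _))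
    have h3 := congrFun (congrFun (congrFun (congrFun h2 ()) ()) i) j
    simpa [toMatrixMap, oneByOne] using h3
  mnorm_fromBlocks_le f g := by
    refine fourier_le _ (le_max_of_le_left (fourier_nonneg f)) fun κ _ _ x => ?_
    rw [mnorm_map_toMatrixMap]
    have e : (Matrix.of fun i j => x.map (FourierAlgebra.toDual n (Matrix.fromBlocks f 0 0 g i j))) = Matrix.fromBlocks
          (Matrix.of fun i j => x.map (FourierAlgebra.toDual n (f i j))) 0 0
          (Matrix.of fun i j => x.map (FourierAlgebra.toDual n (g i j))) := by
      ext (i | i) (j | j) a b <;> simp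
    rw [e]
    refine (OperatorSpace.mnorm_fromBlocks_le _ _).trans ?_
    rw [← mnorm_map_toMatrixMap, ← mnorm_map_toMatrixMap, max_mul_of_nonneg _ _ (linf_nonneg x)]
    exact max_le_max (fourier_apply f x) (fourier_apply g x)
  mnorm_sandwich_le {ι κ} _ _ _ _ α f β := by
    refine fourier_le _ (mul_nonneg (mul_nonneg (norm_nonneg α) (fourier_nonneg f))
      (norm_nonneg β)) fun κ' _ _ x => ?_
    rw [mnorm_map_toMatrixMap]
    have e : (Matrix.of fun i j => x.map (FourierAlgebra.toDual n (sandwich α f β i j))) =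
        sandwich α (Matrix.of fun i j => x.map (FourierAlgebra.toDual n (f i j))) β := by
      ext i j a b
      simp [sandwich, Matrix.sum_apply]
    rw [e]
    refine (OperatorSpace.mnorm_sandwich_le _ _ _).trans ?_
    rw [← mnorm_map_toMatrixMap]
    have := fourier_apply f x
    calc _ ≤ ‖α‖ * (mnorm f * mnorm x) * ‖β‖ := by gcongr
      _ = _ := by ring

end linf


section haarMul
variable {I : Type*} {n : I → ℕ}

/-- The functional `X · ĥ : a ↦ ĥ(a X) = ∑_α n_α Tr(a_α X_α)`, for `X` with finite support. -/
noncomputable def haarMul (X : ∀ α, Matrix (Fin (n α)) (Fin (n α)) ℂ) : FourierAlgebra n :=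
  ∑ᶠ α, ⟨blockFunctional α (X α), Submodule.le_topologicalClosure _
    (Submodule.subset_span ⟨α, X α, rfl⟩)⟩

theorem haarMul_apply {X : ∀ α, Matrix (Fin (n α)) (Fin (n α)) ℂ} (hX : {α | X α ≠ 0}.Finite)
    (a : LInfDual n) :
    FourierAlgebra.toDual n (haarMul X) a = ∑ᶠ α, (n α : ℂ) * (LInfDual.coord α a * X α).trace := by
  have h0 : ∀ α, X α = 0 → blockFunctional α (X α) = 0 := by
    intro α h
    ext b
    simp [blockFunctional_apply, h]
  have hf : (Function.support fun α => (⟨blockFunctional α (X α),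
      Submodule.le_topologicalClosure _ (Submodule.subset_span ⟨α, X α, rfl⟩)⟩ :
        FourierAlgebra n)).Finite :=
    hX.subset fun α h h' => h (Subtype.ext (h0 α h'))
  let L : FourierAlgebra n →ₗ[ℂ] ℂ :=
    { toFun := fun f => FourierAlgebra.toDual n f a
      map_add' := fun _ _ => rfl
      map_smul' := fun _ _ => rfl }
  exact AddMonoidHom.map_finsum L.toAddMonoidHom hf
end haarMul

/-! ### Compact quantum groups -/

section cqg
variable {A : Type*} [Ring A] [StarRing A] [HopfAlgebra ℂ A] [StarModule ℂ A]

open Coalgebra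

/-- Finite dimensional unitary representations. -/
structure IsUnitaryRep {n : ℕ} (u : Matrix (Fin n) (Fin n) A) : Prop where
  mem_unitary : u ∈ unitary (Matrix (Fin n) (Fin n) A)
  comul_eq : ∀ i j, comul (R := ℂ) (u i j) = ∑ k, u i k ⊗ₜ[ℂ] u k j

/-- Irreducibility of a unitary representation: it is nonzero and has trivial commutant. -/
def IsIrreducibleRep {n : ℕ} (u : Matrix (Fin n) (Fin n) A) : Prop :=
  0 < n ∧ ∀ T : Matrix (Fin n) (Fin n) ℂ,
    u * T.map (algebraMap ℂ A) = T.map (algebraMap ℂ A) * u → ∃ c : ℂ, T = c • 1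

/-- Unitary equivalence of representations. -/
def RepEquiv {n m : ℕ} (u : Matrix (Fin n) (Fin n) A) (v : Matrix (Fin m) (Fin m) A) : Prop :=
  ∃ T : Matrix (Fin n) (Fin m) ℂ, T * T.conjTranspose = 1 ∧ T.conjTranspose * T = 1 ∧
    u * T.map (algebraMap ℂ A) = T.map (algebraMap ℂ A) * v

variable (A) in
/-- The Hopf `*`-algebra `A` is the algebra `Pol(G)` of a compact quantum group `G`: it is spanned by
the coefficients of finite dimensional unitary representations. -/
class IsCompactQuantumGroup : Prop where
  comul_star : ∀ a : A, comul (R := ℂ) (star a) = star (comul (R := ℂ) a)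
  span_coeff : Submodule.span ℂ {a : A | ∃ (n : ℕ) (u : Matrix (Fin n) (Fin n) A),
    IsUnitaryRep u ∧ ∃ i j, a = u i j} = ⊤

/-- The Haar state. -/
structure IsHaarState (h : A →ₗ[ℂ] ℂ) : Prop where
  map_one : h 1 = 1
  nonneg : ∀ a, 0 ≤ h (star a * a)
  left_inv : ∀ a, TensorProduct.lid ℂ A (h.rTensor A (comul a)) = h a • (1 : A)
  right_inv : ∀ a, TensorProduct.rid ℂ A (h.lTensor A (comul a)) = h a • (1 : A)

/-- Kac type: the Haar state is a trace. -/
def IsKacType (h : A →ₗ[ℂ] ℂ) : Prop := ∀ a b, h (a * b) = h (b * a)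

variable (A) in
/-- A complete system of pairwise inequivalent irreducible unitary representations, indexed by
`I = Irr(G)`. -/
structure IrrRepresentatives (I : Type*) where
  dim : I → ℕ
  u : ∀ α, Matrix (Fin (dim α)) (Fin (dim α)) A
  isUnitaryRep : ∀ α, IsUnitaryRep (u α)
  irreducible : ∀ α, IsIrreducibleRep (u α)
  eq_of_equiv : ∀ α β, RepEquiv (u α) (u β) → α = β
  complete : ∀ (n : ℕ) (v : Matrix (Fin n) (Fin n) A), IsUnitaryRep v → IsIrreducibleRep v →
    ∃ α, RepEquiv v (u α)

variable {I : Type*} (R : IrrRepresentatives A I)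

instance (α : I) : Fact (0 < (R.dim α : ℝ) ^ (3 / 2 : ℝ)) :=
  ⟨Real.rpow_pos_of_pos (by exact_mod_cast (R.irreducible α).1) _⟩

/-- The Fourier transform `F(x)_α = (h(u_{ji}^* x))_{ij}`. -/
def fourierTransform (h : A →ₗ[ℂ] ℂ) (x : A) (α : I) :
    Matrix (Fin (R.dim α)) (Fin (R.dim α)) ℂ :=
  Matrix.of fun i j => h (star (R.u α j i) * x)

/-- The embedding `x ↦ F(x) · ĥ` of `Pol(G)` into `A(G)`. -/
noncomputable def polEmbed (h : A →ₗ[ℂ] ℂ) (x : A) : FourierAlgebra R.dim :=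
  haarMul (fourierTransform R h x)

/-- The convolution `a ⋆ b = h(S(b₁) a) b₂`. -/
noncomputable def convolution (h : A →ₗ[ℂ] ℂ) (a b : A) : A :=
  TensorProduct.lid ℂ A
    ((h ∘ₗ LinearMap.mulRight ℂ a ∘ₗ HopfAlgebra.antipode ℂ).rTensor A (comul b))

/-- `Φ` is a bounded map on the projective tensor square of `A(G)` that extends
`a ⊗ b ↦ a ⋆ S b` from `Pol(G)`. -/
def IsTwistedConvolution (h : A →ₗ[ℂ] ℂ)
    (Φ : ProjTensor (FourierAlgebra R.dim) (FourierAlgebra R.dim) →L[ℂ] FourierAlgebra R.dim) :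
    Prop :=
  ∀ a b : A, Φ (ProjTensor.tmul (polEmbed R h a) (polEmbed R h b)) =
    polEmbed R h (convolution h a (HopfAlgebra.antipode ℂ b))

/-- `A_Δ(G)`: the range of `Φ`, with the quotient operator space structure. -/
abbrev ADelta {R : IrrRepresentatives A I}
    (Φ : ProjTensor (FourierAlgebra R.dim) (FourierAlgebra R.dim) →L[ℂ] FourierAlgebra R.dim) :
    Type _ := QuotientRange Φ

/-- The Hilbert-Schmidt norm. -/
noncomputable def hsNorm {m : ℕ} (X : Matrix (Fin m) (Fin m) ℂ) : ℝ :=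
  √(∑ i, ∑ j, ‖X i j‖ ^ 2)

/-- The operator space `ℓ¹-⨁_α n_α^{3/2} (S²_{n_α})_r`. -/
abbrev RowSum : Type _ :=
  l1Sum fun α : I => Scaled ((R.dim α : ℝ) ^ (3 / 2 : ℝ)) (HSRow (R.dim α))

end cqg
end OpSp
open OpSp OpSp.MatrixNorm

/-!
Everything takes place blockwise. Write `f_α` for the component at `α` of an element `f` of the
Fourier algebra, so that `f(a) = n_α Tr(a f_α)` for `a` in the block `M_{n_α}`; an element of the
Fourier algebra is determined by its components (`fourier_ext_coeff`).

**The product on blocks.** In Kac type, traciality of the Haar state gives the orthogonality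
relations `h(u_ij^* u_kl) = δ_ik δ_jl / n_α` (`haar_star_mul_self`) and makes the conjugate of a
unitary representation unitary. Hence
`u^α_ij ⋆ S((u^β_kl)^*) = δ_αβ δ_jl n_α⁻¹ u^α_ik` (`convolution_coeff_self`), and there are an
injective map `α ↦ ᾱ` of `Irr(G)` and unitaries `W_α` with `(u^α_kl)^* = (W_α u^ᾱ W_α*)_kl`
(`exists_conj`). As coefficients of unitary representations, as well as their adjoints, span
`Pol(G)`, the component at `α` of the twisted convolution of `f` and `g` is
`(W_α g_ᾱ W_α*)ᵀ f_α` (`coeff_convolution`). Only the pair `(n, Conjugation n)` enters the rest of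
the argument. Uniqueness of the twisted convolution is the density of `Pol(G)` in the Fourier
algebra (`dense_polEmbed`).

**The components are completely contractive.** A complete contraction `T : n_α^{3/2} (S²)_r → M_k`
sends the matrix units to a column of norm at most `n_α^{3/2}` (`sum_norm_sq_mulVec_le`), because
the matrix units form a column of norm one in a row Hilbert space. Pairing the product on blocks
with such columns is a jointly completely contractive bilinear map
(`Conjugation.mnorm_pairing_le`): the product carries the factor `n_α⁻²`, and evaluating the
second argument and then the first leads to the column multiplied by the vector `∑ e_l ⊗ e_l` of
norm `√n_α`. Since the norm of the `ℓ¹`-sum is the supremum over all families of complete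
contractions of the summands into `M_k`, this bounds the norm of the components. With norming
functionals for the `T_α` it shows that the weighted norms of the components are summable, and so
provides the bounded map `Conjugation.conv`.

**The inverse is completely contractive.** On the block `α` the map
`X ↦ n_α ∑ X_ij ω_jl ⊗ ω'_il`, where `ω` and `ω'` are the matrices of coordinate functionals of the
blocks `α` and `ᾱ`, is a right inverse of the twisted convolution, and it is completely contractive
from `n_α^{3/2} (S²)_r` to the projective tensor product (`Conjugation.mnorm_lift_le`). The quotient
matrix norms satisfy Ruan's axioms, and such matrix norms are computed by complete contractions `τ`
into matrix algebras (`IsMatrixSeminorm.exists_completeContraction`, a Hahn-Banach argument). The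
compositions of `τ` with the right inverses form an admissible family for the norm of the
`ℓ¹`-sum, and this is the reverse inequality (`Conjugation.le_mnorm_components`).
-/

set_option linter.unusedSectionVars false

namespace OpSp

/-! ### Unitary representations and the Haar state -/

section cqg
variable {A : Type*} [Ring A] [StarRing A] [HopfAlgebra ℂ A] [StarModule ℂ A]

open Coalgebra

section unitary
variable {n m : ℕ} {u : Matrix (Fin n) (Fin n) A} {v : Matrix (Fin m) (Fin m) A}

theorem IsUnitaryRep.sum_star_mul (hu : IsUnitaryRep u) (i j : Fin n) :
    ∑ k, star (u k i) * u k j = if i = j then 1 else 0 := by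
  have h1 : star u * u = 1 := (Unitary.mem_iff.mp hu.mem_unitary).1
  have := congrFun (congrFun h1 i) j
  simpa [Matrix.mul_apply, Matrix.one_apply] using this

theorem IsUnitaryRep.sum_mul_star (hu : IsUnitaryRep u) (i j : Fin n) :
    ∑ k, u i k * star (u j k) = if i = j then 1 else 0 := by
  have h1 : u * star u = 1 := (Unitary.mem_iff.mp hu.mem_unitary).2
  have := congrFun (congrFun h1 i) j
  simpa [Matrix.mul_apply, Matrix.one_apply] using this

/-- The intertwining relation, entrywise. -/
theorem intertwiner_iff (T : Matrix (Fin n) (Fin m) ℂ) :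
    u * T.map (algebraMap ℂ A) = T.map (algebraMap ℂ A) * v ↔
      ∀ r l, ∑ j, T j l • u r j = ∑ q, T r q • v q l := by
  rw [← Matrix.ext_iff]
  refine forall₂_congr fun r l => ?_
  simp only [Matrix.mul_apply, Matrix.map_apply, ← Algebra.commutes, ← Algebra.smul_def]

theorem IsUnitaryRep.comul_star [IsCompactQuantumGroup A] (hu : IsUnitaryRep u) (i j : Fin n) :
    comul (R := ℂ) (star (u i j)) = ∑ k, star (u i k) ⊗ₜ[ℂ] star (u k j) := by
  rw [IsCompactQuantumGroup.comul_star, hu.comul_eq, star_sum]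
  simp [TensorProduct.star_tmul]

/-- The counit of a coefficient: `ε(u) u = u` and `u` is invertible. -/
theorem IsUnitaryRep.counit_eq (hu : IsUnitaryRep u) (i j : Fin n) :
    counit (R := ℂ) (u i j) = if i = j then 1 else 0 := by
  have h1 : ∀ k, ∑ l, counit (R := ℂ) (u k l) • u l j = u k j := by
    intro k
    have := congrArg (TensorProduct.lid ℂ A) (rTensor_counit_comul (R := ℂ) (u k j))
    rw [hu.comul_eq] at this
    simpa using this
  have h2 : ∑ l, counit (R := ℂ) (u i l) • (∑ k, u l k * star (u j k)) =
      ∑ k, u i k * star (u j k) := by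
    simp only [Finset.smul_sum]
    rw [Finset.sum_comm]
    refine Finset.sum_congr rfl fun k _ => ?_
    have h1' : ∑ l, counit (R := ℂ) (u i l) • u l k = u i k := by
      have := congrArg (TensorProduct.lid ℂ A) (rTensor_counit_comul (R := ℂ) (u i k))
      rw [hu.comul_eq] at this
      simpa using this
    rw [← h1', Finset.sum_mul]
    simp
  simp only [hu.sum_mul_star] at h2
  have h3 := congrArg (counit (R := ℂ)) h2
  simpa [apply_ite] using h3

/-- The antipode of a coefficient: `S(u)` is a left inverse of the unitary `u`. -/
theorem IsUnitaryRep.antipode_eq (hu : IsUnitaryRep u) (i j : Fin n) :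
    HopfAlgebra.antipode ℂ (u i j) = star (u j i) := by
  have h1 : ∀ l, ∑ k, HopfAlgebra.antipode ℂ (u i k) * u k l = if i = l then 1 else 0 := by
    intro l
    have := HopfAlgebra.mul_antipode_rTensor_comul_apply (R := ℂ) (u i l)
    rw [hu.comul_eq, hu.counit_eq] at this
    simpa [apply_ite] using this
  have h2 : ∑ l, (∑ k, HopfAlgebra.antipode ℂ (u i k) * u k l) * star (u j l) =
      HopfAlgebra.antipode ℂ (u i j) := by
    simp only [Finset.sum_mul, mul_assoc]
    rw [Finset.sum_comm]
    simp only [← Finset.mul_sum, hu.sum_mul_star]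
    simp
  rw [← h2]
  simp [h1]

end unitary

section haar
variable {h : A →ₗ[ℂ] ℂ} {n m : ℕ} {u : Matrix (Fin n) (Fin n) A} {v : Matrix (Fin m) (Fin m) A}

/-- Left invariance, for a given expansion of the coproduct. -/
theorem IsHaarState.sum_left (hh : IsHaarState h) {ι : Type*} [Fintype ι] {a : A} {x y : ι → A}
    (hx : comul (R := ℂ) a = ∑ k, x k ⊗ₜ[ℂ] y k) : ∑ k, h (x k) • y k = h a • (1 : A) := by
  rw [← hh.left_inv, hx]
  simp

/-- Right invariance, for a given expansion of the coproduct. -/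
theorem IsHaarState.sum_right (hh : IsHaarState h) {ι : Type*} [Fintype ι] {a : A} {x y : ι → A}
    (hx : comul (R := ℂ) a = ∑ k, x k ⊗ₜ[ℂ] y k) : ∑ k, h (y k) • x k = h a • (1 : A) := by
  rw [← hh.right_inv, hx]
  simp

variable [IsCompactQuantumGroup A]

/-- Averaging a matrix unit over the group gives an intertwiner. -/
theorem IsHaarState.intertwiner (hh : IsHaarState h) (hu : IsUnitaryRep u) (hv : IsUnitaryRep v)
    (i : Fin n) (k : Fin m) :
    u * (Matrix.of fun j l => h (star (u i j) * v k l)).map (algebraMap ℂ A) =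
      (Matrix.of fun j l => h (star (u i j) * v k l)).map (algebraMap ℂ A) * v := by
  rw [intertwiner_iff]
  intro r l
  have key : ∀ j, ∑ pq : Fin n × Fin m, h (star (u i pq.1) * v k pq.2) •
      (star (u pq.1 j) * v pq.2 l) = h (star (u i j) * v k l) • (1 : A) := by
    intro j
    refine hh.sum_left ?_
    rw [Bialgebra.comul_mul, hu.comul_star, hv.comul_eq, Finset.sum_mul_sum,
      Fintype.sum_prod_type]
    simp
  have h2 : ∑ j, u r j * (h (star (u i j) * v k l) • (1 : A)) =
      ∑ q, h (star (u i r) * v k q) • v q l := by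
    simp only [← key, Fintype.sum_prod_type, Finset.mul_sum, mul_smul_comm, ← mul_assoc]
    rw [Finset.sum_comm]
    have : ∀ p, ∑ j, ∑ q, h (star (u i p) * v k q) • (u r j * star (u p j) * v q l) =
        ∑ q, h (star (u i p) * v k q) • ((if r = p then 1 else 0) * v q l) := by
      intro p
      rw [Finset.sum_comm]
      refine Finset.sum_congr rfl fun q _ => ?_
      rw [← Finset.smul_sum, ← Finset.sum_mul, hu.sum_mul_star]
    simp [this]
  simpa using h2

/-- Averaging from the other side, with the adjoint in the second factor. In Kac type both averages
involve the same numbers `h(u_{ij}^* u_{kl})`. -/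
theorem IsHaarState.intertwiner' (hh : IsHaarState h) (hu : IsUnitaryRep u)
    (l j : Fin n) :
    u * (Matrix.of fun p q => h (u p l * star (u q j))).map (algebraMap ℂ A) =
      (Matrix.of fun p q => h (u p l * star (u q j))).map (algebraMap ℂ A) * u := by
  rw [intertwiner_iff]
  intro r t
  have key : ∀ i, ∑ pq : Fin n × Fin n, h (u pq.1 l * star (u pq.2 j)) •
      (u r pq.1 * star (u i pq.2)) = h (u r l * star (u i j)) • (1 : A) := by
    intro i
    refine hh.sum_right ?_
    rw [Bialgebra.comul_mul, hu.comul_star, hu.comul_eq, Finset.sum_mul_sum,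
      Fintype.sum_prod_type]
    simp
  have h2 : ∑ i, (h (u r l * star (u i j)) • (1 : A)) * u i t =
      ∑ p, h (u p l * star (u t j)) • u r p := by
    simp only [← key, Fintype.sum_prod_type, Finset.sum_mul, smul_mul_assoc, mul_assoc]
    rw [Finset.sum_comm]
    refine Finset.sum_congr rfl fun p _ => ?_
    rw [Finset.sum_comm]
    simp only [← Finset.mul_sum, ← Finset.smul_sum, hu.sum_star_mul]
    simp
  simpa using h2.symm

variable (hh : IsHaarState h) (hKac : IsKacType h)
include hh hKac

/-- Schur orthogonality for the coefficients of one irreducible representation: traciality of the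
Haar state makes the two families of averaged intertwiners agree, so that only the factor `1 / n`
is left. -/
theorem haar_star_mul_self (hu : IsUnitaryRep u) (hirr : IsIrreducibleRep u) (i j k l : Fin n) :
    h (star (u i j) * u k l) = if i = k ∧ j = l then (n : ℂ)⁻¹ else 0 := by
  have h1 : ∀ i k, ∃ c : ℂ, ∀ j l, h (star (u i j) * u k l) = if j = l then c else 0 := by
    intro i k
    obtain ⟨c, hc⟩ := hirr.2 _ (hh.intertwiner hu hu i k)
    refine ⟨c, fun j l => ?_⟩
    have := congrFun (congrFun hc j) l
    simpa [Matrix.one_apply] using this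
  have h2 : ∀ l j, ∃ c : ℂ, ∀ k i, h (star (u i j) * u k l) = if k = i then c else 0 := by
    intro l j
    obtain ⟨c, hc⟩ := hirr.2 _ (hh.intertwiner' hu l j)
    refine ⟨c, fun k i => ?_⟩
    have := congrFun (congrFun hc k) i
    rw [hKac]
    simpa [Matrix.one_apply] using this
  choose c hc using h1
  choose d hd using h2
  have hn : (n : ℂ) ≠ 0 := by exact_mod_cast hirr.1.ne'
  have hdiag : ∀ j, ∑ i, h (star (u i j) * u i j) = 1 := by
    intro j
    rw [← map_sum, hu.sum_star_mul]
    simp [hh.map_one]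
  by_cases hik : i = k
  · by_cases hjl : j = l
    · subst hik hjl
      have hall : ∀ i', h (star (u i' j) * u i' j) = h (star (u i j) * u i j) := by
        intro i'
        rw [hd j j i' i', hd j j i i]; simp
      have := hdiag j
      simp only [hall, Finset.sum_const, Finset.card_univ, Fintype.card_fin, nsmul_eq_mul] at this
      simp only [and_self, if_true]
      exact eq_inv_of_mul_eq_one_right this
    · rw [hc]; simp [hjl]
  · rw [hd, if_neg (fun e => hik e.symm), if_neg (fun e => hik e.1)]

/-- The conjugate of a unitary representation is unitary when the Haar state is a trace:
`∑ u_pi u_pk^*` has the same Haar integral as `∑ u_pk^* u_pi = δ_ki`, and left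
invariance recovers it from these integrals. -/
theorem IsUnitaryRep.conj (hu : IsUnitaryRep u) : IsUnitaryRep (u.map star) := by
  have e1 : ∀ i k, ∑ p, u p i * star (u p k) = if i = k then 1 else 0 := by
    intro i k
    -- traciality reduces the integral to the unitarity of `u` itself
    have ht : ∀ r s, h (∑ p, u p r * star (u p s)) = if r = s then 1 else 0 := by
      intro r s
      simp only [map_sum, hKac (u _ r)]
      rw [← map_sum, hu.sum_star_mul]
      simp [apply_ite, hh.map_one, eq_comm]
    have hc := hh.sum_left (a := ∑ p, u p i * star (u p k)) (ι := Fin n × Fin n)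
      (x := fun rs => ∑ p, u p rs.1 * star (u p rs.2))
      (y := fun rs => u rs.1 i * star (u rs.2 k)) (by
        simp only [map_sum, Bialgebra.comul_mul, hu.comul_star, hu.comul_eq, Finset.sum_mul_sum,
          Fintype.sum_prod_type, TensorProduct.sum_tmul, Algebra.TensorProduct.tmul_mul_tmul]
        rw [Finset.sum_comm]
        refine Finset.sum_congr rfl fun r _ => ?_
        rw [Finset.sum_comm])
    simp only [ht, Fintype.sum_prod_type] at hc
    simpa [apply_ite] using hc
  have e2 : ∀ i k, ∑ p, star (u i p) * u k p = if i = k then 1 else 0 := by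
    intro i k
    have ht : ∀ r s, h (∑ p, star (u r p) * u s p) = if r = s then 1 else 0 := by
      intro r s
      simp only [map_sum, hKac (star (u r _))]
      rw [← map_sum, hu.sum_mul_star]
      simp [apply_ite, hh.map_one, eq_comm]
    have hc := hh.sum_right (a := ∑ p, star (u i p) * u k p) (ι := Fin n × Fin n)
      (y := fun rs => ∑ p, star (u rs.1 p) * u rs.2 p)
      (x := fun rs => star (u i rs.1) * u k rs.2) (by
        simp only [map_sum, Bialgebra.comul_mul, hu.comul_star, hu.comul_eq, Finset.sum_mul_sum,
          Fintype.sum_prod_type, TensorProduct.tmul_sum, Algebra.TensorProduct.tmul_mul_tmul]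
        rw [Finset.sum_comm]
        refine Finset.sum_congr rfl fun r _ => ?_
        rw [Finset.sum_comm])
    simp only [ht, Fintype.sum_prod_type] at hc
    simpa [apply_ite] using hc
  refine ⟨Unitary.mem_iff.mpr ⟨?_, ?_⟩, fun i j => ?_⟩
  · ext i k
    simpa [Matrix.mul_apply, Matrix.one_apply] using e1 i k
  · ext i k
    simpa [Matrix.mul_apply, Matrix.one_apply] using e2 i k
  · simpa using hu.comul_star i j

theorem IsUnitaryRep.antipode_star (hu : IsUnitaryRep u) (i j : Fin n) :
    HopfAlgebra.antipode ℂ (star (u i j)) = u j i := by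
  simpa using (hu.conj hh hKac).antipode_eq i j

end haar

theorem IsIrreducibleRep.conj {n : ℕ} {u : Matrix (Fin n) (Fin n) A} (hu : IsIrreducibleRep u) :
    IsIrreducibleRep (u.map star) := by
  refine ⟨hu.1, fun T hT => ?_⟩
  obtain ⟨c, hc⟩ := hu.2 (T.map star) (by
    rw [intertwiner_iff] at hT ⊢
    intro r l
    have := congrArg star (hT r l)
    simpa using this)
  refine ⟨star c, ?_⟩
  ext i j
  have := congrArg star (congrFun (congrFun hc i) j)
  simpa [Matrix.one_apply, apply_ite] using this

end cqg

/-! ### Intertwiners and equivalence -/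

section cqg
variable {A : Type*} [Ring A] [StarRing A] [HopfAlgebra ℂ A] [StarModule ℂ A]

open Coalgebra Matrix

section equivalence
variable {n m k : ℕ} {u : Matrix (Fin n) (Fin n) A} {v : Matrix (Fin m) (Fin m) A}
  {w : Matrix (Fin k) (Fin k) A}

theorem conjTranspose_map_algebraMap (T : Matrix (Fin n) (Fin m) ℂ) :
    (T.map (algebraMap ℂ A))ᴴ = Tᴴ.map (algebraMap ℂ A) := by
  ext i j
  simp only [conjTranspose_apply, Matrix.map_apply]
  exact (algebraMap_star_comm (T j i)).symm

theorem map_algebraMap_mul (T : Matrix (Fin n) (Fin m) ℂ) (T' : Matrix (Fin m) (Fin k) ℂ) :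
    (T * T').map (algebraMap ℂ A) = T.map (algebraMap ℂ A) * T'.map (algebraMap ℂ A) :=
  Matrix.map_mul

theorem map_algebraMap_one :
    (1 : Matrix (Fin n) (Fin n) ℂ).map (algebraMap ℂ A) = 1 :=
  Matrix.map_one _ (map_zero _) (map_one _)

/-- The adjoint of an intertwiner of unitary representations is an intertwiner. -/
theorem intertwiner_conjTranspose (hu : IsUnitaryRep u) (hv : IsUnitaryRep v)
    {T : Matrix (Fin n) (Fin m) ℂ}
    (hT : u * T.map (algebraMap ℂ A) = T.map (algebraMap ℂ A) * v) :
    v * Tᴴ.map (algebraMap ℂ A) = Tᴴ.map (algebraMap ℂ A) * u := by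
  have h1 := congrArg Matrix.conjTranspose hT
  rw [conjTranspose_mul, conjTranspose_mul, conjTranspose_map_algebraMap] at h1
  have hu1 : uᴴ * u = 1 := (Unitary.mem_iff.mp hu.mem_unitary).1
  have hv1 : v * vᴴ = 1 := (Unitary.mem_iff.mp hv.mem_unitary).2
  calc v * Tᴴ.map (algebraMap ℂ A) = v * (Tᴴ.map (algebraMap ℂ A) * uᴴ) * u := by
        rw [Matrix.mul_assoc, Matrix.mul_assoc, hu1, Matrix.mul_one]
    _ = Tᴴ.map (algebraMap ℂ A) * u := by rw [h1, ← Matrix.mul_assoc, hv1, Matrix.one_mul]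

/-- Schur's lemma: a nonzero intertwiner of irreducible unitary representations is a multiple of a
unitary one. -/
theorem repEquiv_of_intertwiner (hu : IsUnitaryRep u) (hv : IsUnitaryRep v)
    (hui : IsIrreducibleRep u) (hvi : IsIrreducibleRep v) {T : Matrix (Fin n) (Fin m) ℂ}
    (hT : u * T.map (algebraMap ℂ A) = T.map (algebraMap ℂ A) * v) (h0 : T ≠ 0) :
    RepEquiv u v := by
  have hT' := intertwiner_conjTranspose hu hv hT
  obtain ⟨c, hc⟩ := hui.2 (T * Tᴴ) (by
    rw [map_algebraMap_mul, ← Matrix.mul_assoc, hT, Matrix.mul_assoc, hT', Matrix.mul_assoc])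
  obtain ⟨d, hd⟩ := hvi.2 (Tᴴ * T) (by
    rw [map_algebraMap_mul, ← Matrix.mul_assoc, hT', Matrix.mul_assoc, hT, Matrix.mul_assoc])
  have hcd : c = d := by
    have h1 : c • T = d • T := by
      calc c • T = T * Tᴴ * T := by rw [hc]; simp
        _ = d • T := by rw [Matrix.mul_assoc, hd]; simp
    have h2 : (c - d) • T = 0 := by rw [sub_smul, h1, sub_self]
    exact sub_eq_zero.mp ((smul_eq_zero.mp h2).resolve_right h0)
  subst hcd
  have hn : (0 : ℝ) < n := by exact_mod_cast hui.1
  obtain ⟨r, hr0, hr⟩ : ∃ r : ℝ, 0 < r ∧ c = r := by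
    have htr : (T * Tᴴ).trace = ((∑ i, ∑ j, ‖T i j‖ ^ 2 : ℝ) : ℂ) := by
      simp [Matrix.trace, Matrix.mul_apply, ← Complex.mul_conj']
    rw [hc] at htr
    simp only [Matrix.trace_smul, Matrix.trace_one, Fintype.card_fin, smul_eq_mul] at htr
    refine ⟨(∑ i, ∑ j, ‖T i j‖ ^ 2) / n, div_pos ?_ hn, ?_⟩
    · obtain ⟨i, j, hij⟩ : ∃ i j, T i j ≠ 0 := by
        by_contra! hcon
        exact h0 (by ext i j; simpa using hcon i j)
      have hi : 0 < ∑ j, ‖T i j‖ ^ 2 :=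
        Finset.sum_pos' (fun _ _ => by positivity) ⟨j, Finset.mem_univ _, by positivity⟩
      exact Finset.sum_pos' (fun _ _ => by positivity) ⟨i, Finset.mem_univ _, hi⟩
    · rw [Complex.ofReal_div, ← htr]
      have : ((n : ℝ) : ℂ) ≠ 0 := by exact_mod_cast hn.ne'
      push_cast at this ⊢
      field_simp
  have hs : ((((√r)⁻¹ : ℝ) : ℂ)) * (((√r)⁻¹ : ℝ) : ℂ) * c = 1 := by
    rw [hr, ← Complex.ofReal_mul, ← Complex.ofReal_mul, ← mul_inv, Real.mul_self_sqrt hr0.le,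
      inv_mul_cancel₀ hr0.ne', Complex.ofReal_one]
  refine ⟨(((√r)⁻¹ : ℝ) : ℂ) • T, ?_, ?_, ?_⟩
  · rw [conjTranspose_smul, Matrix.smul_mul, Matrix.mul_smul, hc, smul_smul, smul_smul]
    simp only [Complex.star_def, Complex.conj_ofReal]
    rw [hs, one_smul]
  · rw [conjTranspose_smul, Matrix.smul_mul, Matrix.mul_smul, hd, smul_smul, smul_smul]
    simp only [Complex.star_def, Complex.conj_ofReal]
    rw [hs, one_smul]
  · rw [intertwiner_iff] at hT ⊢
    intro i l
    have := congrArg ((((√r)⁻¹ : ℝ) : ℂ) • ·) (hT i l)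
    simpa [Finset.smul_sum, smul_smul] using this

theorem RepEquiv.symm (hu : IsUnitaryRep u) (hv : IsUnitaryRep v) (h : RepEquiv u v) :
    RepEquiv v u := by
  obtain ⟨T, h1, h2, h3⟩ := h
  exact ⟨Tᴴ, by simpa using h2, by simpa using h1, intertwiner_conjTranspose hu hv h3⟩

theorem RepEquiv.trans (h : RepEquiv u v) (h' : RepEquiv v w) : RepEquiv u w := by
  obtain ⟨T, h1, h2, h3⟩ := h
  obtain ⟨S, s1, s2, s3⟩ := h'
  refine ⟨T * S, ?_, ?_, ?_⟩
  · rw [conjTranspose_mul, Matrix.mul_assoc, ← Matrix.mul_assoc S, s1, Matrix.one_mul, h1]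
  · rw [conjTranspose_mul, Matrix.mul_assoc, ← Matrix.mul_assoc Tᴴ, h2, Matrix.one_mul, s2]
  · rw [map_algebraMap_mul, ← Matrix.mul_assoc, h3, Matrix.mul_assoc, s3, Matrix.mul_assoc]

theorem RepEquiv.conj (h : RepEquiv u v) : RepEquiv (u.map star) (v.map star) := by
  obtain ⟨T, h1, h2, h3⟩ := h
  refine ⟨T.map star, ?_, ?_, ?_⟩
  · ext i j
    have := congrArg star (congrFun (congrFun h1 i) j)
    simpa [Matrix.mul_apply, Matrix.one_apply, apply_ite] using this
  · ext i j
    have := congrArg star (congrFun (congrFun h2 i) j)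
    simpa [Matrix.mul_apply, Matrix.one_apply, apply_ite] using this
  · rw [intertwiner_iff] at h3 ⊢
    intro r l
    have := congrArg star (h3 r l)
    simpa using this

/-- The coefficients of a representation are combinations of those of an equivalent one. -/
theorem eq_sum_of_repEquiv {T : Matrix (Fin n) (Fin m) ℂ} (h1 : T * Tᴴ = 1)
    (h : u * T.map (algebraMap ℂ A) = T.map (algebraMap ℂ A) * v) (i j : Fin n) :
    u i j = ∑ r, ∑ s, (T i r * star (T j s)) • v r s := by
  have e : u = T.map (algebraMap ℂ A) * v * Tᴴ.map (algebraMap ℂ A) := by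
    rw [← h, Matrix.mul_assoc, ← map_algebraMap_mul, h1, map_algebraMap_one, Matrix.mul_one]
  conv_lhs => rw [e]
  simp only [Matrix.mul_apply, Matrix.map_apply, Finset.sum_mul, conjTranspose_apply]
  rw [Finset.sum_comm]
  refine Finset.sum_congr rfl fun r _ => Finset.sum_congr rfl fun s _ => ?_
  rw [← Algebra.commutes, ← Algebra.smul_def, ← Algebra.smul_def, smul_smul, mul_comm]

theorem map_sandwich {B : Type*} [Semiring B] [Algebra ℂ B] (φ : A →ₐ[ℂ] B)
    (S : Matrix (Fin m) (Fin n) ℂ) (T : Matrix (Fin n) (Fin m) ℂ) :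
    (S.map (algebraMap ℂ A) * u * T.map (algebraMap ℂ A)).map φ =
      S.map (algebraMap ℂ B) * u.map φ * T.map (algebraMap ℂ B) := by
  rw [Matrix.map_mul, Matrix.map_mul, Matrix.map_map, Matrix.map_map]
  have : (φ ∘ algebraMap ℂ A : ℂ → B) = algebraMap ℂ B := funext fun c => φ.commutes c
  rw [this]

/-- Comultiplicativity as a matrix identity over `A ⊗ A`: `Δ(u)` is the product of `u ⊗ 1` and
`1 ⊗ u`. -/
theorem comul_eq_iff : (∀ i j, comul (R := ℂ) (u i j) = ∑ k, u i k ⊗ₜ[ℂ] u k j) ↔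
    u.map (Bialgebra.comulAlgHom ℂ A) =
      u.map (Algebra.TensorProduct.includeLeft : A →ₐ[ℂ] A ⊗[ℂ] A) *
      u.map (Algebra.TensorProduct.includeRight : A →ₐ[ℂ] A ⊗[ℂ] A) := by
  rw [← Matrix.ext_iff]
  refine forall₂_congr fun i j => ?_
  simp [Matrix.mul_apply]

theorem IsUnitaryRep.of_conj_unitary (hu : IsUnitaryRep u) {V : Matrix (Fin n) (Fin n) ℂ}
    (h1 : V * Vᴴ = 1) (h2 : Vᴴ * V = 1) :
    IsUnitaryRep (Vᴴ.map (algebraMap ℂ A) * u * V.map (algebraMap ℂ A)) := by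
  set V' := V.map (algebraMap ℂ A) with hV'
  have hVs : V'ᴴ = Vᴴ.map (algebraMap ℂ A) := conjTranspose_map_algebraMap V
  have e1 : V' * V'ᴴ = 1 := by rw [hVs, ← map_algebraMap_mul, h1, map_algebraMap_one]
  have e2 : V'ᴴ * V' = 1 := by rw [hVs, ← map_algebraMap_mul, h2, map_algebraMap_one]
  have hu1 : uᴴ * u = 1 := (Unitary.mem_iff.mp hu.mem_unitary).1
  have hu2 : u * uᴴ = 1 := (Unitary.mem_iff.mp hu.mem_unitary).2
  rw [← hVs]
  refine ⟨Unitary.mem_iff.mpr ⟨?_, ?_⟩, fun i j => ?_⟩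
  · change (V'ᴴ * u * V')ᴴ * (V'ᴴ * u * V') = 1
    simp only [conjTranspose_mul, conjTranspose_conjTranspose]
    calc V'ᴴ * (uᴴ * V') * (V'ᴴ * u * V') = V'ᴴ * (uᴴ * (V' * V'ᴴ) * u) * V' := by
          simp only [Matrix.mul_assoc]
      _ = 1 := by rw [e1, Matrix.mul_one, hu1, Matrix.mul_one, e2]
  · change (V'ᴴ * u * V') * (V'ᴴ * u * V')ᴴ = 1
    simp only [conjTranspose_mul, conjTranspose_conjTranspose]
    calc V'ᴴ * u * V' * (V'ᴴ * (uᴴ * V')) = V'ᴴ * (u * (V' * V'ᴴ) * uᴴ) * V' := by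
          simp only [Matrix.mul_assoc]
      _ = 1 := by rw [e1, Matrix.mul_one, hu2, Matrix.mul_one, e2]
  · revert i j
    have hu3 := comul_eq_iff.mp hu.comul_eq
    rw [hVs]
    refine comul_eq_iff.mpr ?_
    simp only [hV', map_sandwich, hu3]
    have e3 : V.map (algebraMap ℂ (A ⊗[ℂ] A)) * Vᴴ.map (algebraMap ℂ (A ⊗[ℂ] A)) = 1 := by
      rw [← Matrix.map_mul, h1, Matrix.map_one _ (map_zero _) (map_one _)]
    calc _ = Vᴴ.map (algebraMap ℂ (A ⊗[ℂ] A)) *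
          (u.map (Algebra.TensorProduct.includeLeft : A →ₐ[ℂ] A ⊗[ℂ] A)
          * (V.map (algebraMap ℂ (A ⊗[ℂ] A)) * Vᴴ.map (algebraMap ℂ (A ⊗[ℂ] A))) *
          u.map (Algebra.TensorProduct.includeRight : A →ₐ[ℂ] A ⊗[ℂ] A)) *
          V.map (algebraMap ℂ (A ⊗[ℂ] A)) := by rw [e3, Matrix.mul_one]
      _ = _ := by simp only [Matrix.mul_assoc]

/-- A block of a block diagonal representation is a representation. -/
theorem IsUnitaryRep.submatrix (hu : IsUnitaryRep u) {f : Fin k → Fin n}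
    (hf : Function.Injective f) (h1 : ∀ i j, i ∉ Set.range f → u i (f j) = 0)
    (h2 : ∀ i j, j ∉ Set.range f → u (f i) j = 0) : IsUnitaryRep (u.submatrix f f) := by
  refine ⟨Unitary.mem_iff.mpr ⟨?_, ?_⟩, fun i j => ?_⟩
  · ext i j
    have := hu.sum_star_mul (f i) (f j)
    rw [← Fintype.sum_of_injective f hf (fun k => star (u (f k) (f i)) * u (f k) (f j)) _
      (fun l hl => by simp [h1 l j hl]) (fun _ => rfl)] at this
    simpa [Matrix.mul_apply, Matrix.one_apply, hf.eq_iff] using this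
  · ext i j
    have := hu.sum_mul_star (f i) (f j)
    rw [← Fintype.sum_of_injective f hf (fun k => u (f i) (f k) * star (u (f j) (f k))) _
      (fun l hl => by simp [h2 i l hl]) (fun _ => rfl)] at this
    simpa [Matrix.mul_apply, Matrix.one_apply, hf.eq_iff] using this
  · have := hu.comul_eq (f i) (f j)
    rw [← Fintype.sum_of_injective f hf (fun k => u (f i) (f k) ⊗ₜ[ℂ] u (f k) (f j)) _
      (fun l hl => by simp [h1 l j hl]) (fun _ => rfl)] at this
    exact this

end equivalence

end cqg

/-! ### The functionals given by finitely supported families -/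

section haarMul
variable {I : Type*} {n : I → ℕ}

theorem toDual_injective : Function.Injective (FourierAlgebra.toDual n) :=
  Subtype.val_injective

theorem fourier_ext {f g : FourierAlgebra n}
    (h : ∀ a, FourierAlgebra.toDual n f a = FourierAlgebra.toDual n g a) : f = g :=
  toDual_injective (ContinuousLinearMap.ext h)

variable {X Y : ∀ α, Matrix (Fin (n α)) (Fin (n α)) ℂ}

theorem haarMul_add (hX : {α | X α ≠ 0}.Finite) (hY : {α | Y α ≠ 0}.Finite) :
    haarMul (X + Y) = haarMul X + haarMul Y := by
  refine fourier_ext fun a => ?_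
  have hXY : {α | (X + Y) α ≠ 0}.Finite := (hX.union hY).subset fun α hα => by
    by_contra hcon
    simp only [Set.mem_union, Set.mem_ofPred_eq, not_or, not_not] at hcon
    exact hα (by rw [Pi.add_apply, hcon.1, hcon.2, add_zero])
  rw [map_add, add_apply, haarMul_apply hX, haarMul_apply hY,
    haarMul_apply hXY, ← finsum_add_distrib]
  · simp [mul_add]
  · exact hX.subset fun α hα h0 => hα (by simp [h0])
  · exact hY.subset fun α hα h0 => hα (by simp [h0])

theorem haarMul_smul (c : ℂ) (hX : {α | X α ≠ 0}.Finite) : haarMul (c • X) = c • haarMul X := by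
  refine fourier_ext fun a => ?_
  have hcX : {α | (c • X) α ≠ 0}.Finite :=
    hX.subset fun α hα h0 => hα (by rw [Pi.smul_apply, h0, smul_zero])
  rw [map_smul, smul_apply, haarMul_apply hX, haarMul_apply hcX, smul_finsum]
  simp [mul_left_comm]

end haarMul

/-! ### Coefficients of irreducible representations -/

section cqg
variable {A : Type*} [Ring A] [StarRing A] [HopfAlgebra ℂ A] [StarModule ℂ A]

open Coalgebra Matrix

variable {I : Type*} (R : IrrRepresentatives A I)

theorem commute_add_smul {n : ℕ} {u : Matrix (Fin n) (Fin n) A} {S T : Matrix (Fin n) (Fin n) ℂ}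
    (hS : u * S.map (algebraMap ℂ A) = S.map (algebraMap ℂ A) * u)
    (hT : u * T.map (algebraMap ℂ A) = T.map (algebraMap ℂ A) * u) (a b : ℂ) :
    u * (a • S + b • T).map (algebraMap ℂ A) = (a • S + b • T).map (algebraMap ℂ A) * u := by
  rw [intertwiner_iff] at hS hT ⊢
  intro r l
  have := congrArg₂ (a • · + b • ·) (hS r l) (hT r l)
  simpa [Finset.smul_sum, smul_smul, add_smul, Finset.sum_add_distrib] using this

/-- A representation which is not irreducible commutes with a nonscalar Hermitian matrix: one of the
real and imaginary parts of a nonscalar intertwiner. -/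
theorem exists_isHermitian_commute {n : ℕ} {u : Matrix (Fin n) (Fin n) A} (hu : IsUnitaryRep u)
    (hn : 0 < n) (hirr : ¬ IsIrreducibleRep u) : ∃ H : Matrix (Fin n) (Fin n) ℂ, H.IsHermitian ∧
      u * H.map (algebraMap ℂ A) = H.map (algebraMap ℂ A) * u ∧ ∀ c : ℂ, H ≠ c • 1 := by
  simp only [IsIrreducibleRep, hn, true_and, not_forall, not_exists] at hirr
  obtain ⟨T, hT, hns⟩ := hirr
  have hT' := intertwiner_conjTranspose hu hu hT
  by_cases h1 : ∃ c : ℂ, T + Tᴴ = c • 1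
  · obtain ⟨c, hc⟩ := h1
    refine ⟨Complex.I • T + (-Complex.I) • Tᴴ, ?_, commute_add_smul hT hT' _ _, fun d hd => ?_⟩
    · simp [Matrix.IsHermitian, add_comm]
    · have hT2 : (2 * Complex.I) • T = (Complex.I * c + d) • (1 : Matrix (Fin n) (Fin n) ℂ) := by
        rw [add_smul, mul_smul Complex.I c, ← hc, ← hd]
        module
      refine hns ((2 * Complex.I)⁻¹ * (Complex.I * c + d)) ?_
      rw [mul_smul, ← hT2, inv_smul_smul₀ (by simp)]
  · refine ⟨(1 : ℂ) • T + (1 : ℂ) • Tᴴ, ?_, commute_add_smul hT hT' _ _, fun d hd => h1 ⟨d, ?_⟩⟩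
    · simp [Matrix.IsHermitian, add_comm]
    · simpa using hd

/-- Complete reducibility: the coefficients of a unitary representation are combinations of those of
irreducible ones. -/
theorem coeff_mem_span {n : ℕ} {u : Matrix (Fin n) (Fin n) A} (hu : IsUnitaryRep u) (i j : Fin n) :
    u i j ∈ Submodule.span ℂ {a : A | ∃ α k l, a = R.u α k l} := by
  induction n using Nat.strong_induction_on with
  | _ n ih =>
  set S := Submodule.span ℂ {a : A | ∃ α k l, a = R.u α k l} with hS
  have hn : 0 < n := i.pos
  by_cases hirr : IsIrreducibleRep u
  · obtain ⟨α, T, h1, -, h3⟩ := R.complete n u hu hirr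
    rw [eq_sum_of_repEquiv h1 h3]
    exact Submodule.sum_mem _ fun r _ => Submodule.sum_mem _ fun s _ =>
      Submodule.smul_mem _ _ (Submodule.subset_span ⟨α, r, s, rfl⟩)
  · obtain ⟨H, hH, hHu, hns⟩ := exists_isHermitian_commute hu hn hirr
    set V : Matrix (Fin n) (Fin n) ℂ :=
      (hH.eigenvectorUnitary : Matrix (Fin n) (Fin n) ℂ) with hV
    have v1 : V * Vᴴ = 1 := (Unitary.mem_iff.mp hH.eigenvectorUnitary.2).2
    have v2 : Vᴴ * V = 1 := (Unitary.mem_iff.mp hH.eigenvectorUnitary.2).1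
    set D : Matrix (Fin n) (Fin n) ℂ := diagonal (fun i => (hH.eigenvalues i : ℂ)) with hD
    have hspec : H = V * D * Vᴴ := by
      have := hH.spectral_theorem
      rw [Unitary.conjStarAlgAut_apply] at this
      exact this
    set w := Vᴴ.map (algebraMap ℂ A) * u * V.map (algebraMap ℂ A) with hw
    have hwu : IsUnitaryRep w := hu.of_conj_unitary v1 v2
    have v1' : V.map (algebraMap ℂ A) * Vᴴ.map (algebraMap ℂ A) = 1 := by
      rw [← map_algebraMap_mul, v1, map_algebraMap_one]
    have v2' : Vᴴ.map (algebraMap ℂ A) * V.map (algebraMap ℂ A) = 1 := by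
      rw [← map_algebraMap_mul, v2, map_algebraMap_one]
    have huw : u * V.map (algebraMap ℂ A) = V.map (algebraMap ℂ A) * w := by
      rw [hw, ← Matrix.mul_assoc, ← Matrix.mul_assoc, v1', Matrix.one_mul]
    have hwD : w * D.map (algebraMap ℂ A) = D.map (algebraMap ℂ A) * w := by
      have hDe : D = Vᴴ * H * V := by
        rw [hspec]
        calc D = (Vᴴ * V) * D * (Vᴴ * V) := by rw [v2]; simp
          _ = _ := by simp only [Matrix.mul_assoc]
      rw [hDe, map_algebraMap_mul, map_algebraMap_mul, hw]
      calc _ = Vᴴ.map (algebraMap ℂ A) * (u * (V.map (algebraMap ℂ A) * Vᴴ.map (algebraMap ℂ A)) *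
            H.map (algebraMap ℂ A)) * V.map (algebraMap ℂ A) := by simp only [Matrix.mul_assoc]
        _ = Vᴴ.map (algebraMap ℂ A) * (H.map (algebraMap ℂ A) *
            (V.map (algebraMap ℂ A) * Vᴴ.map (algebraMap ℂ A)) * u) * V.map (algebraMap ℂ A) := by
          rw [v1', Matrix.mul_one, Matrix.mul_one, hHu]
        _ = _ := by simp only [Matrix.mul_assoc]
    have hw0 : ∀ a b, hH.eigenvalues a ≠ hH.eigenvalues b → w a b = 0 := by
      intro a b hab
      rw [intertwiner_iff] at hwD
      have := hwD a b
      simp only [hD, diagonal_apply, ite_smul, zero_smul, Finset.sum_ite_eq', Finset.sum_ite_eq,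
        Finset.mem_univ, if_true] at this
      have h2 : ((hH.eigenvalues b : ℂ) - hH.eigenvalues a) • w a b = 0 := by
        rw [sub_smul, this, sub_self]
      refine (smul_eq_zero.mp h2).resolve_left (sub_ne_zero.mpr ?_)
      exact_mod_cast hab.symm
    -- each eigenspace of `H` carries a subrepresentation of smaller dimension
    have hwS : ∀ a b, w a b ∈ S := by
      intro a b
      by_cases hab : hH.eigenvalues a = hH.eigenvalues b
      · let p : Finset (Fin n) := Finset.univ.filter fun c => hH.eigenvalues c = hH.eigenvalues a
        have hp : ∀ c, c ∈ p ↔ hH.eigenvalues c = hH.eigenvalues a := fun c => by simp [p]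
        have hcard : p.card < n := by
          refine lt_of_le_of_ne (by simpa using p.card_le_univ) fun hc => ?_
          have hall : ∀ c, hH.eigenvalues c = hH.eigenvalues a := fun c => by
            rw [← hp, Finset.eq_univ_of_card p (by simpa using hc)]
            exact Finset.mem_univ _
          refine hns (hH.eigenvalues a) ?_
          have : D = (hH.eigenvalues a : ℂ) • 1 := by
            rw [hD, smul_one_eq_diagonal]
            simp only [hall]
          refine hspec.trans ?_
          rw [this, Matrix.mul_smul, Matrix.mul_one, Matrix.smul_mul, v1]
        let f : Fin p.card → Fin n := fun c => (p.equivFin.symm c : Fin n)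
        have hf : Function.Injective f := Subtype.val_injective.comp p.equivFin.symm.injective
        have hr : ∀ c, c ∈ Set.range f ↔ hH.eigenvalues c = hH.eigenvalues a := by
          intro c
          rw [← hp]
          constructor
          · rintro ⟨d, rfl⟩; exact (p.equivFin.symm d).2
          · intro hc; exact ⟨p.equivFin ⟨c, hc⟩, by simp [f]⟩
        have hfv : ∀ c, hH.eigenvalues (f c) = hH.eigenvalues a := fun c => (hr _).mp ⟨c, rfl⟩
        have hsub := hwu.submatrix hf
          (fun c d hc => hw0 _ _ fun e => hc ((hr _).mpr (e.trans (hfv d))))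
          (fun c d hd => hw0 _ _ fun e => hd ((hr _).mpr (e.symm.trans (hfv c))))
        obtain ⟨a', ha'⟩ := (hr a).mpr rfl
        obtain ⟨b', hb'⟩ := (hr b).mpr hab.symm
        have := ih _ hcard hsub a' b'
        rwa [submatrix_apply, ha', hb'] at this
      · rw [hw0 a b hab]; exact Submodule.zero_mem _
    rw [eq_sum_of_repEquiv v1 huw]
    exact Submodule.sum_mem _ fun r _ => Submodule.sum_mem _ fun s _ =>
      Submodule.smul_mem _ _ (hwS r s)

variable [IsCompactQuantumGroup A]

theorem span_coeff_irr : Submodule.span ℂ {a : A | ∃ α k l, a = R.u α k l} = ⊤ := by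
  rw [← top_le_iff, ← IsCompactQuantumGroup.span_coeff (A := A), Submodule.span_le]
  rintro a ⟨n, u, hu, i, j, rfl⟩
  exact coeff_mem_span R hu i j

/-- The adjoints of irreducible coefficients span as well. They are the second arguments for
which the twisted convolution has a closed form. -/
theorem span_coeff_star : Submodule.span ℂ {a : A | ∃ α k l, a = star (R.u α k l)} = ⊤ := by
  rw [← top_le_iff]
  intro a _
  have ha : star a ∈ Submodule.span ℂ {a : A | ∃ α k l, a = R.u α k l} := by
    rw [span_coeff_irr]; trivial
  rw [← star_star a]
  generalize star a = b at ha
  induction ha using Submodule.span_induction with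
  | mem x hx =>
    obtain ⟨α, k, l, rfl⟩ := hx
    exact Submodule.subset_span ⟨α, k, l, rfl⟩
  | zero => simp
  | add x y _ _ hx hy => rw [star_add]; exact Submodule.add_mem _ hx hy
  | smul c x _ hx => rw [star_smul]; exact Submodule.smul_mem _ _ hx

variable {h : A →ₗ[ℂ] ℂ} (hh : IsHaarState h) (hKac : IsKacType h)
include hh

/-- Schur orthogonality for inequivalent representations. -/
theorem haar_star_mul_of_ne {α β : I} (hne : α ≠ β) (i j : Fin (R.dim α)) (k l : Fin (R.dim β)) :
    h (star (R.u α i j) * R.u β k l) = 0 := by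
  have hT := hh.intertwiner (R.isUnitaryRep α) (R.isUnitaryRep β) i k
  by_contra h0
  refine hne (R.eq_of_equiv α β (repEquiv_of_intertwiner (R.isUnitaryRep α) (R.isUnitaryRep β)
    (R.irreducible α) (R.irreducible β) hT fun e => h0 ?_))
  exact congrFun (congrFun e j) l

include hKac

/-- The convolution of coefficients. Writing the second factor as the adjoint of a coefficient makes
the conjugate representation disappear. -/
theorem convolution_coeff_self (α : I) (i j k l : Fin (R.dim α)) :
    convolution h (R.u α i j) (HopfAlgebra.antipode ℂ (star (R.u α k l))) =
      if j = l then (R.dim α : ℂ)⁻¹ • R.u α i k else 0 := by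
  have hu := R.isUnitaryRep α
  rw [convolution, hu.antipode_star hh hKac, hu.comul_eq]
  simp only [map_sum, LinearMap.rTensor_tmul, LinearMap.comp_apply, hu.antipode_eq,
    LinearMap.mulRight_apply, TensorProduct.lid_tmul,
    haar_star_mul_self hh hKac hu (R.irreducible α)]
  by_cases hjl : j = l
  · simp [hjl, ite_smul]
  · simp [hjl, Ne.symm hjl]

theorem convolution_coeff_of_ne {α β : I} (hne : α ≠ β) (i j : Fin (R.dim α))
    (k l : Fin (R.dim β)) :
    convolution h (R.u α i j) (HopfAlgebra.antipode ℂ (star (R.u β k l))) = 0 := by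
  have hu := R.isUnitaryRep β
  rw [convolution, hu.antipode_star hh hKac, hu.comul_eq]
  simp only [map_sum, LinearMap.rTensor_tmul, LinearMap.comp_apply, hu.antipode_eq,
    LinearMap.mulRight_apply, TensorProduct.lid_tmul, haar_star_mul_of_ne R hh hne.symm]
  simp

/-- The conjugation `α ↦ ᾱ` of `Irr(G)`, with unitaries that implement the equivalences. -/
theorem exists_conj : ∃ (σ : I → I) (W : ∀ α, Matrix (Fin (R.dim α)) (Fin (R.dim (σ α))) ℂ),
    Function.Injective σ ∧ (∀ α, W α * (W α)ᴴ = 1) ∧ (∀ α, (W α)ᴴ * W α = 1) ∧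
    ∀ α k l, star (R.u α k l) = ∑ r, ∑ s, (W α k r * star (W α l s)) • R.u (σ α) r s := by
  have hc : ∀ α, ∃ β, RepEquiv ((R.u α).map star) (R.u β) := fun α =>
    R.complete _ _ ((R.isUnitaryRep α).conj hh hKac) (R.irreducible α).conj
  choose σ hσ using hc
  choose W h1 h2 h3 using id hσ
  refine ⟨σ, W, fun α β hαβ => R.eq_of_equiv α β ?_, h1, h2, fun α k l => ?_⟩
  · have hα : RepEquiv ((R.u α).map star) (R.u (σ β)) := hαβ ▸ hσ α
    have := (hα.trans ((hσ β).symm ((R.isUnitaryRep β).conj hh hKac) (R.isUnitaryRep _))).conj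
    simpa [Matrix.map_map, Function.comp_def] using this
  · exact eq_sum_of_repEquiv (h1 α) (h3 α) k l

omit hKac in
/-- The Fourier transform has finite support; this is what the finite sum in the definition of
`haarMul` needs in order not to collapse to zero. -/
theorem finite_fourierTransform_ne_zero (x : A) : {α | fourierTransform R h x α ≠ 0}.Finite := by
  have hx : x ∈ Submodule.span ℂ {a : A | ∃ α k l, a = R.u α k l} := by
    rw [span_coeff_irr]; trivial
  induction hx using Submodule.span_induction with
  | mem x hx =>
    obtain ⟨α, k, l, rfl⟩ := hx
    refine (Set.finite_singleton α).subset fun β hβ => ?_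
    by_contra hne
    refine hβ ?_
    ext i j
    exact haar_star_mul_of_ne R hh hne _ _ _ _
  | zero =>
    convert Set.finite_empty
    ext α
    simp only [Set.mem_ofPred_eq, Set.mem_empty_iff_false, iff_false, not_not]
    ext i j
    simp [fourierTransform]
  | add x y _ _ hx hy =>
    refine (hx.union hy).subset fun α hα => ?_
    by_contra hcon
    simp only [Set.mem_union, Set.mem_ofPred_eq, not_or, not_not] at hcon
    refine hα ?_
    have : fourierTransform R h (x + y) α =
        fourierTransform R h x α + fourierTransform R h y α := by
      ext i j; simp [fourierTransform, mul_add]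
    rw [this, hcon.1, hcon.2, add_zero]
  | smul c x _ hx =>
    refine hx.subset fun α hα h0 => hα ?_
    have : fourierTransform R h (c • x) α = c • fourierTransform R h x α := by
      ext i j; simp [fourierTransform]
    rw [this, h0, smul_zero]

omit hKac in
theorem polEmbed_apply (x : A) (a : LInfDual R.dim) :
    FourierAlgebra.toDual R.dim (polEmbed R h x) a =
      ∑ᶠ α, (R.dim α : ℂ) * (LInfDual.coord α a * fourierTransform R h x α).trace :=
  haarMul_apply (finite_fourierTransform_ne_zero R hh x) a

omit hKac in
/-- The embedding of the coefficient `u_{kl}` of `u^α` is the coordinate functional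
`a ↦ (a_α)_{kl}`. -/
theorem polEmbed_coeff (hKac : IsKacType h) (α : I) (k l : Fin (R.dim α)) (a : LInfDual R.dim) :
    FourierAlgebra.toDual R.dim (polEmbed R h (R.u α k l)) a = LInfDual.coord α a k l := by
  have hn : (R.dim α : ℂ) ≠ 0 := by exact_mod_cast (R.irreducible α).1.ne'
  rw [polEmbed_apply R hh, finsum_eq_single _ α]
  · have : fourierTransform R h (R.u α k l) α = Matrix.single l k (R.dim α : ℂ)⁻¹ := by
      ext i j
      simp only [fourierTransform, of_apply, haar_star_mul_self hh hKac (R.isUnitaryRep α)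
        (R.irreducible α), Matrix.single_apply]
      congr 1
      exact propext ⟨fun e => ⟨e.2.symm, e.1.symm⟩, fun e => ⟨e.2.symm, e.1.symm⟩⟩
    rw [this, Matrix.trace_mul_single]
    simp only [MulOpposite.smul_eq_mul_unop, MulOpposite.unop_op]
    field_simp
  · intro β hβ
    have : fourierTransform R h (R.u α k l) β = 0 := by
      ext i j
      exact haar_star_mul_of_ne R hh hβ _ _ _ _
    simp [this]

omit hKac in
theorem polEmbed_add (x y : A) : polEmbed R h (x + y) = polEmbed R h x + polEmbed R h y := by
  rw [polEmbed, polEmbed, polEmbed, ← haarMul_add (finite_fourierTransform_ne_zero R hh x)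
    (finite_fourierTransform_ne_zero R hh y)]
  congr 1
  ext α i j
  simp [fourierTransform, mul_add]

omit hKac in
theorem polEmbed_smul (c : ℂ) (x : A) : polEmbed R h (c • x) = c • polEmbed R h x := by
  rw [polEmbed, polEmbed, ← haarMul_smul c (finite_fourierTransform_ne_zero R hh x)]
  congr 1
  ext α i j
  simp [fourierTransform]

omit hh hKac in
theorem convolution_add_left (a a' b : A) :
    convolution h (a + a') b = convolution h a b + convolution h a' b := by
  simp only [convolution]
  rw [← map_add, ← LinearMap.add_apply, ← LinearMap.rTensor_add]
  congr 3
  ext x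
  simp [mul_add]

omit hh hKac in
theorem convolution_smul_left (c : ℂ) (a b : A) :
    convolution h (c • a) b = c • convolution h a b := by
  simp only [convolution]
  rw [← map_smul, ← LinearMap.smul_apply, ← LinearMap.rTensor_smul]
  congr 3
  ext x
  simp

omit hh hKac in
theorem convolution_add_right (a b b' : A) :
    convolution h a (b + b') = convolution h a b + convolution h a b' := by
  simp [convolution]

omit hh hKac in
theorem convolution_smul_right (c : ℂ) (a b : A) :
    convolution h a (c • b) = c • convolution h a b := by
  simp [convolution]

end cqg

/-! ### A separation theorem -/

section sublinear

/-- A form of the Hahn-Banach theorem: a convex cone below the graph of a sublinear function is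
separated from it by a linear function. -/
theorem exists_linear_between {Z : Type*} [AddCommGroup Z] [Module ℝ Z] (π : Z → ℝ)
    (hπs : ∀ c : ℝ, 0 < c → ∀ z, π (c • z) = c * π z) (hπa : ∀ z w, π (z + w) ≤ π z + π w)
    (K : Set (Z × ℝ)) (hK0 : (0, 0) ∈ K)
    (hKs : ∀ c : ℝ, 0 < c → ∀ z t, (z, t) ∈ K → (c • z, c * t) ∈ K)
    (hKa : ∀ z t w s, (z, t) ∈ K → (w, s) ∈ K → (z + w, t + s) ∈ K)
    (hK : ∀ z t, (z, t) ∈ K → t ≤ π z) :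
    ∃ L : Z →ₗ[ℝ] ℝ, (∀ z, L z ≤ π z) ∧ ∀ z t, (z, t) ∈ K → t ≤ L z := by
  have hπ0 : π 0 = 0 := by
    have := hπs 2 (by norm_num) 0
    rw [smul_zero] at this
    linarith
  -- `ν` is the infimal convolution of `π` with the cone; it is again sublinear, and a linear
  -- function below `ν` is below `π` and above the cone
  set Q : Z → Set ℝ := fun z => {r | ∃ w t, (w, t) ∈ K ∧ r = π (z + w) - t} with hQ
  have hne : ∀ z, (Q z).Nonempty := fun z => ⟨_, 0, 0, hK0, rfl⟩
  have hlow : ∀ z, ∀ r ∈ Q z, -π (-z) ≤ r := by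
    rintro z _ ⟨w, t, hwt, rfl⟩
    have h1 := hπa (z + w) (-z)
    have h2 : z + w + -z = w := by abel
    rw [h2] at h1
    have := hK w t hwt
    linarith
  have hbdd : ∀ z, BddBelow (Q z) := fun z => ⟨_, hlow z⟩
  set ν : Z → ℝ := fun z => sInf (Q z) with hν
  have hνle : ∀ z w t, (w, t) ∈ K → ν z ≤ π (z + w) - t := fun z w t h =>
    csInf_le (hbdd z) ⟨w, t, h, rfl⟩
  have hνs1 : ∀ c : ℝ, 0 < c → ∀ z, ν (c • z) ≤ c * ν z := by
    intro c hc z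
    rw [← div_le_iff₀' hc]
    refine le_csInf (hne z) ?_
    rintro _ ⟨w, t, hwt, rfl⟩
    rw [div_le_iff₀' hc]
    have := hνle (c • z) (c • w) (c * t) (hKs c hc w t hwt)
    rw [← smul_add, hπs c hc] at this
    linarith
  have hνs : ∀ c : ℝ, 0 < c → ∀ z, ν (c • z) = c * ν z := by
    intro c hc z
    refine le_antisymm (hνs1 c hc z) ?_
    have := hνs1 c⁻¹ (inv_pos.mpr hc) (c • z)
    rwa [inv_smul_smul₀ hc.ne', ← div_eq_inv_mul, le_div_iff₀' hc] at this
  have hνa : ∀ z z', ν (z + z') ≤ ν z + ν z' := by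
    intro z z'
    rw [← sub_le_iff_le_add]
    refine le_csInf (hne z) ?_
    rintro _ ⟨w, t, hwt, rfl⟩
    rw [sub_le_comm]
    refine le_csInf (hne z') ?_
    rintro _ ⟨w', t', hwt', rfl⟩
    have h1 := hνle (z + z') (w + w') (t + t') (hKa _ _ _ _ hwt hwt')
    have h2 := hπa (z + w) (z' + w')
    have h3 : z + z' + (w + w') = z + w + (z' + w') := by abel
    rw [h3] at h1
    linarith
  obtain ⟨L, -, hL⟩ := exists_extension_of_le_sublinear (⟨⊥, 0⟩ : Z →ₗ.[ℝ] ℝ) ν hνs hνa (by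
    rintro ⟨x, hx⟩
    have hx0 : x = 0 := (Submodule.mem_bot ℝ).mp hx
    subst hx0
    have h0 := hνa 0 0
    rw [add_zero] at h0
    change (0 : ℝ) ≤ ν 0
    linarith)
  refine ⟨L, fun z => (hL z).trans ?_, fun z t hzt => ?_⟩
  · have := hνle z 0 0 hK0
    simpa using this
  · have h1 := (hL (-z)).trans (hνle (-z) z t hzt)
    rw [neg_add_cancel, hπ0, map_neg] at h1
    linarith

end sublinear

/-! ### Matrix seminorms and completely contractive maps into matrix algebras -/

/-- Matrix seminorms: Ruan's axioms without definiteness. Subadditivity and homogeneity are not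
listed since they follow from the two inequalities (`IsMatrixSeminorm.add_le`). The definition
covers spaces whose matrix norms are not known to be definite, such as the algebraic tensor product
with the projective norm. -/
structure IsMatrixSeminorm (E : Type*) [AddCommGroup E] [Module ℂ E] [MatrixNorm E] : Prop where
  nonneg : ∀ {ι : Type} [Fintype ι] [DecidableEq ι] (x : Matrix ι ι E), 0 ≤ mnorm x
  fromBlocks_le : ∀ {ι κ : Type} [Fintype ι] [DecidableEq ι] [Fintype κ] [DecidableEq κ]
    (x : Matrix ι ι E) (y : Matrix κ κ E),
    mnorm (Matrix.fromBlocks x 0 0 y) ≤ max (mnorm x) (mnorm y)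
  sandwich_le : ∀ {ι κ : Type} [Fintype ι] [DecidableEq ι] [Fintype κ] [DecidableEq κ]
    (α : Matrix ι κ ℂ) (x : Matrix κ κ E) (β : Matrix κ ι ℂ),
    mnorm (sandwich α x β) ≤ ‖α‖ * mnorm x * ‖β‖

section matrices
variable {ι κ : Type} [Fintype ι] [DecidableEq ι] [Fintype κ] [DecidableEq κ]

/-- The sum of the squares of the moduli of the entries, as a trace. -/
theorem trace_mul_conjTranspose {m n : Type*} [Fintype m] [Fintype n] (M : Matrix m n ℂ) :
    (M * M.conjTranspose).trace = ((∑ i, ∑ j, ‖M i j‖ ^ 2 : ℝ) : ℂ) := by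
  simp [Matrix.trace, Matrix.mul_apply, ← Complex.mul_conj']

open Matrix in
open scoped MatrixOrder in
/-- A positive functional on matrices is, up to an arbitrarily small error, of the form
`α αᴴ ↦ ‖B α‖₂²` with `B` invertible. -/
theorem exists_sq_of_positive (ℓ : Matrix ι ι ℂ →ₗ[ℝ] ℝ)
    (hℓ : ∀ x : ι → ℂ, 0 ≤ ℓ (vecMulVec x (star x))) {ε : ℝ} (hε : 0 < ε) :
    ∃ B C : Matrix ι ι ℂ, B * C = 1 ∧ C * B = 1 ∧
      (∀ (κ : Type) [Fintype κ] (α : Matrix ι κ ℂ), ℓ (α * αᴴ) ≤ ∑ i, ∑ s, ‖(B * α) i s‖ ^ 2) ∧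
      ∑ i, ∑ j, ‖B i j‖ ^ 2 = ℓ 1 + ε * Fintype.card ι := by
  set g : Module.Dual ℂ (Matrix ι ι ℂ) := Module.Dual.extendRCLike ℓ with hg
  have hgre : ∀ A, (g A).re = ℓ A := fun A => Module.Dual.re_extendRCLike_apply (𝕜 := ℂ) ℓ A
  -- the density matrix of `ℓ`, made Hermitian below and positive definite by adding `ε`
  set τ : Matrix ι ι ℂ := Matrix.of fun i j => g (Matrix.single j i 1) with hτ
  have hgτ : ∀ A, g A = (τ * A).trace := by
    intro A
    conv_lhs => rw [Matrix.matrix_eq_sum_single A]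
    simp only [map_sum, Matrix.trace, Matrix.diag_apply, Matrix.mul_apply, hτ, of_apply]
    rw [Finset.sum_comm]
    refine Finset.sum_congr rfl fun i _ => Finset.sum_congr rfl fun j _ => ?_
    have : Matrix.single j i (A j i) = A j i • Matrix.single j i (1 : ℂ) := by simp
    rw [this, map_smul, smul_eq_mul, mul_comm]
  set ρ : Matrix ι ι ℂ := (2 : ℂ)⁻¹ • (τ + τᴴ) with hρ
  have hρH : ρ.IsHermitian := by
    simp [hρ, Matrix.IsHermitian, add_comm]
  have hρℓ : ∀ A : Matrix ι ι ℂ, A.IsHermitian → (ρ * A).trace = (ℓ A : ℂ) := by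
    intro A hA
    have h1 : (τᴴ * A).trace = star (τ * A).trace := by
      rw [← Matrix.trace_conjTranspose, conjTranspose_mul, hA.eq, Matrix.trace_mul_comm]
    rw [hρ, Matrix.smul_mul, Matrix.trace_smul, Matrix.add_mul, Matrix.trace_add, h1, ← hgτ,
      ← hgre]
    simp only [Complex.star_def, Complex.add_conj, smul_eq_mul]
    push_cast
    ring
  have hρ0 : ρ.PosSemidef := by
    refine Matrix.PosSemidef.of_dotProduct_mulVec_nonneg hρH fun x => ?_
    have h1 : star x ⬝ᵥ (ρ *ᵥ x) = (ρ * vecMulVec x (star x)).trace := by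
      rw [Matrix.mul_vecMulVec, Matrix.trace_vecMulVec, dotProduct_comm]
    rw [h1, hρℓ]
    · exact_mod_cast hℓ x
    · simp [Matrix.IsHermitian, conjTranspose_vecMulVec]
  have hρε : (ρ + (ε : ℂ) • 1).PosDef := by
    refine Matrix.PosDef.posSemidef_add hρ0 ?_
    exact Matrix.PosDef.smul Matrix.PosDef.one (by exact_mod_cast hε)
  obtain ⟨B, hB⟩ := CStarAlgebra.nonneg_iff_eq_star_mul_self.mp hρε.posSemidef.nonneg
  have hB' : Bᴴ * B = ρ + (ε : ℂ) • 1 := hB.symm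
  obtain ⟨D, hD⟩ := hρε.isUnit
  have hCB : ((D⁻¹ : (Matrix ι ι ℂ)ˣ).val * Bᴴ) * B = 1 := by
    rw [Matrix.mul_assoc, hB', ← hD, Units.inv_mul]
  have key : ∀ (κ : Type) [Fintype κ] (α : Matrix ι κ ℂ),
      ((∑ i, ∑ s, ‖(B * α) i s‖ ^ 2 : ℝ) : ℂ) =
        ((ℓ (α * αᴴ) + ε * ∑ i, ∑ s, ‖α i s‖ ^ 2 : ℝ) : ℂ) := by
    intro κ _ α
    rw [← trace_mul_conjTranspose, conjTranspose_mul, Matrix.trace_mul_comm]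
    have : αᴴ * Bᴴ * (B * α) = αᴴ * ((ρ + (ε : ℂ) • 1) * α) := by
      rw [← hB']; simp only [Matrix.mul_assoc]
    rw [this, Matrix.trace_mul_comm, Matrix.mul_assoc, Matrix.add_mul, Matrix.trace_add,
      hρℓ _ (Matrix.isHermitian_mul_conjTranspose_self α), Matrix.smul_mul, Matrix.one_mul,
      Matrix.trace_smul, trace_mul_conjTranspose]
    push_cast
    rfl
  refine ⟨B, (D⁻¹ : (Matrix ι ι ℂ)ˣ).val * Bᴴ, mul_eq_one_comm.mp hCB, hCB, fun κ _ α => ?_, ?_⟩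
  · have := Complex.ofReal_injective (key κ α)
    rw [this]
    have : 0 ≤ ∑ i, ∑ s, ‖α i s‖ ^ 2 := by positivity
    nlinarith
  · have := Complex.ofReal_injective (key ι 1)
    rw [Matrix.mul_one, conjTranspose_one, Matrix.mul_one] at this
    rw [this]
    simp [Matrix.one_apply, apply_ite norm, ite_pow]

/-- A matrix is contractive if its bilinear form is dominated by the arithmetic mean of the squared
norms. -/
theorem norm_le_one_of_re {m n : Type*} [Fintype m] [Fintype n] [DecidableEq n]
    (M : Matrix m n ℂ) (h : ∀ (x : m → ℂ) (y : n → ℂ),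
      2 * (∑ i, ∑ j, x i * M i j * y j).re ≤ ∑ i, ‖x i‖ ^ 2 + ∑ j, ‖y j‖ ^ 2) : ‖M‖ ≤ 1 := by
  refine l2_le _ zero_le_one fun v => ?_
  -- the vector dual to `M v` turns the bilinear form into `‖M v‖²`
  have h1 := h (fun i => star (M.mulVec v i)) v
  have h2 : ∑ i, ∑ j, star (M.mulVec v i) * M i j * v j =
      ((∑ i, ‖M.mulVec v i‖ ^ 2 : ℝ) : ℂ) := by
    push_cast
    refine Finset.sum_congr rfl fun i _ => ?_
    rw [← Complex.conj_mul']
    conv_rhs => rw [Matrix.mulVec, dotProduct]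
    rw [Finset.mul_sum]
    exact Finset.sum_congr rfl fun j _ => mul_assoc _ _ _
  rw [h2, Complex.ofReal_re] at h1
  simp only [norm_star] at h1
  linarith

/-- The bilinear form of a matrix is bounded by its operator norm. -/
theorem norm_sum_mul_mul_le {m n : Type*} [Fintype m] [Fintype n] [DecidableEq m] [DecidableEq n]
    (M : Matrix m n ℂ) (x : m → ℂ) (y : n → ℂ) :
    ‖∑ i, ∑ j, x i * M i j * y j‖ ≤ √(∑ i, ‖x i‖ ^ 2) * ‖M‖ * √(∑ j, ‖y j‖ ^ 2) := by
  set P := (Matrix.of fun (_ : Unit) i => x i) * M * (Matrix.of fun j (_ : Unit) => y j) with hP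
  have h1 : P () () = ∑ i, ∑ j, x i * M i j * y j := by
    simp only [hP, Matrix.mul_apply, Matrix.of_apply, Finset.sum_mul]
    rw [Finset.sum_comm]
  have h2 : ‖P () ()‖ ≤ ‖P‖ := by
    have := l2_apply P fun _ => 1
    simp only [Matrix.mulVec, dotProduct, mul_one, Finset.univ_unique, Finset.sum_singleton,
      norm_one, one_pow] at this
    exact le_of_sq_le_sq this (norm_nonneg _)
  rw [← h1]
  refine h2.trans ((Matrix.l2_opNorm_mul _ _).trans ?_)
  gcongr
  · refine (Matrix.l2_opNorm_mul _ _).trans ?_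
    gcongr
    exact l2_row_le x
  · exact l2_col_le y

end matrices

section sandwich
variable {E ι κ κ' : Type*} [AddCommGroup E] [Module ℂ E] [Fintype κ] [Fintype κ']

theorem sandwich_zero (α : Matrix ι κ ℂ) (β : Matrix κ ι ℂ) :
    sandwich α (0 : Matrix κ κ E) β = 0 := by
  ext i j; simp [sandwich]

theorem sandwich_one [Fintype ι] [DecidableEq ι] (x : Matrix ι ι E) : sandwich 1 x 1 = x := by
  ext i j; simp [sandwich, Matrix.one_apply]

theorem sandwich_fromBlocks (α : Matrix ι κ ℂ) (α' : Matrix ι κ' ℂ) (x : Matrix κ κ E)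
    (x' : Matrix κ' κ' E) (β : Matrix κ ι ℂ) (β' : Matrix κ' ι ℂ) :
    sandwich (Matrix.fromCols α α') (Matrix.fromBlocks x 0 0 x') (Matrix.fromRows β β') =
      sandwich α x β + sandwich α' x' β' := by
  ext i j; simp [sandwich, Fintype.sum_sum_type]

theorem sandwich_map {F : Type*} [AddCommGroup F] [Module ℂ F] (T : E →ₗ[ℂ] F) (α : Matrix ι κ ℂ)
    (x : Matrix κ κ E) (β : Matrix κ ι ℂ) :
    (sandwich α x β).map T = sandwich α (x.map T) β := by
  ext i j; simp [sandwich]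

theorem fromCols_mul_conjTranspose (α : Matrix ι κ ℂ) (α' : Matrix ι κ' ℂ) :
    Matrix.fromCols α α' * (Matrix.fromCols α α').conjTranspose =
      α * α.conjTranspose + α' * α'.conjTranspose := by
  rw [Matrix.conjTranspose_fromCols_eq_fromRows_conjTranspose, Matrix.fromCols_mul_fromRows]

theorem conjTranspose_mul_fromRows (β : Matrix κ ι ℂ) (β' : Matrix κ' ι ℂ) :
    (Matrix.fromRows β β').conjTranspose * Matrix.fromRows β β' =
      β.conjTranspose * β + β'.conjTranspose * β' := by
  rw [Matrix.conjTranspose_fromRows_eq_fromCols_conjTranspose, Matrix.fromCols_mul_fromRows]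

end sandwich

theorem norm_one_le {ι : Type*} [Fintype ι] [DecidableEq ι] : ‖(1 : Matrix ι ι ℂ)‖ ≤ 1 :=
  l2_le _ zero_le_one fun v => by simp

namespace IsMatrixSeminorm
variable {E : Type*} [AddCommGroup E] [Module ℂ E] [MatrixNorm E] (hE : IsMatrixSeminorm E)
variable {ι κ : Type} [Fintype ι] [DecidableEq ι] [Fintype κ] [DecidableEq κ]
include hE

theorem smul_le (c : ℂ) (x : Matrix ι ι E) : mnorm (c • x) ≤ ‖c‖ * mnorm x := by
  have h := hE.sandwich_le (c • (1 : Matrix ι ι ℂ)) x 1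
  have e := sandwich_smul c 1 1 (1 : Matrix ι ι ℂ) x 1
  rw [one_smul, one_smul, mul_one, mul_one, sandwich_one] at e
  rw [e, norm_smul] at h
  have h1 := norm_one_le (ι := ι)
  have := hE.nonneg x
  calc mnorm (c • x) ≤ ‖c‖ * 1 * mnorm x * 1 := h.trans (by gcongr)
    _ = _ := by ring

theorem map_zero : mnorm (0 : Matrix ι ι E) = 0 := by
  have := hE.smul_le 0 (0 : Matrix ι ι E)
  rw [smul_zero, norm_zero, zero_mul] at this
  exact le_antisymm this (hE.nonneg _)

theorem smul_pos {c : ℝ} (hc : 0 < c) (x : Matrix ι ι E) : mnorm (c • x) = c * mnorm x := by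
  have key : ∀ c : ℝ, 0 < c → ∀ x : Matrix ι ι E, mnorm (c • x) ≤ c * mnorm x := by
    intro c hc x
    have := hE.smul_le (c : ℂ) x
    rwa [Complex.norm_real, Real.norm_of_nonneg hc.le, Complex.coe_smul] at this
  refine le_antisymm (key c hc x) ?_
  have := key c⁻¹ (inv_pos.mpr hc) (c • x)
  rwa [inv_smul_smul₀ hc.ne', ← div_eq_inv_mul, le_div_iff₀' hc] at this

/-- Subadditivity: `x + y` is a sandwich of the block diagonal matrix of `x / s` and `y / t` between
a row and a column of norm `√(s + t)`. -/
theorem add_le (x y : Matrix ι ι E) : mnorm (x + y) ≤ mnorm x + mnorm y := by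
  have key : ∀ s t : ℝ, 0 < s → 0 < t → mnorm x ≤ s → mnorm y ≤ t → mnorm (x + y) ≤ s + t := by
    intro s t hs ht hxs hyt
    have h0 : mnorm (Matrix.fromBlocks ((s⁻¹ : ℝ) • x) 0 0 ((t⁻¹ : ℝ) • y)) ≤ 1 := by
      refine (hE.fromBlocks_le _ _).trans (max_le ?_ ?_)
      · rw [hE.smul_pos (inv_pos.mpr hs), inv_mul_le_iff₀ hs]; simpa
      · rw [hE.smul_pos (inv_pos.mpr ht), inv_mul_le_iff₀ ht]; simpa
    set β : Matrix (ι ⊕ ι) ι ℂ := Matrix.fromRows ((√s : ℂ) • 1) ((√t : ℂ) • 1) with hβ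
    have hβn : ‖β‖ ≤ √(s + t) := by
      refine l2_le _ (by positivity) fun v => ?_
      rw [Real.sq_sqrt (by positivity)]
      simp [hβ, Matrix.fromRows_mulVec, Matrix.smul_mulVec, mul_pow, Real.sq_sqrt hs.le,
        Real.sq_sqrt ht.le, ← Finset.mul_sum, add_mul]
    have h := hE.sandwich_le β.conjTranspose
      (Matrix.fromBlocks ((s⁻¹ : ℝ) • x) 0 0 ((t⁻¹ : ℝ) • y)) β
    have e : sandwich β.conjTranspose (Matrix.fromBlocks ((s⁻¹ : ℝ) • x) 0 0 ((t⁻¹ : ℝ) • y)) β =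
        x + y := by
      have hroot : ∀ r : ℝ, 0 < r → (√r : ℂ) * √r * ((r⁻¹ : ℝ) : ℂ) = 1 := fun r hr => by
        rw [← Complex.ofReal_mul, ← Complex.ofReal_mul, Real.mul_self_sqrt hr.le,
          mul_inv_cancel₀ hr.ne', Complex.ofReal_one]
      rw [hβ, Matrix.conjTranspose_fromRows_eq_fromCols_conjTranspose, sandwich_fromBlocks]
      simp only [Matrix.conjTranspose_smul, Matrix.conjTranspose_one, Complex.star_def,
        Complex.conj_ofReal, ← Complex.coe_smul, sandwich_smul, sandwich_one]
      rw [hroot s hs, hroot t ht, one_smul, one_smul]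
    rw [e, Matrix.l2_opNorm_conjTranspose] at h
    have := hE.nonneg (Matrix.fromBlocks ((s⁻¹ : ℝ) • x) 0 0 ((t⁻¹ : ℝ) • y))
    calc mnorm (x + y) ≤ √(s + t) * 1 * √(s + t) := h.trans (by gcongr)
      _ = s + t := by rw [mul_one, Real.mul_self_sqrt (by positivity)]
  refine le_of_forall_pos_le_add fun ε hε => ?_
  have := key (mnorm x + ε / 2) (mnorm y + ε / 2) (by linarith [hE.nonneg x, half_pos hε])
    (by linarith [hE.nonneg y, half_pos hε]) (by linarith) (by linarith)
  linarith

/-- A functional dominated by the matrix norm and attaining it at `x`. -/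
theorem exists_functional (x : Matrix ι ι E) : ∃ f : Module.Dual ℂ (Matrix ι ι E),
    (∀ y, (f y).re ≤ mnorm y) ∧ mnorm x ≤ (f x).re := by
  obtain ⟨L, hL, hL'⟩ := exists_linear_between (Z := Matrix ι ι E) (fun y => mnorm y)
    (fun c hc y => hE.smul_pos hc y) hE.add_le
    -- the ray through `(x, ‖x‖)`
    {p | ∃ c : ℝ, 0 ≤ c ∧ p = (c • x, c * mnorm x)} ⟨0, le_rfl, by simp⟩ (by
      rintro c hc z t ⟨d, hd, h⟩
      obtain ⟨rfl, rfl⟩ := Prod.mk.inj h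
      exact ⟨c * d, by positivity, by rw [mul_smul, mul_assoc]⟩) (by
      rintro z t w s ⟨c, hc, h⟩ ⟨d, hd, h'⟩
      obtain ⟨rfl, rfl⟩ := Prod.mk.inj h
      obtain ⟨rfl, rfl⟩ := Prod.mk.inj h'
      exact ⟨c + d, by positivity, by rw [add_smul, add_mul]⟩) (by
      rintro z t ⟨c, hc, h⟩
      obtain ⟨rfl, rfl⟩ := Prod.mk.inj h
      rcases hc.eq_or_lt with rfl | hc
      · simpa using hE.nonneg _
      · exact (hE.smul_pos hc x).ge)
  have hre : ∀ y, (Module.Dual.extendRCLike (𝕜 := ℂ) L y).re = L y := fun y =>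
    Module.Dual.re_extendRCLike_apply (𝕜 := ℂ) L y
  refine ⟨Module.Dual.extendRCLike L, fun y => ?_, ?_⟩
  · rw [hre]; exact hL y
  · rw [hre]; exact hL' _ _ ⟨1, zero_le_one, by simp⟩

open Matrix in
/-- The functional of `exists_functional` is dominated by a pair of positive functionals on scalar
matrices: this is the separation argument behind the representation theorem for operator spaces. -/
theorem exists_states (f : Module.Dual ℂ (Matrix ι ι E)) (hf : ∀ y, (f y).re ≤ mnorm y) :
    ∃ L₁ L₂ : Matrix ι ι ℂ →ₗ[ℝ] ℝ, L₁ 1 ≤ 1 ∧ L₂ 1 ≤ 1 ∧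
      (∀ x : ι → ℂ, 0 ≤ L₁ (vecMulVec x (star x))) ∧
      (∀ x : ι → ℂ, 0 ≤ L₂ (vecMulVec x (star x))) ∧
      ∀ (κ : Type) [Fintype κ] [DecidableEq κ] (α : Matrix ι κ ℂ) (v : Matrix κ κ E)
        (β : Matrix κ ι ℂ), mnorm v ≤ 1 →
        2 * (f (sandwich α v β)).re ≤ L₁ (α * αᴴ) + L₂ (βᴴ * β) := by
  -- the cone of all inequalities to be satisfied; it is closed under addition because block
  -- diagonal matrices carry the maximum norm, and it lies below the sum of the operator norms by
  -- the inequality of the arithmetic and geometric means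
  set K : Set ((Matrix ι ι ℂ × Matrix ι ι ℂ) × ℝ) := {p | ∃ (κ : Type) (_ : Fintype κ)
    (_ : DecidableEq κ) (α : Matrix ι κ ℂ) (v : Matrix κ κ E) (β : Matrix κ ι ℂ), mnorm v ≤ 1 ∧
    p = ((α * αᴴ, βᴴ * β), 2 * (f (sandwich α v β)).re)} with hK
  obtain ⟨L, hL, hL'⟩ := exists_linear_between (Z := Matrix ι ι ℂ × Matrix ι ι ℂ)
    (fun z => ‖z.1‖ + ‖z.2‖) (fun c hc z => by
      change ‖c • z.1‖ + ‖c • z.2‖ = _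
      rw [norm_smul, norm_smul, Real.norm_of_nonneg hc.le, mul_add])
    (fun z w => by
      have h1 := norm_add_le z.1 w.1
      have h2 := norm_add_le z.2 w.2
      change ‖z.1 + w.1‖ + ‖z.2 + w.2‖ ≤ _
      linarith) K
    ⟨ι, inferInstance, inferInstance, 0, 0, 0, by rw [hE.map_zero]; exact zero_le_one, by
      simp [sandwich_zero]; rfl⟩ (by
      rintro c hc z t ⟨κ, _, _, α, v, β, hv, h⟩
      obtain ⟨rfl, rfl⟩ := Prod.mk.inj h
      have hcc : (√c : ℂ) * √c = (c : ℂ) := by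
        rw [← Complex.ofReal_mul, Real.mul_self_sqrt hc.le]
      refine ⟨κ, inferInstance, inferInstance, (√c : ℂ) • α, v, (√c : ℂ) • β, hv, ?_⟩
      have e := sandwich_smul (√c : ℂ) (√c : ℂ) 1 α v β
      rw [one_smul, mul_one, hcc] at e
      rw [e, map_smul, conjTranspose_smul, conjTranspose_smul, Complex.star_def,
        Complex.conj_ofReal, Matrix.smul_mul, Matrix.smul_mul, Matrix.mul_smul, Matrix.mul_smul,
        smul_smul, smul_smul, hcc, Complex.coe_smul, Complex.coe_smul, Prod.smul_mk, smul_eq_mul,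
        Complex.re_ofReal_mul]
      congr 1
      ring) (by
      rintro z t w s ⟨κ, _, _, α, v, β, hv, h⟩ ⟨κ', _, _, α', v', β', hv', h'⟩
      obtain ⟨rfl, rfl⟩ := Prod.mk.inj h
      obtain ⟨rfl, rfl⟩ := Prod.mk.inj h'
      refine ⟨κ ⊕ κ', inferInstance, inferInstance, fromCols α α', fromBlocks v 0 0 v',
        fromRows β β', (hE.fromBlocks_le _ _).trans (max_le hv hv'), ?_⟩
      rw [sandwich_fromBlocks, fromCols_mul_conjTranspose, conjTranspose_mul_fromRows, map_add,
        Complex.add_re, mul_add]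
      rfl) (by
      rintro z t ⟨κ, _, _, α, v, β, hv, h⟩
      obtain ⟨rfl, rfl⟩ := Prod.mk.inj h
      have h1 := hE.sandwich_le α v β
      have h2 := hf (sandwich α v β)
      have h3 : ‖α * αᴴ‖ = ‖α‖ * ‖α‖ := by
        have := l2_opNorm_conjTranspose_mul_self αᴴ
        rwa [conjTranspose_conjTranspose, l2_opNorm_conjTranspose] at this
      change _ ≤ ‖α * αᴴ‖ + ‖βᴴ * β‖
      rw [h3, l2_opNorm_conjTranspose_mul_self]
      have h4 : ‖α‖ * mnorm v * ‖β‖ ≤ ‖α‖ * 1 * ‖β‖ := by gcongr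
      nlinarith [sq_nonneg (‖α‖ - ‖β‖)])
  have h0 : ∀ (α : Matrix ι Unit ℂ) (β : Matrix Unit ι ℂ), 0 ≤ L (α * αᴴ, βᴴ * β) := by
    intro α β
    refine hL' _ _ ⟨Unit, inferInstance, inferInstance, α, 0, β, ?_, ?_⟩
    · rw [hE.map_zero]; exact zero_le_one
    · simp [sandwich_zero]
  refine ⟨L ∘ₗ LinearMap.inl ℝ _ _, L ∘ₗ LinearMap.inr ℝ _ _, ?_, ?_, fun x => ?_, fun x => ?_, ?_⟩
  · refine (hL _).trans ?_
    simpa using norm_one_le (ι := ι)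
  · refine (hL _).trans ?_
    simpa using norm_one_le (ι := ι)
  · have := h0 (Matrix.of fun i _ => x i) 0
    have e : (Matrix.of fun i (_ : Unit) => x i) * (Matrix.of fun i (_ : Unit) => x i)ᴴ =
        vecMulVec x (star x) := by
      ext i j; simp [vecMulVec, Matrix.mul_apply]
    rwa [e, conjTranspose_zero, Matrix.zero_mul] at this
  · have := h0 0 (Matrix.of fun _ i => star (x i))
    have e : (Matrix.of fun (_ : Unit) i => star (x i))ᴴ *
        (Matrix.of fun (_ : Unit) i => star (x i)) = vecMulVec x (star x) := by
      ext i j; simp [vecMulVec, Matrix.mul_apply]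
    rwa [e, Matrix.zero_mul] at this
  · intro κ _ _ α v β hv
    have := hL' _ _ ⟨κ, inferInstance, inferInstance, α, v, β, hv, rfl⟩
    have e : ((α * αᴴ, βᴴ * β) : Matrix ι ι ℂ × Matrix ι ι ℂ) =
      LinearMap.inl ℝ _ _ (α * αᴴ) + LinearMap.inr ℝ _ _ (βᴴ * β) := by simp
    rw [e, map_add] at this
    exact this

open Matrix in
/-- The matrix norms are given by completely contractive maps into matrix algebras. For a functional
`f` attaining the norm of `x`, the states that dominate `f` are written, up to a small error, as
`‖B α‖₂²` and `‖C β^*‖₂²`; the map whose matrix is that of `f` with `B` and `C` divided out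
is completely contractive, and it sends `x` to a matrix which pairs with the vectors `B` and `C`
to `f(x)`. -/
theorem exists_completeContraction (x : Matrix ι ι E) {ε : ℝ} (hε : 0 < ε) :
    ∃ (k : ℕ) (T : E →ₗ[ℂ] Matrix (Fin k) (Fin k) ℂ), IsCompleteContraction T ∧
      mnorm x ≤ (1 + ε) * mnorm (x.map T) := by
  obtain ⟨f, hf, hfx⟩ := hE.exists_functional x
  obtain ⟨L₁, L₂, h1, h2, hp1, hp2, hL⟩ := hE.exists_states f hf
  set δ : ℝ := ε / (Fintype.card ι + 1) with hδ
  have hδ0 : 0 < δ := by positivity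
  have hδε : δ * Fintype.card ι ≤ ε := by
    rw [hδ, div_mul_eq_mul_div, div_le_iff₀ (by positivity)]
    nlinarith
  obtain ⟨B, B', hBB', hB'B, hB, hB2⟩ := exists_sq_of_positive L₁ hp1 hδ0
  obtain ⟨C, C', hCC', hC'C, hC, hC2⟩ := exists_sq_of_positive L₂ hp2 hδ0
  set F : ι → ι → E →ₗ[ℂ] ℂ := fun i j => f ∘ₗ Matrix.singleLinearMap ℂ i j with hF
  have hfF : ∀ y : Matrix ι ι E, f y = ∑ i, ∑ j, F i j (y i j) := by
    intro y
    conv_lhs => rw [Matrix.matrix_eq_sum_single y]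
    simp [hF]
  let e := (Fintype.equivFin ι).symm
  -- the matrix `F(v)`, with `B` divided out on the left and `C` on the right; `e` renames the
  -- indices since the target has to be indexed by some `Fin k`
  let T : E →ₗ[ℂ] Matrix (Fin (Fintype.card ι)) (Fin (Fintype.card ι)) ℂ :=
    { toFun := fun v => Matrix.of fun k l => ∑ i, ∑ j, B' i (e k) * star (C' j (e l)) * F i j v
      map_add' := fun v w => by
        ext k l; simp [mul_add, Finset.sum_add_distrib]
      map_smul' := fun c v => by
        ext k l; simp [Finset.mul_sum, mul_left_comm] }
  -- the bilinear form of an amplification of `T` is a value of `f` on a sandwich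
  have hT : ∀ (κ : Type) [Fintype κ] [DecidableEq κ] (v : Matrix κ κ E)
      (X Y : κ × Fin (Fintype.card ι) → ℂ),
      ∑ s, ∑ t, X s * Matrix.comp κ κ _ _ ℂ (v.map T) s t * Y t =
        f (sandwich (B' * Matrix.of fun k s => X (s, e.symm k)) v
          (C' * Matrix.of fun l t => star (Y (t, e.symm l)))ᴴ) := by
    intro κ _ _ v X Y
    have hα : ∀ i s, (B' * Matrix.of fun k s => X (s, e.symm k)) i s =
        ∑ k, B' i (e k) * X (s, k) := by
      intro i s
      rw [Matrix.mul_apply, ← Equiv.sum_comp e]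
      simp
    have hβ : ∀ t j, (C' * Matrix.of fun l t => star (Y (t, e.symm l)))ᴴ t j =
        ∑ l, star (C' j (e l)) * Y (t, l) := by
      intro t j
      rw [conjTranspose_apply, Matrix.mul_apply, ← Equiv.sum_comp e, star_sum]
      simp
    have hr : f (sandwich (B' * Matrix.of fun k s => X (s, e.symm k)) v
          (C' * Matrix.of fun l t => star (Y (t, e.symm l)))ᴴ) =
        ∑ s, ∑ t, ∑ i, ∑ j, ∑ k, ∑ l,
          X (s, k) * (B' i (e k) * star (C' j (e l)) * F i j (v s t)) * Y (t, l) := by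
      rw [hfF]
      simp only [sandwich, of_apply, map_sum, map_smul, smul_eq_mul, hα, hβ]
      have h4 : ∀ g : ι → ι → κ → κ → ℂ,
          ∑ i, ∑ j, ∑ s, ∑ t, g i j s t = ∑ s, ∑ t, ∑ i, ∑ j, g i j s t := by
        intro g
        simp only [← Fintype.sum_prod_type']
        exact Fintype.sum_equiv ⟨fun p => (p.2.2.1, p.2.2.2, p.1, p.2.1),
          fun p => (p.2.2.1, p.2.2.2, p.1, p.2.1), fun _ => rfl, fun _ => rfl⟩ _ _ fun _ => rfl
      rw [h4]
      refine Finset.sum_congr rfl fun s _ => Finset.sum_congr rfl fun t _ =>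
        Finset.sum_congr rfl fun i _ => Finset.sum_congr rfl fun j _ => ?_
      rw [Finset.sum_mul_sum, Finset.sum_mul]
      refine Finset.sum_congr rfl fun k _ => ?_
      rw [Finset.sum_mul]
      exact Finset.sum_congr rfl fun l _ => by ring
    rw [hr]
    simp only [Fintype.sum_prod_type]
    refine Finset.sum_congr rfl fun s _ => ?_
    rw [Finset.sum_comm]
    refine Finset.sum_congr rfl fun t _ => ?_
    simp only [comp_apply, map_apply, T, LinearMap.coe_mk, AddHom.coe_mk, of_apply, Finset.mul_sum,
      Finset.sum_mul]
    simp only [← Fintype.sum_prod_type']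
    exact Fintype.sum_equiv ⟨fun p => (p.2.2.1, p.2.2.2, p.1, p.2.1),
      fun p => (p.2.2.1, p.2.2.2, p.1, p.2.1), fun _ => rfl, fun _ => rfl⟩ _ _ fun _ => rfl
  refine ⟨_, T, ?_, ?_⟩
  · have key : ∀ (κ : Type) [Fintype κ] [DecidableEq κ] (v : Matrix κ κ E), mnorm v ≤ 1 →
        mnorm (v.map T) ≤ 1 := by
      intro κ _ _ v hv
      refine norm_le_one_of_re _ fun X Y => ?_
      rw [hT]
      refine (hL κ _ v _ hv).trans ?_
      rw [conjTranspose_conjTranspose]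
      refine add_le_add ((hB _ _).trans_eq ?_) ((hC _ _).trans_eq ?_)
      · rw [← Matrix.mul_assoc, hBB', Matrix.one_mul, Fintype.sum_prod_type_right,
          ← Equiv.sum_comp e]
        simp
      · rw [← Matrix.mul_assoc, hCC', Matrix.one_mul, Fintype.sum_prod_type_right,
          ← Equiv.sum_comp e]
        simp
    intro κ _ _ v
    refine le_of_forall_pos_le_add fun r hr => ?_
    have hs : 0 < mnorm v + r := add_pos_of_nonneg_of_pos (hE.nonneg v) hr
    have h3 := key κ ((mnorm v + r)⁻¹ • v) (by
      rw [hE.smul_pos (inv_pos.mpr hs), inv_mul_le_iff₀ hs]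
      linarith)
    have h4 : ((mnorm v + r)⁻¹ • v).map T = (((mnorm v + r)⁻¹ : ℝ) : ℂ) • v.map T := by
      ext a b : 2
      simp [← Complex.coe_smul]
    rw [h4, OperatorSpace.mnorm_smul, Complex.norm_real,
      Real.norm_of_nonneg (inv_pos.mpr hs).le, inv_mul_le_iff₀ hs, mul_one] at h3
    exact h3
  · -- at the vectors given by the entries of `B` and `C` the sandwich is `x` itself
    set X : ι × Fin (Fintype.card ι) → ℂ := fun s => B (e s.2) s.1 with hX
    set Y : ι × Fin (Fintype.card ι) → ℂ := fun s => star (C (e s.2) s.1) with hY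
    have hXn : ∑ s, ‖X s‖ ^ 2 ≤ 1 + ε := by
      rw [Fintype.sum_prod_type_right, Equiv.sum_comp e (fun k => ∑ s, ‖B k s‖ ^ 2), hB2]
      linarith
    have hYn : ∑ s, ‖Y s‖ ^ 2 ≤ 1 + ε := by
      simp only [hY, norm_star]
      rw [Fintype.sum_prod_type_right, Equiv.sum_comp e (fun k => ∑ s, ‖C k s‖ ^ 2), hC2]
      linarith
    have h3 := norm_sum_mul_mul_le (Matrix.comp ι ι _ _ ℂ (x.map T)) X Y
    rw [hT] at h3
    have e1 : (B' * Matrix.of fun k s => X (s, e.symm k)) = 1 := by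
      rw [← hB'B]; congr 1; ext i j; simp [hX]
    have e2 : (C' * Matrix.of fun k s => star (Y (s, e.symm k))) = 1 := by
      rw [← hC'C]; congr 1; ext i j; simp [hY]
    rw [e1, e2, conjTranspose_one, sandwich_one] at h3
    have h4 : mnorm x ≤ √(1 + ε) * mnorm (x.map T) * √(1 + ε) :=
      (hfx.trans (Complex.re_le_norm _)).trans (h3.trans (by
        rw [mnorm_matrix_def]
        gcongr))
    calc mnorm x ≤ (√(1 + ε) * √(1 + ε)) * mnorm (x.map T) := by linarith
      _ = _ := by rw [Real.mul_self_sqrt (by positivity)]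

end IsMatrixSeminorm

/-! ### Ruan's axioms for the projective tensor product -/

theorem le_mul_of_forall_gt {a b c : ℝ} (h : ∀ r, b < r → a ≤ c * r) : a ≤ c * b := by
  refine ge_of_tendsto (x := nhdsWithin b (Set.Ioi b)) (f := fun r => c * r)
    ((Continuous.tendsto (by fun_prop) _).mono_left nhdsWithin_le_nhds) ?_
  filter_upwards [self_mem_nhdsWithin] with r hr using h r hr

theorem sandwich_sandwich {E ι κ μ : Type*} [AddCommGroup E] [Module ℂ E] [Fintype κ] [Fintype μ]
    (a : Matrix ι κ ℂ) (α : Matrix κ μ ℂ) (x : Matrix μ μ E) (β : Matrix μ κ ℂ) (b : Matrix κ ι ℂ) :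
    sandwich a (sandwich α x β) b = sandwich (a * α) x (β * b) := by
  ext i j
  simp only [sandwich, Matrix.of_apply, Finset.smul_sum, smul_smul, Matrix.mul_apply,
    Finset.sum_mul_sum, Finset.sum_smul]
  have h4 : ∀ g : κ → κ → μ → μ → E,
      ∑ i, ∑ j, ∑ s, ∑ t, g i j s t = ∑ s, ∑ t, ∑ i, ∑ j, g i j s t := by
    intro g
    simp only [← Fintype.sum_prod_type']
    exact Fintype.sum_equiv ⟨fun p => (p.2.2.1, p.2.2.2, p.1, p.2.1),
      fun p => (p.2.2.1, p.2.2.2, p.1, p.2.1), fun _ => rfl, fun _ => rfl⟩ _ _ fun _ => rfl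
  rw [h4]
  refine Finset.sum_congr rfl fun s _ => Finset.sum_congr rfl fun t _ =>
    Finset.sum_congr rfl fun k _ => Finset.sum_congr rfl fun l _ => ?_
  congr 1
  ring

/-- A matrix is the sum of its entries, each placed by a column and a row of norm one. -/
theorem IsMatrixSeminorm.mnorm_le_sum {E : Type*} [AddCommGroup E] [Module ℂ E] [MatrixNorm E]
    (hE : IsMatrixSeminorm E) {ι : Type} [Fintype ι] [DecidableEq ι] (x : Matrix ι ι E) :
    mnorm x ≤ ∑ i, ∑ j, mnorm (oneByOne E (x i j)) := by
  have hs : ∀ (s : Finset (ι × ι)) (y : ι × ι → Matrix ι ι E),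
      mnorm (∑ p ∈ s, y p) ≤ ∑ p ∈ s, mnorm (y p) := by
    intro s y
    induction s using Finset.induction_on with
    | empty => simp [hE.map_zero]
    | insert a s ha ih =>
      rw [Finset.sum_insert ha, Finset.sum_insert ha]
      exact (hE.add_le _ _).trans (by gcongr)
  have hx : x = ∑ p : ι × ι, sandwich (Matrix.of fun i (_ : Unit) => (Pi.single p.1 1 : ι → ℂ) i)
      (oneByOne E (x p.1 p.2)) (Matrix.of fun (_ : Unit) i => (Pi.single p.2 1 : ι → ℂ) i) := by
    ext i j
    simp [Matrix.sum_apply, sandwich, oneByOne, Fintype.sum_prod_type, Pi.single_apply]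
  conv_lhs => rw [hx]
  rw [← Fintype.sum_prod_type']
  refine (hs _ _).trans (Finset.sum_le_sum fun p _ => ?_)
  refine (hE.sandwich_le _ _ _).trans ?_
  have h1 := l2_col_le (Pi.single p.1 1 : ι → ℂ)
  have h2 := l2_row_le (Pi.single p.2 1 : ι → ℂ)
  have e : ∀ k : ι, √(∑ i, ‖(Pi.single k 1 : ι → ℂ) i‖ ^ 2) = 1 := by
    intro k; simp [Pi.single_apply, apply_ite norm, ite_pow]
  rw [e] at h1 h2
  have h0 := hE.nonneg (oneByOne E (x p.1 p.2))
  calc _ ≤ 1 * mnorm (oneByOne E (x p.1 p.2)) * 1 := by gcongr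
    _ = _ := by ring

section proj
variable {E F : Type*} [AddCommGroup E] [Module ℂ E] [MatrixNorm E] [OperatorSpace E]
  [AddCommGroup F] [Module ℂ F] [MatrixNorm F] [OperatorSpace F]
  {ι κ : Type} [Fintype ι] [DecidableEq ι] [Fintype κ] [DecidableEq κ]

open scoped Kronecker

theorem ProjRep.sandwich {u : Matrix κ κ (E ⊗[ℂ] F)} {s : ℝ} (h : ProjRep u s) (a : Matrix ι κ ℂ)
    (b : Matrix κ ι ℂ) {t : ℝ} (ht : ‖a‖ * s * ‖b‖ < t) : ProjRep (OpSp.sandwich a u b) t := by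
  obtain ⟨hs, p, q, _, _, _, _, α, v, w, β, rfl, hα, hv, hw, hβ⟩ := h
  refine ProjRep.of_eq (a * α) v w (β * b) (sandwich_sandwich _ _ _ _ _) (lt_of_le_of_lt ?_ ht)
  have h1 := Matrix.l2_opNorm_mul a α
  have h2 := Matrix.l2_opNorm_mul β b
  have := OperatorSpace.mnorm_nonneg v
  have := OperatorSpace.mnorm_nonneg w
  calc _ ≤ (‖a‖ * √s) * 1 * 1 * (√s * ‖b‖) := by
        gcongr
        · exact h1.trans (by gcongr)
        · exact h2.trans (by gcongr)
    _ = ‖a‖ * (√s * √s) * ‖b‖ := by ring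
    _ = _ := by rw [Real.mul_self_sqrt hs.le]

/-- Every matrix over the algebraic tensor product has a representation `α (v ⊗ w) β`, so that the
infimum in `projNorm` is over a nonempty set. -/
theorem exists_projRep_matrix (u : Matrix ι ι (E ⊗[ℂ] F)) : ∃ s, ProjRep u s := by
  have hs : ∀ (S : Finset (ι × ι)) (y : ι × ι → Matrix ι ι (E ⊗[ℂ] F)),
      (∀ p, ∃ s, ProjRep (y p) s) → ∃ s, ProjRep (∑ p ∈ S, y p) s := by
    intro S y hy
    induction S using Finset.induction_on with
    | empty =>
      refine ⟨1, ProjRep.of_eq (p := Unit) (q := Unit) 0 0 0 0 ?_ ?_⟩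
      · ext; simp [OpSp.sandwich]
      · simp
    | insert a S ha ih =>
      rw [Finset.sum_insert ha]
      obtain ⟨s, h⟩ := ih
      obtain ⟨s', h'⟩ := hy a
      exact ⟨_, h'.add h⟩
  have hx : u = ∑ p : ι × ι, OpSp.sandwich
      (Matrix.of fun i (_ : Unit) => (Pi.single p.1 1 : ι → ℂ) i)
      (oneByOne _ (u p.1 p.2)) (Matrix.of fun (_ : Unit) i => (Pi.single p.2 1 : ι → ℂ) i) := by
    ext i j
    simp [Matrix.sum_apply, OpSp.sandwich, oneByOne, Fintype.sum_prod_type, Pi.single_apply]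
  rw [hx]
  refine hs _ _ fun p => ?_
  obtain ⟨s, h⟩ := exists_projRep (u p.1 p.2)
  exact ⟨_, h.sandwich _ _ (lt_add_one _)⟩

/-- Two columns indexed by products, put in the diagonal blocks, with separate column indices. -/
def diagBlock {ι κ p p' q q' : Type} (β : Matrix (p × q) ι ℂ) (β' : Matrix (p' × q') κ ℂ) :
    Matrix ((p ⊕ p') × (q ⊕ q')) (ι ⊕ κ) ℂ := Matrix.fromCols (diagCol β 0) (diagCol 0 β')

theorem norm_diagBlock_le {p p' q q' : Type} [Fintype p] [Fintype p'] [Fintype q] [Fintype q']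
    (β : Matrix (p × q) ι ℂ) (β' : Matrix (p' × q') κ ℂ) {s : ℝ} (hs : 0 ≤ s) (h : ‖β‖ ≤ s)
    (h' : ‖β'‖ ≤ s) : ‖diagBlock β β'‖ ≤ s := by
  refine l2_le _ hs fun v => ?_
  have h1 := l2_apply β fun i => v (Sum.inl i)
  have h2 := l2_apply β' fun i => v (Sum.inr i)
  have e3 : ∑ i, ‖((diagBlock β β').mulVec v) i‖ ^ 2 =
      ∑ i, ‖(β.mulVec fun i => v (Sum.inl i)) i‖ ^ 2 +
      ∑ i, ‖(β'.mulVec fun i => v (Sum.inr i)) i‖ ^ 2 := by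
    simp [Fintype.sum_prod_type, diagBlock, diagCol, Matrix.mulVec, dotProduct]
  rw [e3, Fintype.sum_sum_type, mul_add]
  gcongr
  · exact h1.trans (by gcongr)
  · exact h2.trans (by gcongr)

theorem sandwich_diagBlock {M : Type*} {p p' q q' : Type} [AddCommGroup M] [Module ℂ M] [Fintype p]
    [Fintype p'] [Fintype q] [Fintype q'] (α : Matrix (p × q) ι ℂ) (α' : Matrix (p' × q') κ ℂ)
    (X : Matrix ((p ⊕ p') × (q ⊕ q')) ((p ⊕ p') × (q ⊕ q')) M)
    (β : Matrix (p × q) ι ℂ) (β' : Matrix (p' × q') κ ℂ)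
    (h₁ : ∀ i j k l, X (Sum.inl i, Sum.inl j) (Sum.inr k, Sum.inr l) = 0)
    (h₂ : ∀ i j k l, X (Sum.inr i, Sum.inr j) (Sum.inl k, Sum.inl l) = 0) :
    OpSp.sandwich (diagBlock α α').transpose X (diagBlock β β') = Matrix.fromBlocks
      (OpSp.sandwich α.transpose (X.submatrix (Prod.map Sum.inl Sum.inl) (Prod.map Sum.inl Sum.inl))
        β) 0 0 (OpSp.sandwich α'.transpose
          (X.submatrix (Prod.map Sum.inr Sum.inr) (Prod.map Sum.inr Sum.inr)) β') := by
  have e1 : ∀ s a, diagBlock β β' s (Sum.inl a) = diagCol β 0 s a := fun _ _ => rfl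
  have e2 : ∀ s a, diagBlock β β' s (Sum.inr a) = diagCol 0 β' s a := fun _ _ => rfl
  have e3 : ∀ s a, diagBlock α α' s (Sum.inl a) = diagCol α 0 s a := fun _ _ => rfl
  have e4 : ∀ s a, diagBlock α α' s (Sum.inr a) = diagCol 0 α' s a := fun _ _ => rfl
  ext (a | a) (b | b) <;>
    simp only [OpSp.sandwich, Matrix.of_apply, Matrix.transpose_apply, e1, e2, e3, e4,
      Fintype.sum_prod_type, Fintype.sum_sum_type, Matrix.fromBlocks_apply₁₁,
      Matrix.fromBlocks_apply₁₂, Matrix.fromBlocks_apply₂₁, Matrix.fromBlocks_apply₂₂] <;>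
    simp [diagCol, h₁, h₂]

theorem ProjRep.fromBlocks {u : Matrix ι ι (E ⊗[ℂ] F)} {u' : Matrix κ κ (E ⊗[ℂ] F)} {s : ℝ}
    (h : ProjRep u s) (h' : ProjRep u' s) : ProjRep (Matrix.fromBlocks u 0 0 u') s := by
  obtain ⟨hs, p, q, _, _, _, _, α, v, w, β, hu, hα, hv, hw, hβ⟩ := h
  obtain ⟨-, p', q', _, _, _, _, α', v', w', β', hu', hα', hv', hw', hβ'⟩ := h'
  refine ⟨hs, p ⊕ p', q ⊕ q', inferInstance, inferInstance, inferInstance,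
    inferInstance, (diagBlock α.transpose α'.transpose).transpose, Matrix.fromBlocks v 0 0 v',
    Matrix.fromBlocks w 0 0 w', diagBlock β β', ?_, ?_, ?_, ?_, ?_⟩
  · rw [hu, hu']
    refine ((sandwich_diagBlock α.transpose α'.transpose
      (Matrix.fromBlocks v 0 0 v' ⊗ₖₜ[ℂ] Matrix.fromBlocks w 0 0 w') β β' ?_ ?_).trans ?_).symm
    · intro i j k l; simp
    · intro i j k l; simp
    congr 1
  · have e : (diagBlock α.transpose α'.transpose).transpose =
        (diagBlock α.conjTranspose α'.conjTranspose).conjTranspose := by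
      ext (a | a) ⟨i | i, j | j⟩ <;> simp [diagBlock, diagCol]
    rw [e, Matrix.l2_opNorm_conjTranspose]
    refine norm_diagBlock_le _ _ (Real.sqrt_nonneg s) ?_ ?_
    · rwa [Matrix.l2_opNorm_conjTranspose]
    · rwa [Matrix.l2_opNorm_conjTranspose]
  · exact (OperatorSpace.mnorm_fromBlocks_le _ _).trans (max_le hv hv')
  · exact (OperatorSpace.mnorm_fromBlocks_le _ _).trans (max_le hw hw')
  · exact norm_diagBlock_le _ _ (Real.sqrt_nonneg s) hβ hβ'

/-- The projective norm satisfies Ruan's axioms: block diagonal matrices and sandwiches of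
represented matrices are represented with the expected constants. -/
theorem isMatrixSeminorm_algTensor : IsMatrixSeminorm (AlgTensor E F) where
  nonneg u := projNorm_nonneg (E := E) (F := F) u
  fromBlocks_le u u' := by
    refine le_of_forall_gt_imp_ge_of_dense fun r hr => ?_
    obtain ⟨_, h⟩ := exists_projRep_matrix (E := E) (F := F) u
    obtain ⟨_, h'⟩ := exists_projRep_matrix (E := E) (F := F) u'
    exact ((h.of_lt ((le_max_left _ _).trans_lt hr)).fromBlocks
      (h'.of_lt ((le_max_right _ _).trans_lt hr))).le
  sandwich_le a u b := by
    rw [mul_right_comm]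
    refine le_mul_of_forall_gt fun r hr => ?_
    obtain ⟨_, h⟩ := exists_projRep_matrix (E := E) (F := F) u
    rw [mul_right_comm]
    refine le_of_forall_gt_imp_ge_of_dense fun t ht => ?_
    exact ((h.of_lt hr).sandwich a b ht).le

end proj

/-! ### Ruan's axioms for completions -/

section completion
variable {V : Type*} [SeminormedAddCommGroup V] [NormedSpace ℂ V] [MatrixNorm V]
  {ι κ : Type} [Fintype ι] [DecidableEq ι] [Fintype κ] [DecidableEq κ]

open UniformSpace

/-- The image of the ball of radius `r` of `M_ι(V)` in the matrices over the completion. -/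
def ballImage (ι : Type) [Fintype ι] [DecidableEq ι] (V : Type*) [SeminormedAddCommGroup V]
    [MatrixNorm V] (r : ℝ) : Set (Matrix ι ι (Completion V)) :=
  (fun u : Matrix ι ι V => u.map fun v => (v : Completion V)) '' {u | mnorm u ≤ r}

theorem map_coe_sandwich (α : Matrix ι κ ℂ) (u : Matrix κ κ V) (β : Matrix κ ι ℂ) :
    (sandwich α u β).map (fun v => (v : Completion V)) =
      sandwich α (u.map fun v => (v : Completion V)) β := by
  refine Matrix.ext fun i j => ?_
  rw [Matrix.map_apply]
  unfold sandwich
  rw [Matrix.of_apply, Matrix.of_apply]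
  refine (map_sum (Completion.toComplL (𝕜 := ℂ) (E := V)) _ _).trans ?_
  refine Finset.sum_congr rfl fun s _ => ?_
  refine (map_sum (Completion.toComplL (𝕜 := ℂ) (E := V)) _ _).trans ?_
  exact Finset.sum_congr rfl fun t _ => Completion.coe_smul _ _

theorem ballImage_mono {r s : ℝ} (h : r ≤ s) : ballImage ι V r ⊆ ballImage ι V s :=
  Set.image_mono fun _ hu => le_trans hu h

theorem completion_mnorm_nonneg (U : Matrix ι ι (Completion V)) : 0 ≤ mnorm U :=
  Real.sInf_nonneg fun _ h => h.1

theorem completion_mnorm_le {U : Matrix ι ι (Completion V)} {r : ℝ} (hr : 0 ≤ r)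
    (h : U ∈ closure (ballImage ι V r)) : mnorm U ≤ r :=
  csInf_le ⟨0, fun _ h => h.1⟩ ⟨hr, h⟩

theorem mnorm_map_coe_le (hV : IsMatrixSeminorm V) (u : Matrix ι ι V) :
    mnorm (u.map fun v => (v : Completion V)) ≤ mnorm u :=
  completion_mnorm_le (hV.nonneg u) (subset_closure ⟨u, le_refl (mnorm u), rfl⟩)

/-- Every matrix over the completion is in the closure of some ball, with control by the entries.
This makes the infimum that defines the norm of a matrix over the completion a genuine one. -/
theorem mem_closure_ballImage (hV : IsMatrixSeminorm V)
    (h1 : ∀ v : V, mnorm (oneByOne V v) ≤ ‖v‖) (U : Matrix ι ι (Completion V)) {r : ℝ}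
    (hr : ∑ i, ∑ j, ‖U i j‖ < r) : U ∈ closure (ballImage ι V r) := by
  have hd : DenseRange (fun u : Matrix ι ι V => u.map fun v => (v : Completion V)) :=
    DenseRange.piMap fun _ => DenseRange.piMap fun _ => Completion.denseRange_coe
  have ho : IsOpen {U' : Matrix ι ι (Completion V) | ∑ i, ∑ j, ‖U' i j‖ < r} :=
    isOpen_lt (by fun_prop) continuous_const
  refine closure_mono ?_ (hd.open_subset_closure_inter ho hr)
  rintro _ ⟨hU', u, rfl⟩
  refine ⟨u, ?_, rfl⟩
  refine (hV.mnorm_le_sum u).trans (le_trans ?_ (le_of_lt hU'))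
  gcongr with i _ j _
  exact (h1 _).trans_eq (Completion.norm_coe _).symm

theorem mem_closure_ballImage_of_lt (hV : IsMatrixSeminorm V)
    (h1 : ∀ v : V, mnorm (oneByOne V v) ≤ ‖v‖) {U : Matrix ι ι (Completion V)} {r : ℝ}
    (hr : mnorm U < r) : U ∈ closure (ballImage ι V r) := by
  have hne : {r | 0 ≤ r ∧ U ∈ closure (ballImage ι V r)}.Nonempty :=
    ⟨_, by positivity, mem_closure_ballImage hV h1 U (lt_add_one _)⟩
  obtain ⟨s, hs, hsr⟩ := exists_lt_of_csInf_lt hne hr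
  exact closure_mono (ballImage_mono hsr.le) hs.2

theorem completion_mnorm_le_sum (hV : IsMatrixSeminorm V)
    (h1 : ∀ v : V, mnorm (oneByOne V v) ≤ ‖v‖) (U : Matrix ι ι (Completion V)) :
    mnorm U ≤ ∑ i, ∑ j, ‖U i j‖ :=
  le_of_forall_gt_imp_ge_of_dense fun r hr =>
    completion_mnorm_le ((by positivity : 0 ≤ ∑ i, ∑ j, ‖U i j‖).trans hr.le)
      (mem_closure_ballImage hV h1 U hr)

/-- Ruan's axioms pass to completions, since the operations involved are continuous on entries. -/
theorem isMatrixSeminorm_completion (hV : IsMatrixSeminorm V)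
    (h1 : ∀ v : V, mnorm (oneByOne V v) ≤ ‖v‖) : IsMatrixSeminorm (Completion V) where
  nonneg U := completion_mnorm_nonneg U
  fromBlocks_le {ι κ} _ _ _ _ U W := by
    refine le_of_forall_gt_imp_ge_of_dense fun r hr => ?_
    refine completion_mnorm_le ((completion_mnorm_nonneg U).trans
      ((le_max_left _ _).trans hr.le)) ?_
    have hc : Continuous fun p : Matrix ι ι (Completion V) × Matrix κ κ (Completion V) =>
        Matrix.fromBlocks p.1 0 0 p.2 :=
      Continuous.matrix_fromBlocks continuous_fst continuous_const continuous_const continuous_snd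
    refine map_mem_closure₂ (f := fun a b => Matrix.fromBlocks a 0 0 b) hc
      (mem_closure_ballImage_of_lt hV h1 ((le_max_left _ _).trans_lt hr))
      (mem_closure_ballImage_of_lt hV h1 ((le_max_right _ _).trans_lt hr)) ?_
    rintro _ ⟨u, hu, rfl⟩ _ ⟨w, hw, rfl⟩
    refine ⟨Matrix.fromBlocks u 0 0 w, (hV.fromBlocks_le u w).trans (max_le hu hw), ?_⟩
    ext (i | i) (j | j) <;> simp [Completion.coe_zero]
  sandwich_le {ι κ} _ _ _ _ α U β := by
    rw [mul_right_comm]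
    refine le_mul_of_forall_gt fun r hr => ?_
    have hr0 : 0 ≤ r := (completion_mnorm_nonneg U).trans hr.le
    refine completion_mnorm_le (by positivity) ?_
    have hc : Continuous fun p : Matrix κ κ (Completion V) => sandwich α p β := by
      refine continuous_matrix fun i j => ?_
      simp only [sandwich, Matrix.of_apply]
      exact continuous_finsetSum _ fun s _ => continuous_finsetSum _ fun t _ =>
        (continuous_const_smul (α i s * β t j)).comp (Continuous.matrix_elem continuous_id s t)
    refine map_mem_closure (f := fun p => sandwich α p β) hc
      (mem_closure_ballImage_of_lt hV h1 hr) ?_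
    rintro _ ⟨u, hu, rfl⟩
    refine ⟨sandwich α u β, ?_, ?_⟩
    · change mnorm (sandwich α u β) ≤ ‖α‖ * ‖β‖ * r
      refine (hV.sandwich_le α u β).trans ?_
      have hu : mnorm u ≤ r := hu
      calc _ ≤ ‖α‖ * r * ‖β‖ := by gcongr
        _ = _ := by ring
    · exact map_coe_sandwich α u β

end completion

/-! ### Ruan's axioms for quotients -/

section quotient
variable {T V : Type*} [NormedAddCommGroup T] [NormedSpace ℂ T] [NormedAddCommGroup V]
  [NormedSpace ℂ V] [MatrixNorm T] (hT : IsMatrixSeminorm T) (Φ : T →L[ℂ] V)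
  {ι κ : Type} [Fintype ι] [DecidableEq ι] [Fintype κ] [DecidableEq κ]

theorem QuotientRange.incl_injective : Function.Injective (QuotientRange.incl Φ) :=
  Subtype.val_injective

include hT

theorem quotient_mnorm_le {y : Matrix ι ι (QuotientRange Φ)} {U : Matrix ι ι T}
    (h : U.map Φ = y.map (QuotientRange.incl Φ)) : mnorm y ≤ mnorm U := by
  refine csInf_le ⟨0, ?_⟩ ⟨U, h, rfl⟩
  rintro _ ⟨U, -, rfl⟩
  exact hT.nonneg U

omit hT in
theorem exists_lift_of_mnorm_lt {y : Matrix ι ι (QuotientRange Φ)} {r : ℝ} (h : mnorm y < r) :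
    ∃ U : Matrix ι ι T, U.map Φ = y.map (QuotientRange.incl Φ) ∧ mnorm U < r := by
  have hne : {r | ∃ U : Matrix ι ι T, U.map Φ = y.map (QuotientRange.incl Φ) ∧
      r = mnorm U}.Nonempty := by
    have hy : ∀ i j, ∃ t : T, Φ t = QuotientRange.incl Φ (y i j) := fun i j => (y i j).2
    choose U hU using hy
    exact ⟨_, Matrix.of U, by ext i j; exact hU i j, rfl⟩
  obtain ⟨_, ⟨U, hU, rfl⟩, hr⟩ := exists_lt_of_csInf_lt hne h
  exact ⟨U, hU, hr⟩

/-- Ruan's axioms pass to quotients, by lifting matrices with nearly the same norm. -/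
theorem isMatrixSeminorm_quotient : IsMatrixSeminorm (QuotientRange Φ) where
  nonneg y := by
    refine Real.sInf_nonneg ?_
    rintro _ ⟨U, -, rfl⟩
    exact hT.nonneg U
  fromBlocks_le y z := by
    refine le_of_forall_gt_imp_ge_of_dense fun r hr => ?_
    obtain ⟨U, hU, hUr⟩ := exists_lift_of_mnorm_lt Φ ((le_max_left _ _).trans_lt hr)
    obtain ⟨W, hW, hWr⟩ := exists_lift_of_mnorm_lt Φ ((le_max_right _ _).trans_lt hr)
    refine (quotient_mnorm_le hT Φ (U := Matrix.fromBlocks U 0 0 W) ?_).trans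
      ((hT.fromBlocks_le U W).trans (max_le hUr.le hWr.le))
    rw [Matrix.fromBlocks_map, Matrix.fromBlocks_map, hU, hW]
    simp
  sandwich_le α y β := by
    rw [mul_right_comm]
    refine le_mul_of_forall_gt fun r hr => ?_
    obtain ⟨U, hU, hUr⟩ := exists_lift_of_mnorm_lt Φ hr
    refine (quotient_mnorm_le hT Φ (U := sandwich α U β) ?_).trans
      ((hT.sandwich_le α U β).trans ?_)
    · rw [sandwich_map (QuotientRange.incl Φ), ← hU]
      exact sandwich_map Φ.toLinearMap α U β
    · calc _ ≤ ‖α‖ * r * ‖β‖ := by gcongr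
        _ = _ := by ring

end quotient

/-! ### Components of elements of the Fourier algebra -/

section blocks
variable {I : Type*} {n : I → ℕ}

open Classical in
/-- The bounded family supported at `α`. -/
noncomputable def LInfDual.single (α : I) :
    Matrix (Fin (n α)) (Fin (n α)) ℂ →ₗ[ℂ] LInfDual n where
  toFun M := (lp.single (E := fun α : I => Matrix (Fin (n α)) (Fin (n α)) ℂ) ⊤ α M)
  map_add' M N := by
    refine LInfDual.ext fun β => ?_
    change (Pi.single α (M + N) : ∀ β, Matrix (Fin (n β)) (Fin (n β)) ℂ) β =
      (Pi.single α M : ∀ β, Matrix (Fin (n β)) (Fin (n β)) ℂ) β +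
      (Pi.single α N : ∀ β, Matrix (Fin (n β)) (Fin (n β)) ℂ) β
    rw [Pi.single_add]
    rfl
  map_smul' c M := by
    refine LInfDual.ext fun β => ?_
    change (Pi.single α (c • M) : ∀ β, Matrix (Fin (n β)) (Fin (n β)) ℂ) β =
      c • (Pi.single α M : ∀ β, Matrix (Fin (n β)) (Fin (n β)) ℂ) β
    rw [Pi.single_smul]
    rfl

theorem LInfDual.coord_single_self (α : I) (M : Matrix (Fin (n α)) (Fin (n α)) ℂ) :
    LInfDual.coord α (LInfDual.single α M) = M := by
  classical
  exact Pi.single_eq_same (M := fun β => Matrix (Fin (n β)) (Fin (n β)) ℂ) α M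

theorem LInfDual.coord_single_of_ne {α β : I} (h : β ≠ α)
    (M : Matrix (Fin (n α)) (Fin (n α)) ℂ) : LInfDual.coord β (LInfDual.single α M) = 0 := by
  classical
  exact Pi.single_eq_of_ne (M := fun β => Matrix (Fin (n β)) (Fin (n β)) ℂ) h M

/-- The functional `a ↦ n_α Tr(a_α X)` as an element of the Fourier algebra. -/
noncomputable def blockElem (α : I) : Matrix (Fin (n α)) (Fin (n α)) ℂ →ₗ[ℂ] FourierAlgebra n where
  toFun X := ⟨blockFunctional α X, Submodule.le_topologicalClosure _
    (Submodule.subset_span ⟨α, X, rfl⟩)⟩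
  map_add' X Y := fourier_ext fun a => by
    change blockFunctional α (X + Y) a = blockFunctional α X a + blockFunctional α Y a
    simp [blockFunctional_apply, mul_add]
  map_smul' c X := fourier_ext fun a => by
    change blockFunctional α (c • X) a = c * blockFunctional α X a
    simp [blockFunctional_apply, mul_left_comm]

theorem blockElem_apply (α : I) (X : Matrix (Fin (n α)) (Fin (n α)) ℂ) (a : LInfDual n) :
    FourierAlgebra.toDual n (blockElem α X) a = n α * (LInfDual.coord α a * X).trace := rfl

theorem toDual_norm (f : FourierAlgebra n) : ‖FourierAlgebra.toDual n f‖ = ‖f‖ := rfl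

theorem toDual_le (f : FourierAlgebra n) (a : LInfDual n) :
    ‖FourierAlgebra.toDual n f a‖ ≤ ‖f‖ * ‖a‖ :=
  (FourierAlgebra.toDual n f).le_opNorm a

/-- The component `X_α` of an element of the Fourier algebra, with `f(a) = n_α Tr(a X_α)` for `a`
supported at `α`. Its entries are the values of `f` at matrix units, in transposed order. -/
noncomputable def FourierAlgebra.coeff (α : I) :
    FourierAlgebra n →ₗ[ℂ] Matrix (Fin (n α)) (Fin (n α)) ℂ where
  toFun f := Matrix.of fun i j =>
    (n α : ℂ)⁻¹ * FourierAlgebra.toDual n f (LInfDual.single α (Matrix.single j i 1))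
  map_add' f g := by ext i j; simp [mul_add]
  map_smul' c f := by ext i j; simp [mul_left_comm]

theorem FourierAlgebra.toDual_single (hn : ∀ α, 0 < n α) (α : I) (f : FourierAlgebra n)
    (a : Matrix (Fin (n α)) (Fin (n α)) ℂ) :
    FourierAlgebra.toDual n f (LInfDual.single α a) = n α * (a * coeff α f).trace := by
  have h0 : (n α : ℂ) ≠ 0 := by exact_mod_cast (hn α).ne'
  conv_lhs => rw [Matrix.matrix_eq_sum_single a]
  simp only [map_sum, Matrix.trace, Matrix.diag_apply, Matrix.mul_apply, Finset.mul_sum]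
  refine Finset.sum_congr rfl fun i _ => Finset.sum_congr rfl fun j _ => ?_
  have : Matrix.single i j (a i j) = a i j • Matrix.single i j (1 : ℂ) := by simp
  rw [this, map_smul, map_smul, smul_eq_mul, coeff]
  simp only [LinearMap.coe_mk, AddHom.coe_mk, Matrix.of_apply]
  field_simp

theorem FourierAlgebra.coeff_blockElem_self (hn : ∀ α, 0 < n α) (α : I)
    (X : Matrix (Fin (n α)) (Fin (n α)) ℂ) : coeff α (blockElem α X) = X := by
  have h0 : (n α : ℂ) ≠ 0 := by exact_mod_cast (hn α).ne'
  ext i j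
  simp only [coeff, LinearMap.coe_mk, AddHom.coe_mk, Matrix.of_apply, blockElem_apply,
    LInfDual.coord_single_self]
  rw [Matrix.trace_single_mul]
  simp [h0]

theorem FourierAlgebra.coeff_blockElem_of_ne {α β : I} (h : α ≠ β)
    (X : Matrix (Fin (n β)) (Fin (n β)) ℂ) : coeff α (blockElem β X) = 0 := by
  ext i j
  simp [coeff, blockElem_apply, LInfDual.coord_single_of_ne h.symm]

theorem continuous_coeff (α : I) : Continuous (FourierAlgebra.coeff (n := n) α) := by
  refine continuous_matrix fun i j => ?_
  have : Continuous fun f : FourierAlgebra n =>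
      FourierAlgebra.toDual n f (LInfDual.single α (Matrix.single j i 1)) :=
    (ContinuousLinearMap.apply ℂ ℂ (LInfDual.single α (Matrix.single j i 1))).continuous.comp
      (continuous_subtype_val (p := fun x => x ∈ fourierSubmodule n))
  exact continuous_const.mul this

/-- The Fourier algebra is the closed span of its blocks. -/
theorem mem_closure_span_blockElem (f : FourierAlgebra n) :
    f ∈ (Submodule.span ℂ
      {g : FourierAlgebra n | ∃ α X, g = blockElem α X}).topologicalClosure := by
  rw [← SetLike.mem_coe, Submodule.topologicalClosure_coe, Metric.mem_closure_iff]
  intro ε hε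
  have hf : f.1 ∈ closure ((Submodule.span ℂ {ω | ∃ (α : I)
      (Y : Matrix (Fin (n α)) (Fin (n α)) ℂ), ω = blockFunctional α Y} :
        Submodule ℂ (StrongDual ℂ (LInfDual n))) : Set (StrongDual ℂ (LInfDual n))) := f.2
  obtain ⟨g, hg, hfg⟩ := Metric.mem_closure_iff.mp hf ε hε
  have key : ∀ g ∈ Submodule.span ℂ {ω | ∃ (α : I)
      (Y : Matrix (Fin (n α)) (Fin (n α)) ℂ), ω = blockFunctional α Y},
      ∃ g' ∈ Submodule.span ℂ {g : FourierAlgebra n | ∃ α X, g = blockElem α X},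
        FourierAlgebra.toDual n g' = g := by
    intro g hg
    induction hg using Submodule.span_induction with
    | mem x hx =>
      obtain ⟨α, Y, rfl⟩ := hx
      exact ⟨_, Submodule.subset_span ⟨α, Y, rfl⟩, rfl⟩
    | zero => exact ⟨0, Submodule.zero_mem _, map_zero _⟩
    | add x y _ _ hx hy =>
      obtain ⟨x', hx', rfl⟩ := hx
      obtain ⟨y', hy', rfl⟩ := hy
      exact ⟨_, Submodule.add_mem _ hx' hy', map_add _ _ _⟩
    | smul c x _ hx =>
      obtain ⟨x', hx', rfl⟩ := hx
      exact ⟨_, Submodule.smul_mem _ c hx', map_smul _ _ _⟩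
  obtain ⟨g', hg', rfl⟩ := key g hg
  exact ⟨g', hg', hfg⟩

/-- An element of the Fourier algebra is determined by its components. The corresponding statement
for functionals on `ℓ^∞(Ĝ)` fails for infinite `Irr(G)`; the reason here is the approximation by
finitely many blocks. -/
theorem fourier_ext_coeff (hn : ∀ α, 0 < n α) {f g : FourierAlgebra n}
    (h : ∀ α, FourierAlgebra.coeff α f = FourierAlgebra.coeff α g) : f = g := by
  rw [← sub_eq_zero]
  set d := f - g with hd
  have hd0 : ∀ α, FourierAlgebra.coeff α d = 0 := fun α => by rw [hd, map_sub, h, sub_self]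
  clear_value d
  have hsupp : ∀ g ∈ Submodule.span ℂ {g : FourierAlgebra n | ∃ α X, g = blockElem α X},
      ∃ S : Finset I, ∀ a : LInfDual n, (∀ α ∈ S, LInfDual.coord α a = 0) →
        FourierAlgebra.toDual n g a = 0 := by
    classical
    intro g hg
    induction hg using Submodule.span_induction with
    | mem x hx =>
      obtain ⟨α, Y, rfl⟩ := hx
      refine ⟨{α}, fun a ha => ?_⟩
      rw [blockElem_apply, ha α (Finset.mem_singleton_self α)]
      simp
    | zero => exact ⟨∅, fun a _ => by simp⟩
    | add x y _ _ hx hy =>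
      obtain ⟨S, hS⟩ := hx
      obtain ⟨T, hT⟩ := hy
      refine ⟨S ∪ T, fun a ha => ?_⟩
      rw [map_add, add_apply, hS a fun α hα => ha α (Finset.mem_union_left _ hα),
        hT a fun α hα => ha α (Finset.mem_union_right _ hα), add_zero]
    | smul c x _ hx =>
      obtain ⟨S, hS⟩ := hx
      exact ⟨S, fun a ha => by rw [map_smul, smul_apply, hS a ha, smul_zero]⟩
  refine fourier_ext fun a => ?_
  rw [map_zero, zero_apply, ← norm_eq_zero]
  refine le_antisymm ?_ (norm_nonneg _)
  rw [← zero_mul ‖a‖]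
  refine le_of_forall_pos_le_add fun ε hε => ?_
  rw [zero_mul, zero_add]
  obtain ⟨g', hg', hdg⟩ := Metric.mem_closure_iff.mp (by
    have := mem_closure_span_blockElem d
    rwa [← SetLike.mem_coe, Submodule.topologicalClosure_coe] at this) (ε / (‖a‖ + 1))
    (by positivity)
  obtain ⟨S, hS⟩ := hsupp g' hg'
  classical
  -- cutting off finitely many components of `a` neither changes `d a`, as the components of `d`
  -- vanish, nor increases the norm of `a`, and it makes the approximation `g'` of `d` vanish
  set a' : LInfDual n := a - ∑ α ∈ S, LInfDual.single α (LInfDual.coord α a) with ha'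
  have hcoord : ∀ β, LInfDual.coord β a' = if β ∈ S then 0 else LInfDual.coord β a := by
    intro β
    rw [ha', map_sub, map_sum]
    split_ifs with hβ
    · rw [Finset.sum_eq_single_of_mem β hβ fun γ _ hγ => LInfDual.coord_single_of_ne hγ.symm _,
        LInfDual.coord_single_self, sub_self]
    · rw [Finset.sum_eq_zero fun γ hγ => LInfDual.coord_single_of_ne
        (fun e => hβ (by rw [e]; exact hγ)) _, sub_zero]
  have hna : ‖a'‖ ≤ ‖a‖ := by
    refine LInfDual.norm_le (norm_nonneg _) fun β => ?_
    rw [hcoord]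
    split_ifs
    · simp
    · exact LInfDual.norm_coord_le a β
  have h1 : FourierAlgebra.toDual n d a = FourierAlgebra.toDual n (d - g') a' := by
    have hg0 : FourierAlgebra.toDual n g' a' = 0 := hS a' fun α hα => by rw [hcoord, if_pos hα]
    have hs : ∑ α ∈ S, FourierAlgebra.toDual n d (LInfDual.single α (LInfDual.coord α a)) = 0 :=
      Finset.sum_eq_zero fun α _ => by
        rw [FourierAlgebra.toDual_single hn, hd0]; simp
    rw [map_sub (FourierAlgebra.toDual n) d g', sub_apply, hg0, sub_zero, ha', map_sub, map_sum, hs,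
      sub_zero]
  rw [h1]
  refine (toDual_le _ _).trans ?_
  rw [dist_eq_norm] at hdg
  calc ‖d - g'‖ * ‖a'‖ ≤ ε / (‖a‖ + 1) * (‖a‖ + 1) := by
        gcongr
        linarith
    _ = ε := by field_simp

theorem coeff_haarMul (hn : ∀ α, 0 < n α) {X : ∀ α, Matrix (Fin (n α)) (Fin (n α)) ℂ}
    (hX : {α | X α ≠ 0}.Finite) (α : I) : FourierAlgebra.coeff α (haarMul X) = X α := by
  have h0 : (n α : ℂ) ≠ 0 := by exact_mod_cast (hn α).ne'
  ext i j
  simp only [FourierAlgebra.coeff, LinearMap.coe_mk, AddHom.coe_mk, Matrix.of_apply]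
  rw [haarMul_apply hX, finsum_eq_single _ α]
  · rw [LInfDual.coord_single_self, Matrix.trace_single_mul]
    simp [h0]
  · intro β hβ
    rw [LInfDual.coord_single_of_ne hβ]
    simp

theorem hsNorm_sq {m : ℕ} (X : Matrix (Fin m) (Fin m) ℂ) :
    hsNorm X ^ 2 = ∑ i, ∑ j, ‖X i j‖ ^ 2 := Real.sq_sqrt (by positivity)

theorem hsNorm_nonneg {m : ℕ} (X : Matrix (Fin m) (Fin m) ℂ) : 0 ≤ hsNorm X := Real.sqrt_nonneg _

/-- The Hilbert-Schmidt norm of an `m × p` matrix is at most `√p` times its operator norm. -/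
theorem sum_norm_sq_le {m p : Type*} [Fintype m] [Fintype p] [DecidableEq p] (M : Matrix m p ℂ) :
    ∑ i, ∑ j, ‖M i j‖ ^ 2 ≤ Fintype.card p * ‖M‖ ^ 2 := by
  rw [Finset.sum_comm]
  have h : ∀ j, ∑ i, ‖M i j‖ ^ 2 ≤ ‖M‖ ^ 2 := fun j => by
    have := l2_apply M (Pi.single j 1)
    simpa [Pi.single_apply, apply_ite norm, ite_pow] using this
  calc _ ≤ ∑ _j : p, ‖M‖ ^ 2 := Finset.sum_le_sum fun j _ => h j
    _ = _ := by simp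

/-- The Cauchy-Schwarz inequality for the trace, with the Hilbert-Schmidt norm of `A` estimated by
its operator norm. -/
theorem norm_trace_mul_le {m : ℕ} (A B : Matrix (Fin m) (Fin m) ℂ) :
    ‖(A * B).trace‖ ≤ √m * ‖A‖ * hsNorm B := by
  have h1 : ‖(A * B).trace‖ ≤ ∑ p : Fin m × Fin m, ‖A p.1 p.2‖ * ‖B p.2 p.1‖ := by
    rw [Matrix.trace, Fintype.sum_prod_type]
    refine (norm_sum_le _ _).trans (Finset.sum_le_sum fun i _ => ?_)
    rw [Matrix.diag_apply, Matrix.mul_apply]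
    exact (norm_sum_le _ _).trans (Finset.sum_le_sum fun j _ => (norm_mul _ _).le)
  refine h1.trans ((Real.sum_mul_le_sqrt_mul_sqrt _ _ _).trans ?_)
  have e1 : √(∑ p : Fin m × Fin m, ‖A p.1 p.2‖ ^ 2) ≤ √m * ‖A‖ := by
    rw [Fintype.sum_prod_type]
    refine (Real.sqrt_le_sqrt (sum_norm_sq_le A)).trans_eq ?_
    rw [Fintype.card_fin, Real.sqrt_mul (by positivity), Real.sqrt_sq (norm_nonneg _)]
  have e2 : √(∑ p : Fin m × Fin m, ‖B p.2 p.1‖ ^ 2) = hsNorm B := by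
    rw [Fintype.sum_prod_type_right]; rfl
  rw [e2]
  exact mul_le_mul_of_nonneg_right e1 (hsNorm_nonneg B)

theorem rpow_three_halves {x : ℝ} (hx : 0 ≤ x) : x ^ (3 / 2 : ℝ) = x * √x := by
  rcases hx.eq_or_lt with rfl | h
  · rw [Real.zero_rpow (by norm_num), zero_mul]
  · rw [Real.sqrt_eq_rpow, show (3 / 2 : ℝ) = 1 + 1 / 2 by norm_num, Real.rpow_add h,
      Real.rpow_one]

/-- The inclusion of a block with the Hilbert-Schmidt norm weighted by `n_α^{3/2}`: one factor `n_α`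
comes from the definition of the functional, and `√n_α` from `norm_trace_mul_le`. -/
theorem norm_blockElem_le (α : I) (X : Matrix (Fin (n α)) (Fin (n α)) ℂ) :
    ‖blockElem α X‖ ≤ (n α : ℝ) ^ (3 / 2 : ℝ) * hsNorm X := by
  rw [← toDual_norm, rpow_three_halves (by positivity)]
  have := hsNorm_nonneg X
  refine ContinuousLinearMap.opNorm_le_bound _ (by positivity) fun a => ?_
  rw [blockElem_apply, norm_mul, Complex.norm_natCast]
  have h1 := norm_trace_mul_le (LInfDual.coord α a) X
  have h2 := LInfDual.norm_coord_le a α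
  calc (n α : ℝ) * ‖(LInfDual.coord α a * X).trace‖
      ≤ n α * (√(n α) * ‖a‖ * hsNorm X) := by
        gcongr
        exact h1.trans (by gcongr)
    _ = _ := by ring

theorem mnorm_one_fourier_le (f : FourierAlgebra n) : mnorm (oneByOne _ f) ≤ ‖f‖ := by
  refine fourier_le _ (norm_nonneg _) fun κ _ _ x => ?_
  rw [mnorm_map_toMatrixMap]
  have h := mnorm_one_matrix (x.map (FourierAlgebra.toDual n f))
  exact h.le.trans (linf_functional (FourierAlgebra.toDual n f) x)

/-- The matrix of functionals `a ↦ (V a_α V*)_{ij}`. For `V = 1` these are the images of the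
coefficients of `u^α`, and for `V = W_β`, `α = β̄` those of the adjoints of the coefficients of
`u^β`. -/
noncomputable def coordMatrix {m : ℕ} (α : I) (V : Matrix (Fin m) (Fin (n α)) ℂ) :
    Matrix (Fin m) (Fin m) (FourierAlgebra n) := Matrix.of fun i j =>
  blockElem α ((n α : ℂ)⁻¹ • (V.conjTranspose * Matrix.single j i (1 : ℂ) * V))

theorem toDual_coordMatrix (hn : ∀ α, 0 < n α) {m : ℕ} (α : I) (V : Matrix (Fin m) (Fin (n α)) ℂ)
    (i j : Fin m) (a : LInfDual n) : FourierAlgebra.toDual n (coordMatrix α V i j) a =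
      (V * LInfDual.coord α a * V.conjTranspose) i j := by
  have h0 : (n α : ℂ) ≠ 0 := by exact_mod_cast (hn α).ne'
  rw [coordMatrix, Matrix.of_apply, blockElem_apply, Matrix.mul_smul, Matrix.trace_smul,
    smul_eq_mul, mul_inv_cancel_left₀ h0, ← Matrix.mul_assoc, Matrix.trace_mul_comm,
    ← Matrix.mul_assoc, ← Matrix.mul_assoc, Matrix.trace_mul_single]
  simp

/-- A matrix over an operator space, tensored with an identity matrix. -/
def ampliation {E : Type*} [Zero E] (κ : Type) [DecidableEq κ] {m : Type} (x : Matrix m m E) :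
    Matrix (κ × m) (κ × m) E :=
  Matrix.of fun s t => if s.1 = t.1 then x s.2 t.2 else 0

/-- The map `a ↦ V a_α V*` is completely contractive when `V` is a contraction, and so is its direct
sum with copies of itself. -/
theorem mnorm_ampliation_coordMatrix_le (hn : ∀ α, 0 < n α) {m : ℕ} (α : I)
    (V : Matrix (Fin m) (Fin (n α)) ℂ) (hV : ‖V‖ ≤ 1) (κ : Type) [Fintype κ] [DecidableEq κ] :
    mnorm (ampliation κ (coordMatrix α V)) ≤ 1 := by
  refine fourier_le _ zero_le_one fun μ _ _ x => ?_
  set A : Matrix (μ × Fin m) (μ × Fin (n α)) ℂ :=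
    Matrix.of fun p q => if p.1 = q.1 then V p.2 q.2 else 0 with hA
  have hAn : ‖A‖ ≤ 1 := by
    refine le_trans ?_ ((l2_kron_one (J := μ) V).trans hV)
    exact l2_submatrix_le (Equiv.prodComm _ _) (Equiv.prodComm _ _)
      (Matrix.of fun (p : Fin m × μ) (q : Fin (n α) × μ) => if p.2 = q.2 then V p.1 q.1 else 0)
  set N := A * Matrix.comp μ μ _ _ ℂ (x.map (LInfDual.coord α)) * A.conjTranspose with hN
  have hNe : ∀ s t i j, N (s, i) (t, j) =
      (V * LInfDual.coord α (x s t) * V.conjTranspose) i j := by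
    intro s t i j
    simp [hN, hA, Matrix.mul_apply, Fintype.sum_prod_type, Finset.sum_mul, apply_ite star]
  have hNn : ‖N‖ ≤ mnorm x := by
    have h0 := linf_nonneg x
    refine (Matrix.l2_opNorm_mul _ _).trans ?_
    rw [Matrix.l2_opNorm_conjTranspose]
    have h1 := Matrix.l2_opNorm_mul A (Matrix.comp μ μ _ _ ℂ (x.map (LInfDual.coord α)))
    have h2 : ‖Matrix.comp μ μ _ _ ℂ (x.map (LInfDual.coord α))‖ ≤ mnorm x := linf_le x α
    calc _ ≤ 1 * mnorm x * 1 := by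
          gcongr
          exact h1.trans (by gcongr)
      _ = _ := by ring
  rw [one_mul]
  refine le_trans ?_ hNn
  have h1 := l2_kron_one (J := κ) N
  refine le_trans ?_ h1
  let e : μ × (κ × Fin m) ≃ (μ × Fin m) × κ :=
    ⟨fun p => ((p.1, p.2.2), p.2.1), fun p => (p.1.1, (p.2, p.1.2)), fun _ => rfl, fun _ => rfl⟩
  have h2 := l2_submatrix_le e e (Matrix.of fun (p : (μ × Fin m) × κ) (q : (μ × Fin m) × κ) =>
    if p.2 = q.2 then N p.1 q.1 else 0)
  refine le_trans (le_of_eq ?_) h2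
  rw [mnorm_matrix_def]
  congr 1
  ext ⟨s, a, i⟩ ⟨t, b, j⟩
  simp only [Matrix.comp_apply, Matrix.map_apply, toMatrixMap, LinearMap.coe_mk, AddHom.coe_mk,
    Matrix.of_apply, ampliation, Matrix.submatrix_apply, e, Equiv.coe_fn_mk]
  split_ifs with hab
  · rw [toDual_coordMatrix hn, hNe]
  · simp

theorem coeff_coordMatrix_self (hn : ∀ α, 0 < n α) {m : ℕ} (α : I)
    (V : Matrix (Fin m) (Fin (n α)) ℂ) (i j : Fin m) :
    FourierAlgebra.coeff α (coordMatrix α V i j) =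
      (n α : ℂ)⁻¹ • (V.conjTranspose * Matrix.single j i (1 : ℂ) * V) :=
  FourierAlgebra.coeff_blockElem_self hn α _

end blocks

/-! ### The twisted convolution on blocks -/

/-- The effect of conjugating representations on the blocks of `ℓ^∞(Ĝ)`: an injective map `α ↦ ᾱ`
of the index set, and unitaries from the space of `u^ᾱ` onto that of the conjugate of `u^α`. They
are rectangular matrices, as the equality of the dimensions `n_ᾱ` and `n_α` is not definitional. -/
structure Conjugation {I : Type*} (n : I → ℕ) where
  bar : I → I
  W : ∀ α, Matrix (Fin (n α)) (Fin (n (bar α))) ℂ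
  bar_injective : Function.Injective bar
  mul_conjTranspose : ∀ α, W α * (W α).conjTranspose = 1
  conjTranspose_mul : ∀ α, (W α).conjTranspose * W α = 1

section key
variable {I : Type*} {n : I → ℕ} (C : Conjugation n)

open Matrix

theorem Conjugation.dim_bar (α : I) : n (C.bar α) = n α := by
  have h1 : ((C.W α)ᴴ * C.W α).trace = (C.W α * (C.W α)ᴴ).trace := Matrix.trace_mul_comm _ _
  rw [C.conjTranspose_mul, C.mul_conjTranspose] at h1
  simp only [trace_one, Fintype.card_fin] at h1
  exact_mod_cast h1

theorem Conjugation.norm_le (α : I) : ‖C.W α‖ ≤ 1 := by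
  have h := l2_opNorm_conjTranspose_mul_self (C.W α)
  rw [C.conjTranspose_mul] at h
  have := norm_one_le (ι := Fin (n (C.bar α)))
  nlinarith [norm_nonneg (C.W α)]

/-- The block of index `α` placed at the index `ᾱ` through `M ↦ W_α* M W_α`, the transpose of
`g ↦ W_α g_ᾱ W_α*` for the trace pairing. -/
noncomputable def Conjugation.single (α : I) :
    Matrix (Fin (n α)) (Fin (n α)) ℂ →ₗ[ℂ] LInfDual n where
  toFun M := LInfDual.single (C.bar α) ((C.W α)ᴴ * M * C.W α)
  map_add' M N := by rw [Matrix.mul_add, Matrix.add_mul, map_add]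
  map_smul' c M := by rw [Matrix.mul_smul, Matrix.smul_mul, map_smul]; rfl

theorem Conjugation.coord_single_self (α : I) (M : Matrix (Fin (n α)) (Fin (n α)) ℂ) :
    LInfDual.coord (C.bar α) (C.single α M) = (C.W α)ᴴ * M * C.W α :=
  LInfDual.coord_single_self _ _

theorem Conjugation.coord_single_of_ne {α β : I} (h : β ≠ C.bar α)
    (M : Matrix (Fin (n α)) (Fin (n α)) ℂ) : LInfDual.coord β (C.single α M) = 0 :=
  LInfDual.coord_single_of_ne h _

/-- The component at `α` of the twisted convolution of `f` and `g`. -/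
noncomputable def Conjugation.prodCoeff (α : I) : FourierAlgebra n →ₗ[ℂ] FourierAlgebra n →ₗ[ℂ]
    Matrix (Fin (n α)) (Fin (n α)) ℂ :=
  LinearMap.mk₂ ℂ (fun f g => (C.W α * FourierAlgebra.coeff (C.bar α) g * (C.W α)ᴴ)ᵀ *
      FourierAlgebra.coeff α f)
    (fun f f' g => by rw [map_add, Matrix.mul_add])
    (fun c f g => by rw [map_smul, Matrix.mul_smul])
    (fun f g g' => by rw [map_add, Matrix.mul_add, Matrix.add_mul, transpose_add, Matrix.add_mul])
    (fun c f g => by rw [map_smul, Matrix.mul_smul, Matrix.smul_mul, transpose_smul,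
      Matrix.smul_mul])

/-- The entries of the component at `α` in terms of values at matrix units. The factor `n_α⁻²`
is the one that compensates the norms in `Conjugation.mnorm_pairing_le`. -/
theorem Conjugation.prodCoeff_apply (hn : ∀ α, 0 < n α) (α : I) (f g : FourierAlgebra n)
    (i j : Fin (n α)) : C.prodCoeff α f g i j = ∑ l, ((n α : ℂ)⁻¹ * (n α : ℂ)⁻¹) *
      (FourierAlgebra.toDual n f (LInfDual.single α (Matrix.single j l 1)) *
        FourierAlgebra.toDual n g (C.single α (Matrix.single i l 1))) := by
  have h0 : (n α : ℂ) ≠ 0 := by exact_mod_cast (hn α).ne'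
  simp only [Conjugation.prodCoeff, LinearMap.mk₂_apply, Matrix.mul_apply (M := _ᵀ),
    Conjugation.single, LinearMap.coe_mk, AddHom.coe_mk]
  refine Finset.sum_congr rfl fun l _ => ?_
  have h2 : ((C.W α)ᴴ * Matrix.single i l (1 : ℂ) * C.W α *
      FourierAlgebra.coeff (C.bar α) g).trace =
      (C.W α * FourierAlgebra.coeff (C.bar α) g * (C.W α)ᴴ) l i := by
    rw [Matrix.mul_assoc, Matrix.mul_assoc, Matrix.trace_mul_comm, Matrix.mul_assoc,
      Matrix.trace_single_mul]
    simp
  have hdim' : (n (C.bar α) : ℂ) = n α := by rw [C.dim_bar]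
  rw [FourierAlgebra.toDual_single hn, FourierAlgebra.toDual_single hn, h2, hdim',
    Matrix.trace_single_mul]
  simp only [transpose_apply, smul_eq_mul, one_mul]
  field_simp

variable {k : Type} [Fintype k] [DecidableEq k]

/-- The matrix `∑ E_{jl} ⊗ E_{il} ⊗ t_{ij}`, its second leg being carried to the block `ᾱ`. It is
the column `t` multiplied by the vector `∑ e_l ⊗ e_l` of norm `√n_α`. -/
theorem Conjugation.mnorm_sum_le (α : I) (t : Fin (n α) → Fin (n α) → Matrix k k ℂ) {c : ℝ}
    (hc : 0 ≤ c) (ht : ∀ η : k → ℂ, ∑ i, ∑ j, ∑ b, ‖(t i j *ᵥ η) b‖ ^ 2 ≤ c ^ 2 * ∑ b, ‖η b‖ ^ 2) :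
    mnorm (Matrix.of fun (s s' : Fin (n α) × k) =>
      ∑ i, t i s.1 s.2 s'.2 • C.single α (Matrix.single i s'.1 1)) ≤ c * √(n α) := by
  refine linf_mnorm_le _ (by positivity) fun β => ?_
  by_cases hβ : β = C.bar α
  · subst hβ
    refine l2_le _ (by positivity) fun y => ?_
    set W := C.W α with hW
    -- contraction with `∑ e_l ⊗ e_l`, the second leg being moved by `W`
    set η : k → ℂ := fun d => ∑ l, ∑ s, W l s * y ((l, d), s) with hη
    have hent : ∀ (j : Fin (n α)) (b : k) (r : Fin (n (C.bar α))),
        (Matrix.comp _ _ _ _ ℂ ((Matrix.of fun (s s' : Fin (n α) × k) =>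
          ∑ i, t i s.1 s.2 s'.2 • C.single α (Matrix.single i s'.1 1)).map
            (LInfDual.coord (C.bar α))) *ᵥ y) ((j, b), r) =
          (Wᴴ *ᵥ fun i => (t i j *ᵥ η) b) r := by
      intro j b r
      have hs : ∀ i l s, (Wᴴ * Matrix.single i l (1 : ℂ) * W) r s = star (W i r) * W l s := by
        intro i l s
        rw [Matrix.mul_apply, Finset.sum_eq_single l]
        · simp
        · intro x _ hx
          rw [Matrix.mul_single_apply_of_ne _ _ _ _ _ hx, zero_mul]
        · simp
      simp only [mulVec, dotProduct, comp_apply, map_apply, of_apply, map_sum, map_smul,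
        C.coord_single_self, Fintype.sum_prod_type, Matrix.sum_apply, Matrix.smul_apply, ← hW, hs,
        hη, smul_eq_mul, Finset.sum_mul, Finset.mul_sum, conjTranspose_apply]
      have h4 : ∀ g : Fin (n α) → k → Fin (n (C.bar α)) → Fin (n α) → ℂ,
          ∑ l, ∑ d, ∑ s, ∑ i, g l d s i = ∑ i, ∑ d, ∑ l, ∑ s, g l d s i := by
        intro g
        simp only [← Fintype.sum_prod_type']
        exact Fintype.sum_equiv ⟨fun p => (p.2.2.2, p.2.1, p.1, p.2.2.1),
          fun p => (p.2.2.1, p.2.1, p.2.2.2, p.1), fun _ => rfl, fun _ => rfl⟩ _ _ fun _ => rfl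
      rw [h4]
      refine Finset.sum_congr rfl fun i _ => Finset.sum_congr rfl fun d _ =>
        Finset.sum_congr rfl fun l _ => Finset.sum_congr rfl fun s _ => ?_
      ring
    have hWn : ‖Wᴴ‖ ≤ 1 := (l2_opNorm_conjTranspose W).trans_le (C.norm_le α)
    have h1 : ∀ j b, ∑ r, ‖(Wᴴ *ᵥ fun i => (t i j *ᵥ η) b) r‖ ^ 2 ≤ ∑ i, ‖(t i j *ᵥ η) b‖ ^ 2 := by
      intro j b
      refine (l2_apply Wᴴ _).trans ?_
      have : ‖Wᴴ‖ ^ 2 ≤ 1 := pow_le_one₀ (norm_nonneg _) hWn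
      have h0 : 0 ≤ ∑ i, ‖(t i j *ᵥ η) b‖ ^ 2 := by positivity
      nlinarith
    have h2 : ∑ d, ‖η d‖ ^ 2 ≤ n α * ∑ x, ‖y x‖ ^ 2 := by
      -- the square of the Hilbert-Schmidt norm of a unitary matrix is its size
      have hWs : ∑ l, ∑ s, ‖W l s‖ ^ 2 = n α := by
        have := trace_mul_conjTranspose W
        rw [C.mul_conjTranspose, trace_one, Fintype.card_fin] at this
        exact_mod_cast this.symm
      have h3 : ∀ d, ‖η d‖ ^ 2 ≤ n α * ∑ l, ∑ s, ‖y ((l, d), s)‖ ^ 2 := by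
        intro d
        have e : ‖η d‖ ≤
            ∑ p : Fin (n α) × Fin (n (C.bar α)), ‖W p.1 p.2‖ * ‖y ((p.1, d), p.2)‖ := by
          rw [Fintype.sum_prod_type]
          refine (norm_sum_le _ _).trans (Finset.sum_le_sum fun l _ => ?_)
          exact (norm_sum_le _ _).trans (Finset.sum_le_sum fun s _ => (norm_mul _ _).le)
        have e2 := Finset.sum_mul_sq_le_sq_mul_sq Finset.univ
          (fun p : Fin (n α) × Fin (n (C.bar α)) => ‖W p.1 p.2‖) fun p => ‖y ((p.1, d), p.2)‖
        rw [Fintype.sum_prod_type (fun p : Fin (n α) × Fin (n (C.bar α)) => ‖W p.1 p.2‖ ^ 2), hWs,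
          Fintype.sum_prod_type (fun p : Fin (n α) × Fin (n (C.bar α)) =>
            ‖y ((p.1, d), p.2)‖ ^ 2)] at e2
        exact (pow_le_pow_left₀ (norm_nonneg _) e 2).trans e2
      refine (Finset.sum_le_sum fun d _ => h3 d).trans_eq ?_
      rw [← Finset.mul_sum, Fintype.sum_prod_type, Fintype.sum_prod_type, Finset.sum_comm]
    rw [Fintype.sum_prod_type, Fintype.sum_prod_type]
    simp only [hent]
    calc _ ≤ ∑ j, ∑ b, ∑ i, ‖(t i j *ᵥ η) b‖ ^ 2 :=
          Finset.sum_le_sum fun j _ => Finset.sum_le_sum fun b _ => h1 j b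
      _ = ∑ j, ∑ i, ∑ b, ‖(t i j *ᵥ η) b‖ ^ 2 :=
          Finset.sum_congr rfl fun j _ => Finset.sum_comm
      _ = ∑ i, ∑ j, ∑ b, ‖(t i j *ᵥ η) b‖ ^ 2 := Finset.sum_comm
      _ ≤ c ^ 2 * ∑ d, ‖η d‖ ^ 2 := ht η
      _ ≤ c ^ 2 * (n α * ∑ x, ‖y x‖ ^ 2) := by gcongr
      _ = _ := by rw [mul_pow, Real.sq_sqrt (by positivity)]; ring
  · have : ((Matrix.of fun (s s' : Fin (n α) × k) =>
        ∑ i, t i s.1 s.2 s'.2 • C.single α (Matrix.single i s'.1 1)).map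
          (LInfDual.coord β)) = 0 := by
      refine Matrix.ext fun s s' => ?_
      simp only [map_apply, of_apply, map_sum, map_smul, C.coord_single_of_ne hβ, smul_zero,
        Finset.sum_const_zero]
      rfl
    rw [this, OperatorSpace.mnorm_zero]
    positivity

/-- The main estimate: the pairing of the twisted convolution with columns of norm `n_α^{3/2}` is
jointly completely contractive. -/
theorem Conjugation.mnorm_pairing_le (hn : ∀ α, 0 < n α) (S : Finset I)
    (t : ∀ α, Fin (n α) → Fin (n α) → Matrix k k ℂ)
    (ht : ∀ α, ∀ η : k → ℂ, ∑ i, ∑ j, ∑ b, ‖(t α i j *ᵥ η) b‖ ^ 2 ≤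
      ((n α : ℝ) ^ (3 / 2 : ℝ)) ^ 2 * ∑ b, ‖η b‖ ^ 2)
    {p q : Type} [Fintype p] [DecidableEq p] [Fintype q] [DecidableEq q]
    (v : Matrix p p (FourierAlgebra n)) (w : Matrix q q (FourierAlgebra n)) :
    mnorm (Matrix.of fun (s s' : p × q) => ∑ α ∈ S, ∑ i, ∑ j,
      C.prodCoeff α (v s.1 s'.1) (w s.2 s'.2) i j • t α i j) ≤ mnorm v * mnorm w := by
  -- the result of evaluating `w` on the matrices of `mnorm_sum_le`; evaluating `v` on `x` then
  -- gives the pairing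
  set x : Matrix (k × q) (k × q) (LInfDual n) := Matrix.of fun s s' =>
    ∑ α ∈ S, ∑ j, ∑ l, (∑ i, ((n α : ℂ)⁻¹ * (n α : ℂ)⁻¹) * (t α i j s.1 s'.1 *
      FourierAlgebra.toDual n (w s.2 s'.2) (C.single α (Matrix.single i l 1)))) •
        LInfDual.single α (Matrix.single j l 1) with hx
  -- blockwise, `n⁻²` times `n^{3/2}` for the column times `√n` for `∑ e_l ⊗ e_l`
  have hxn : mnorm x ≤ mnorm w := by
    refine linf_mnorm_le _ (fourier_nonneg w) fun β => ?_
    by_cases hβ : β ∈ S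
    · set z : Matrix (Fin (n β) × k) (Fin (n β) × k) (LInfDual n) :=
        Matrix.of fun (s s' : Fin (n β) × k) =>
          ∑ i, t β i s.1 s.2 s'.2 • C.single β (Matrix.single i s'.1 1) with hz
      have hzn := C.mnorm_sum_le β (t β) (by positivity) (ht β)
      have h1 := (fourier_apply w z).trans (mul_le_mul_of_nonneg_left hzn (fourier_nonneg w))
      let e : (k × q) × Fin (n β) ≃ (Fin (n β) × k) × q :=
        ⟨fun a => ((a.2, a.1.1), a.1.2), fun a => ((a.1.2, a.2), a.1.1), fun _ => rfl, fun _ => rfl⟩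
      have h2 : Matrix.comp _ _ _ _ ℂ (x.map (LInfDual.coord β)) =
          ((n β : ℂ)⁻¹ * (n β : ℂ)⁻¹) •
            (Matrix.comp _ _ _ _ ℂ (z.map (toMatrixMap w))).submatrix e e := by
        ext ⟨⟨b, c⟩, j⟩ ⟨⟨b', c'⟩, l⟩
        simp only [comp_apply, map_apply, hx, of_apply, map_sum, map_smul, hz, Matrix.smul_apply,
          Matrix.submatrix_apply, e, Equiv.coe_fn_mk, toMatrixMap, LinearMap.coe_mk, AddHom.coe_mk,
          Matrix.sum_apply]
        rw [Finset.sum_eq_single_of_mem β hβ]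
        · simp only [LInfDual.coord_single_self]
          rw [Finset.sum_eq_single j, Finset.sum_eq_single l]
          · simp [Finset.mul_sum]
          · intro l' _ hl'; simp [hl']
          · simp
          · intro j' _ hj'; simp [hj']
          · simp
        · intro γ _ hγ
          simp [LInfDual.coord_single_of_ne hγ.symm]
      rw [mnorm_matrix_def, h2, norm_smul]
      have h3 := l2_submatrix_le e e (Matrix.comp _ _ _ _ ℂ (z.map (toMatrixMap w)))
      have h4 : (0 : ℝ) < n β := by exact_mod_cast hn β
      have h5 : ‖((n β : ℂ)⁻¹ * (n β : ℂ)⁻¹)‖ = (n β : ℝ)⁻¹ * (n β : ℝ)⁻¹ := by simp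
      rw [h5]
      calc _ ≤ (n β : ℝ)⁻¹ * (n β : ℝ)⁻¹ *
            (mnorm w * ((n β : ℝ) ^ (3 / 2 : ℝ) * √(n β))) := by
            gcongr
            exact h3.trans h1
        _ = mnorm w := by
            rw [rpow_three_halves h4.le, mul_assoc (n β : ℝ), Real.mul_self_sqrt h4.le]
            field_simp
    · have : x.map (LInfDual.coord β) = 0 := by
        refine Matrix.ext fun s s' => ?_
        simp only [hx, map_apply, of_apply, map_sum, map_smul]
        refine Finset.sum_eq_zero fun γ hγ => ?_
        have : β ≠ γ := fun h => hβ (h ▸ hγ)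
        simp [LInfDual.coord_single_of_ne this]
      rw [this, OperatorSpace.mnorm_zero]
      exact fourier_nonneg w
  have h1 := (fourier_apply v x).trans (mul_le_mul_of_nonneg_left hxn (fourier_nonneg v))
  refine le_trans ?_ h1
  let e : (p × q) × k ≃ (k × q) × p :=
    ⟨fun a => ((a.2, a.1.2), a.1.1), fun a => ((a.2, a.1.2), a.1.1), fun _ => rfl, fun _ => rfl⟩
  refine le_trans (le_of_eq ?_)
    (l2_submatrix_le e e (Matrix.comp _ _ _ _ ℂ (x.map (toMatrixMap v))))
  rw [mnorm_matrix_def]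
  congr 1
  ext ⟨⟨a, c⟩, b⟩ ⟨⟨a', c'⟩, b'⟩
  simp only [comp_apply, map_apply, hx, of_apply, map_sum, map_smul, Matrix.smul_apply,
    Matrix.submatrix_apply, e, Equiv.coe_fn_mk, toMatrixMap, LinearMap.coe_mk, AddHom.coe_mk,
    Matrix.sum_apply, C.prodCoeff_apply hn]
  refine Finset.sum_congr rfl fun α _ => ?_
  rw [Finset.sum_comm]
  refine Finset.sum_congr rfl fun j _ => ?_
  simp only [smul_eq_mul, Finset.sum_mul]
  rw [Finset.sum_comm]
  exact Finset.sum_congr rfl fun l _ => Finset.sum_congr rfl fun i _ => by ring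

end key

/-! ### Row Hilbert spaces -/

open scoped Kronecker

/-- A bilinear map that is jointly completely contractive is completely contractive for the
projective norm. -/
theorem mnorm_map_le_projNorm {E F G : Type*} [AddCommGroup E] [Module ℂ E] [MatrixNorm E]
    [OperatorSpace E] [AddCommGroup F] [Module ℂ F] [MatrixNorm F] [OperatorSpace F]
    [AddCommGroup G] [Module ℂ G] [MatrixNorm G] [OperatorSpace G] (Ψ : E ⊗[ℂ] F →ₗ[ℂ] G)
    (h : ∀ (p q : Type) [Fintype p] [DecidableEq p] [Fintype q] [DecidableEq q]
      (v : Matrix p p E) (w : Matrix q q F), mnorm ((v ⊗ₖₜ[ℂ] w).map Ψ) ≤ mnorm v * mnorm w)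
    {ι : Type} [Fintype ι] [DecidableEq ι] (u : Matrix ι ι (E ⊗[ℂ] F)) :
    mnorm (u.map Ψ) ≤ projNorm u := by
  refine le_of_forall_gt_imp_ge_of_dense fun r hr => ?_
  obtain ⟨s, hs⟩ := exists_projRep_matrix u
  obtain ⟨h0, p, q, _, _, _, _, α, v, w, β, rfl, hα, hv, hw, hβ⟩ := hs.of_lt hr
  rw [sandwich_map]
  refine (OperatorSpace.mnorm_sandwich_le _ _ _).trans ?_
  have h1 := h p q v w
  have h2 : mnorm v * mnorm w ≤ 1 := mul_le_one₀ hv (OperatorSpace.mnorm_nonneg w) hw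
  have h3 := OperatorSpace.mnorm_nonneg ((v ⊗ₖₜ[ℂ] w).map Ψ)
  calc _ ≤ √r * 1 * √r := by
        gcongr
        exact h1.trans h2
    _ = r := by rw [mul_one, Real.mul_self_sqrt h0.le]

section hsrow
variable {m : ℕ} {k : Type} [Fintype k] [DecidableEq k]

/-- Matrices as elements of the rescaled row Hilbert space. -/
def toScaled (c : ℝ) (m : ℕ) : Matrix (Fin m) (Fin m) ℂ →ₗ[ℂ] Scaled c (HSRow m) where
  toFun X := (X : Matrix (Fin m) (Fin m) ℂ)
  map_add' _ _ := rfl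
  map_smul' _ _ := rfl

theorem apply_toScaled {c : ℝ} {V : Type*} [AddCommGroup V] [Module ℂ V]
    (T : Scaled c (HSRow m) →ₗ[ℂ] V) (X : Matrix (Fin m) (Fin m) ℂ) :
    T (toScaled c m X) = ∑ i, ∑ j, X i j • T (toScaled c m (Matrix.single i j 1)) := by
  conv_lhs => rw [Matrix.matrix_eq_sum_single X]
  simp only [map_sum]
  refine Finset.sum_congr rfl fun i _ => Finset.sum_congr rfl fun j _ => ?_
  rw [← map_smul, ← map_smul]
  simp

/-- The images of the matrix units under a complete contraction of the row Hilbert space form a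
contractive column, since the matrix units themselves form a column of norm one. -/
theorem sum_norm_sq_mulVec_le {c : ℝ} (hc : 0 ≤ c) {T : Scaled c (HSRow m) →ₗ[ℂ] Matrix k k ℂ}
    (hT : IsCompleteContraction T) (η : k → ℂ) :
    ∑ i, ∑ j, ∑ b, ‖((T (toScaled c m (Matrix.single i j 1))).mulVec η) b‖ ^ 2 ≤
      c ^ 2 * ∑ b, ‖η b‖ ^ 2 := by
  -- the column of matrix units as a square matrix: it occupies the column with index `none`
  let x : Matrix (Option (Fin m × Fin m)) (Option (Fin m × Fin m)) (HSRow m) :=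
    Matrix.of fun s t => match s, t with
      | some p, none => (Matrix.single p.1 p.2 (1 : ℂ) : Matrix (Fin m) (Fin m) ℂ)
      | _, _ => 0
  have hx : ‖HSRow.row x‖ ≤ 1 := by
    refine l2_le _ zero_le_one fun v => ?_
    rw [Fintype.sum_option]
    have h0 : ((HSRow.row x).mulVec v) none = 0 := by
      refine Finset.sum_eq_zero fun s _ => ?_
      have : HSRow.row x none s = 0 := rfl
      simp [this]
    have h1 : ∀ p, ((HSRow.row x).mulVec v) (some p) = v (none, p) := by
      rintro ⟨i, j⟩
      have e : ∀ p q, HSRow.row x (some p) (none, q) =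
          (Matrix.single p.1 p.2 (1 : ℂ) : Matrix (Fin m) (Fin m) ℂ) q.1 q.2 := fun _ _ => rfl
      have e' : ∀ p r q, HSRow.row x (some p) (some r, q) = 0 := fun _ _ _ => rfl
      simp only [Matrix.mulVec, dotProduct, Fintype.sum_prod_type, Fintype.sum_option, e, e',
        Matrix.single_apply]
      simp [ite_and]
    rw [h0, Fintype.sum_prod_type (fun s : Option (Fin m × Fin m) × (Fin m × Fin m) => ‖v s‖ ^ 2),
      Fintype.sum_option]
    simp only [h1]
    have : 0 ≤ ∑ i, ∑ y, ‖v (some i, y)‖ ^ 2 := by positivity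
    simp only [norm_zero]
    nlinarith
  have h := hT _ (show Matrix _ _ (Scaled c (HSRow m)) from x)
  have h2 : mnorm (show Matrix _ _ (Scaled c (HSRow m)) from x) ≤ c :=
    (mul_le_mul_of_nonneg_left hx hc).trans_eq (mul_one c)
  have h3 := h.trans h2
  have h4 := l2_apply (Matrix.comp _ _ k k ℂ
    ((show Matrix _ _ (Scaled c (HSRow m)) from x).map T)) fun s =>
      match s.1 with
      | none => η s.2
      | some _ => 0
  have h5 : ‖Matrix.comp _ _ k k ℂ ((show Matrix _ _ (Scaled c (HSRow m)) from x).map T)‖ ^ 2 ≤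
      c ^ 2 := pow_le_pow_left₀ (norm_nonneg _) h3 2
  rw [Fintype.sum_prod_type, Fintype.sum_prod_type (fun s : Option (Fin m × Fin m) × k => _ ^ 2),
    Fintype.sum_option, Fintype.sum_option] at h4
  have e : ∀ p b, ((Matrix.comp _ _ k k ℂ ((show Matrix _ _ (Scaled c (HSRow m)) from x).map
      T)).mulVec fun s => match s.1 with
        | none => η s.2
        | some _ => 0) (some p, b) =
      ((T (toScaled c m (Matrix.single p.1 p.2 1))).mulVec η) b := by
    intro p b
    simp only [Matrix.mulVec, dotProduct, Fintype.sum_prod_type, Fintype.sum_option, mul_zero,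
      Finset.sum_const_zero, add_zero]
    rfl
  simp only [e] at h4
  simp only [Fintype.sum_prod_type, norm_zero] at h4
  have h6 : 0 ≤ ∑ b, ‖η b‖ ^ 2 := by positivity
  refine le_trans ?_ (h4.trans (le_trans ?_ (mul_le_mul_of_nonneg_right h5 h6)))
  · exact le_add_of_nonneg_left (by positivity)
  · simp

/-- The functional `X ↦ c ⟨X, Y⟩` as a map into `M_1`. -/
noncomputable def hsFunctional (c : ℝ) (Y : Matrix (Fin m) (Fin m) ℂ) :
    Scaled c (HSRow m) →ₗ[ℂ] Matrix (Fin 1) (Fin 1) ℂ where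
  toFun X := Matrix.of fun _ _ => (c : ℂ) * ∑ i, ∑ j, star (Y i j) *
    (show Matrix (Fin m) (Fin m) ℂ from X) i j
  map_add' X X' := by
    ext a b
    change (c : ℂ) * ∑ i, ∑ j, star (Y i j) * ((show Matrix (Fin m) (Fin m) ℂ from X) i j +
      (show Matrix (Fin m) (Fin m) ℂ from X') i j) = _
    simp [mul_add, Finset.sum_add_distrib]
  map_smul' r X := by
    ext a b
    change (c : ℂ) * ∑ i, ∑ j, star (Y i j) * (r * (show Matrix (Fin m) (Fin m) ℂ from X) i j) = _
    simp [Finset.mul_sum, mul_left_comm]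

/-- On a row `r` over the row Hilbert space the functional acts as multiplication by the contractive
block diagonal matrix with the column of the conjugate entries of `Y` on the diagonal. -/
theorem isCompleteContraction_hsFunctional {c : ℝ} (hc : 0 ≤ c) {Y : Matrix (Fin m) (Fin m) ℂ}
    (hY : hsNorm Y ≤ 1) : IsCompleteContraction (hsFunctional c Y) := by
  intro κ _ _ x
  set N : Matrix (κ × (Fin m × Fin m)) (κ × Fin 1) ℂ :=
    Matrix.of fun s t => if s.1 = t.1 then star (Y s.2.1 s.2.2) else 0 with hN
  have hNn : ‖N‖ ≤ 1 := by
    refine l2_le _ zero_le_one fun v => ?_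
    have e : ∀ s, (N.mulVec v) s = star (Y s.2.1 s.2.2) * v (s.1, 0) := by
      intro s
      simp [hN, Matrix.mulVec, dotProduct, Fintype.sum_prod_type]
    have hY2 : ∑ i, ∑ j, ‖Y i j‖ ^ 2 ≤ 1 := by
      rw [← hsNorm_sq]
      exact pow_le_one₀ (hsNorm_nonneg _) hY
    simp only [e, norm_mul, norm_star, mul_pow, Fintype.sum_prod_type, ← Finset.sum_mul]
    simp only [Finset.univ_unique, Fin.default_eq_zero, Finset.sum_singleton, one_pow, one_mul]
    refine Finset.sum_le_sum fun a _ => ?_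
    exact mul_le_of_le_one_left (by positivity) hY2
  set r : Matrix κ (κ × (Fin m × Fin m)) ℂ := HSRow.row (show Matrix κ κ (HSRow m) from x) with hr
  have e : ∀ a i b j, Matrix.comp _ _ _ _ ℂ (x.map (hsFunctional c Y)) (a, i) (b, j) =
      (c : ℂ) * ∑ p, ∑ q, star (Y p q) * r a (b, (p, q)) := fun _ _ _ _ => rfl
  have hxr : mnorm x = c * ‖r‖ := rfl
  rw [mnorm_matrix_def, hxr]
  generalize Matrix.comp _ _ _ _ ℂ (x.map (hsFunctional c Y)) = M at e
  clear_value r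
  have h : M = (c : ℂ) • ((r * N).submatrix (Equiv.prodUnique κ (Fin 1)) (Equiv.refl _)) := by
    ext ⟨a, i⟩ ⟨b, j⟩
    rw [e, Matrix.smul_apply, Matrix.submatrix_apply, Matrix.mul_apply, Fintype.sum_prod_type,
      Finset.sum_eq_single b]
    · rw [Fintype.sum_prod_type]
      simp [hN, mul_comm]
    · intro b' _ hb'
      refine Finset.sum_eq_zero fun s _ => ?_
      simp [hN, hb']
    · simp
  rw [h, norm_smul, Complex.norm_real, Real.norm_of_nonneg hc]
  refine mul_le_mul_of_nonneg_left ?_ hc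
  refine (l2_submatrix_le _ _ _).trans ((Matrix.l2_opNorm_mul _ _).trans ?_)
  exact mul_le_of_le_one_right (norm_nonneg _) hNn

/-- The functional given by the normalization of `Y` attains the norm at `Y`; for `Y = 0` both sides
vanish. -/
theorem hsFunctional_self (c : ℝ) (Y : Matrix (Fin m) (Fin m) ℂ) :
    hsFunctional c (((hsNorm Y)⁻¹ : ℂ) • Y) (toScaled c m Y) 0 0 = ((c * hsNorm Y : ℝ) : ℂ) := by
  change (c : ℂ) * ∑ i, ∑ j, star (((hsNorm Y)⁻¹ : ℂ) * Y i j) * Y i j = _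
  have h : ((hsNorm Y ^ 2 : ℝ) : ℂ) = ∑ i, ∑ j, star (Y i j) * Y i j := by
    rw [hsNorm_sq]
    push_cast
    refine Finset.sum_congr rfl fun i _ => Finset.sum_congr rfl fun j _ => ?_
    rw [RCLike.star_def, Complex.conj_mul']
  have h2 : ∑ i, ∑ j, star (((hsNorm Y)⁻¹ : ℂ) * Y i j) * Y i j =
      ((hsNorm Y)⁻¹ : ℂ) * ((hsNorm Y ^ 2 : ℝ) : ℂ) := by
    rw [h]
    simp only [Finset.mul_sum]
    refine Finset.sum_congr rfl fun i _ => Finset.sum_congr rfl fun j _ => ?_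
    rw [star_mul', RCLike.star_def, map_inv₀, Complex.conj_ofReal, mul_assoc]
  rw [h2]
  rcases eq_or_ne (hsNorm Y) 0 with h0 | h0
  · simp [h0]
  · have : (hsNorm Y : ℂ) ≠ 0 := by exact_mod_cast h0
    push_cast
    field_simp

theorem hsNorm_normalize_le (Y : Matrix (Fin m) (Fin m) ℂ) :
    hsNorm (((hsNorm Y)⁻¹ : ℂ) • Y) ≤ 1 := by
  rw [← abs_of_nonneg (hsNorm_nonneg _), ← sq_le_one_iff_abs_le_one, hsNorm_sq]
  simp only [Matrix.smul_apply, norm_smul, mul_pow, ← Finset.mul_sum]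
  rw [← hsNorm_sq, norm_inv, Complex.norm_real, Real.norm_of_nonneg (hsNorm_nonneg _), ← mul_pow]
  exact pow_le_one₀ (mul_nonneg (inv_nonneg.mpr (hsNorm_nonneg _)) (hsNorm_nonneg _))
    inv_mul_le_one

theorem mnorm_one_scaled (c : ℝ) (X : Matrix (Fin m) (Fin m) ℂ) :
    mnorm (oneByOne _ (toScaled c m X)) = c * hsNorm X := by
  change c * ‖HSRow.row (oneByOne (HSRow m) X)‖ = _
  refine congrArg _ (le_antisymm ?_ ?_)
  · have h := l2_row_le fun p : Fin m × Fin m => X p.1 p.2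
    rw [Fintype.sum_prod_type] at h
    refine le_trans ?_ h
    exact l2_submatrix_le (Equiv.refl Unit) (Equiv.punitProd (Fin m × Fin m))
      (Matrix.of fun (_ : Unit) i => X i.1 i.2)
  · rw [← Matrix.l2_opNorm_conjTranspose]
    refine Real.sqrt_le_iff.mpr ⟨norm_nonneg _, ?_⟩
    have h := l2_apply (HSRow.row (oneByOne (HSRow m) X)).conjTranspose fun _ => 1
    have e : ∀ u p q, HSRow.row (oneByOne (HSRow m) X) () (u, (p, q)) = X p q :=
      fun _ _ _ => rfl
    simp only [Fintype.sum_prod_type, Matrix.mulVec, dotProduct, Finset.univ_unique,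
      Finset.sum_singleton, Matrix.conjTranspose_apply, PUnit.default_eq_unit, e, mul_one,
      norm_star, norm_one, one_pow] at h
    exact h

end hsrow

/-! ### Components and their right inverses on the tensor product -/

section tensor
variable {I : Type*} {n : I → ℕ} (C : Conjugation n)

/-- The component at `α` of the twisted convolution, on the algebraic tensor product. -/
noncomputable def Conjugation.coeffTensor (α : I) :
    AlgTensor (FourierAlgebra n) (FourierAlgebra n) →ₗ[ℂ] Matrix (Fin (n α)) (Fin (n α)) ℂ :=
  (TensorProduct.lift (C.prodCoeff α) : FourierAlgebra n ⊗[ℂ] FourierAlgebra n →ₗ[ℂ] _)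

theorem Conjugation.coeffTensor_tmul (α : I) (f g : FourierAlgebra n) :
    C.coeffTensor α (AlgTensor.tmul f g) = C.prodCoeff α f g := TensorProduct.lift.tmul _ _

/-- Families of complete contractions of the summands, applied to the components of the twisted
convolution, are complete contractions of the projective tensor product. -/
theorem Conjugation.mnorm_sum_coeffTensor_le (hn : ∀ α, 0 < n α) (S : Finset I)
    {k : Type} [Fintype k] [DecidableEq k]
    {T : ∀ α, Scaled ((n α : ℝ) ^ (3 / 2 : ℝ)) (HSRow (n α)) →ₗ[ℂ] Matrix k k ℂ}
    (hT : ∀ α, IsCompleteContraction (T α)) {ι : Type} [Fintype ι] [DecidableEq ι]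
    (u : Matrix ι ι (AlgTensor (FourierAlgebra n) (FourierAlgebra n))) :
    mnorm (Matrix.of fun a b => ∑ α ∈ S, T α (toScaled _ _ (C.coeffTensor α (u a b)))) ≤
      mnorm u := by
  let Ψ : FourierAlgebra n ⊗[ℂ] FourierAlgebra n →ₗ[ℂ] Matrix k k ℂ :=
    ∑ α ∈ S, (T α ∘ₗ toScaled _ _ ∘ₗ TensorProduct.lift (C.prodCoeff α))
  have h := mnorm_map_le_projNorm Ψ (fun p q _ _ _ _ v w => ?_) u
  · have e : (u.map Ψ : Matrix ι ι (Matrix k k ℂ)) =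
        Matrix.of fun a b => ∑ α ∈ S, T α (toScaled _ _ (C.coeffTensor α (u a b))) := by
      refine Matrix.ext fun a b => ?_
      exact LinearMap.sum_apply _ _ _
    exact (le_of_eq (congrArg mnorm e.symm)).trans h
  · have h1 := C.mnorm_pairing_le hn S (fun α i j => T α (toScaled _ _ (Matrix.single i j 1)))
      (fun α η => sum_norm_sq_mulVec_le (by positivity) (hT α) η) v w
    have e : (v ⊗ₖₜ[ℂ] w).map Ψ = Matrix.of fun (s s' : p × q) => ∑ α ∈ S, ∑ i, ∑ j,
        C.prodCoeff α (v s.1 s'.1) (w s.2 s'.2) i j •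
          T α (toScaled _ _ (Matrix.single i j 1)) := by
      refine Matrix.ext fun s s' => ?_
      refine (LinearMap.sum_apply _ _ _).trans ?_
      rw [Matrix.of_apply]
      refine Finset.sum_congr rfl fun α _ => ?_
      rw [← apply_toScaled]
      rfl
    rw [e]
    exact h1

theorem norm_entry_le {m p : Type*} [Fintype m] [Fintype p] [DecidableEq p] (M : Matrix m p ℂ)
    (i : m) (j : p) : ‖M i j‖ ≤ ‖M‖ := by
  have h : ∑ i, ‖M i j‖ ^ 2 ≤ ‖M‖ ^ 2 := by
    have := l2_apply M (Pi.single j 1)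
    simpa [Pi.single_apply, apply_ite norm, ite_pow] using this
  refine le_of_sq_le_sq (le_trans ?_ h) (norm_nonneg _)
  exact Finset.single_le_sum (f := fun i => ‖M i j‖ ^ 2) (fun _ _ => by positivity)
    (Finset.mem_univ i)

/-- The norms of the components are summable with the weights `n_α^{3/2}`: at each `α` the norm is
the value of a contractive functional. -/
theorem Conjugation.sum_hsNorm_coeffTensor_le (hn : ∀ α, 0 < n α) (S : Finset I)
    (u : AlgTensor (FourierAlgebra n) (FourierAlgebra n)) :
    ∑ α ∈ S, (n α : ℝ) ^ (3 / 2 : ℝ) * hsNorm (C.coeffTensor α u) ≤ ‖u‖ := by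
  have h := C.mnorm_sum_coeffTensor_le hn S (T := fun α => hsFunctional _
    (((hsNorm (C.coeffTensor α u))⁻¹ : ℂ) • C.coeffTensor α u))
    (fun α => isCompleteContraction_hsFunctional (by positivity) (hsNorm_normalize_le _))
    (oneByOne _ u)
  refine le_trans ?_ h
  have e := mnorm_one_matrix (∑ α ∈ S, hsFunctional ((n α : ℝ) ^ (3 / 2 : ℝ))
    (((hsNorm (C.coeffTensor α u))⁻¹ : ℂ) • C.coeffTensor α u) (toScaled _ _ (C.coeffTensor α u)))
  refine le_trans ?_ e.ge
  refine le_trans ?_ (norm_entry_le _ 0 0)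
  rw [Matrix.sum_apply]
  simp only [hsFunctional_self]
  rw [← Complex.ofReal_sum, Complex.norm_real]
  exact le_abs_self _

/-- A right inverse of the twisted convolution on the block `α`. It sums over `l` the tensors
`ω_jl ⊗ ω'_il`, the images of `u_jl ⊗ u_il^*`, which are mapped to `n_α⁻¹ u_ji` for every `l`. -/
noncomputable def Conjugation.lift (α : I) : Matrix (Fin (n α)) (Fin (n α)) ℂ →ₗ[ℂ]
    FourierAlgebra n ⊗[ℂ] FourierAlgebra n where
  toFun X := (n α : ℂ) • ∑ i, ∑ j, X i j • ∑ l,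
    coordMatrix α 1 j l ⊗ₜ[ℂ] coordMatrix (C.bar α) (C.W α) i l
  map_add' X Y := by simp only [Matrix.add_apply, add_smul, Finset.sum_add_distrib, smul_add]
  map_smul' c X := by
    simp only [Matrix.smul_apply, smul_eq_mul, mul_smul, RingHom.id_apply]
    rw [smul_comm c]
    simp only [← Finset.smul_sum]

theorem Conjugation.lift_apply (α : I) (X : Matrix (Fin (n α)) (Fin (n α)) ℂ) : C.lift α X =
    (n α : ℂ) • ∑ i, ∑ j, X i j • ∑ l,
    coordMatrix α 1 j l ⊗ₜ[ℂ] coordMatrix (C.bar α) (C.W α) i l := rfl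

theorem Conjugation.coeffTensor_lift_of_ne {α β : I} (h : β ≠ α)
    (X : Matrix (Fin (n α)) (Fin (n α)) ℂ) : C.coeffTensor β (C.lift α X) = 0 := by
  change TensorProduct.lift (C.prodCoeff β) (C.lift α X) = 0
  rw [C.lift_apply]
  simp only [map_smul, map_sum, TensorProduct.lift.tmul]
  have : ∀ j l i, C.prodCoeff β (coordMatrix α 1 j l) (coordMatrix (C.bar α) (C.W α) i l) = 0 := by
    intro j l i
    simp only [Conjugation.prodCoeff, LinearMap.mk₂_apply, coordMatrix, Matrix.of_apply,
      FourierAlgebra.coeff_blockElem_of_ne h, Matrix.mul_zero]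
  simp [this]

/-- The relation `u_jl ⋆ S(u_il'^*) = δ_ll' n_α⁻¹ u_ji` on the level of components. -/
theorem Conjugation.prodCoeff_coordMatrix (hn : ∀ α, 0 < n α) (α : I) (j l i l' : Fin (n α)) :
    C.prodCoeff α (coordMatrix α 1 j l) (coordMatrix (C.bar α) (C.W α) i l') =
      ((n α : ℂ)⁻¹ * (n α : ℂ)⁻¹) • (Matrix.single i l' 1 * Matrix.single l j 1) := by
  have hdim : (n (C.bar α) : ℂ) = n α := by exact_mod_cast C.dim_bar α
  simp only [Conjugation.prodCoeff, LinearMap.mk₂_apply, coeff_coordMatrix_self hn, hdim,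
    Matrix.mul_smul, Matrix.smul_mul, Matrix.transpose_smul, smul_smul]
  have e : C.W α * ((C.W α).conjTranspose * Matrix.single l' i (1 : ℂ) * C.W α) *
      (C.W α).conjTranspose = Matrix.single l' i 1 := by
    calc _ = (C.W α * (C.W α).conjTranspose) * Matrix.single l' i (1 : ℂ) *
          (C.W α * (C.W α).conjTranspose) := by simp only [Matrix.mul_assoc]
      _ = _ := by rw [C.mul_conjTranspose, Matrix.one_mul, Matrix.mul_one]
  rw [e]
  simp

theorem Conjugation.coeffTensor_lift_self (hn : ∀ α, 0 < n α) (α : I)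
    (X : Matrix (Fin (n α)) (Fin (n α)) ℂ) : C.coeffTensor α (C.lift α X) = X := by
  have h0 : (n α : ℂ) ≠ 0 := by exact_mod_cast (hn α).ne'
  change TensorProduct.lift (C.prodCoeff α) (C.lift α X) = X
  rw [C.lift_apply]
  simp only [map_smul, map_sum, TensorProduct.lift.tmul, C.prodCoeff_coordMatrix hn]
  conv_rhs => rw [Matrix.matrix_eq_sum_single X]
  simp only [Finset.smul_sum]
  refine Finset.sum_congr rfl fun i _ => Finset.sum_congr rfl fun j _ => ?_
  simp only [Matrix.single_mul_single_same, mul_one, Finset.sum_const, Finset.card_univ,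
    Fintype.card_fin, Matrix.smul_single, smul_eq_mul]
  congr 1
  rw [nsmul_eq_mul]
  field_simp

/-- The right inverse is completely contractive from `n_α^{3/2} (S²)_r`: the tensor
`∑ x_ij ⊗ ω_jl ⊗ ω'_il` is the product of the row of `x`, of two contractive matrices of
functionals, and of the column `∑ e_l ⊗ e_l` of norm `√n_α`. -/
theorem Conjugation.mnorm_lift_le (hn : ∀ α, 0 < n α) (α : I) {κ : Type} [Fintype κ]
    [DecidableEq κ] (x : Matrix κ κ (Matrix (Fin (n α)) (Fin (n α)) ℂ)) :
    projNorm (x.map (C.lift α)) ≤ (n α : ℝ) ^ (3 / 2 : ℝ) *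
      ‖HSRow.row (show Matrix κ κ (HSRow (n α)) from x)‖ := by
  set v := ampliation κ (coordMatrix (n := n) α (1 : Matrix (Fin (n α)) (Fin (n α)) ℂ)) with hv
  set w := ampliation Unit (coordMatrix (C.bar α) (C.W α)) with hw
  set r : Matrix κ (κ × (Fin (n α) × Fin (n α))) ℂ :=
    HSRow.row (show Matrix κ κ (HSRow (n α)) from x) with hr
  have hre : ∀ a b i j, r a (b, (i, j)) = x a b i j := fun _ _ _ _ => rfl
  clear_value r
  let e : (κ × Fin (n α)) × (Unit × Fin (n α)) ≃ κ × (Fin (n α) × Fin (n α)) :=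
    ⟨fun p => (p.1.1, (p.2.2, p.1.2)), fun p => ((p.1, p.2.2), ((), p.2.1)), fun _ => rfl,
      fun _ => rfl⟩
  -- `A` is the row of `x`, and the columns of `B` are disjoint copies of `∑ e_l ⊗ e_l`
  set A : Matrix κ ((κ × Fin (n α)) × (Unit × Fin (n α))) ℂ :=
    (n α : ℂ) • r.submatrix (Equiv.refl κ) e with hA
  set B : Matrix ((κ × Fin (n α)) × (Unit × Fin (n α))) κ ℂ := Matrix.of fun s b =>
    if s.1.1 = b ∧ s.1.2 = s.2.2 then 1 else 0 with hB
  have hu : x.map (C.lift α) = sandwich A (v ⊗ₖₜ[ℂ] w) B := by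
    refine Matrix.ext fun a b => ?_
    have hent : ∀ (c c' : κ) (j l i l' : Fin (n α)) (y y' : Unit),
        (v ⊗ₖₜ[ℂ] w) ((c, j), (y, i)) ((c', l), (y', l')) = if c = c' then
          coordMatrix α 1 j l ⊗ₜ[ℂ] coordMatrix (C.bar α) (C.W α) i l' else 0 := by
      intro c c' j l i l' y y'
      rw [Matrix.kroneckerTMul_apply]
      simp only [hv, hw, ampliation, Matrix.of_apply, if_true]
      split_ifs
      · rfl
      · exact TensorProduct.zero_tmul _ _
    rw [Matrix.map_apply, C.lift_apply]
    simp only [sandwich, Matrix.of_apply, Fintype.sum_prod_type, hent, hA, hB, Matrix.smul_apply,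
      Matrix.submatrix_apply, Equiv.refl_apply, e, Equiv.coe_fn_mk, hre, Finset.univ_unique,
      Finset.sum_singleton, ite_and, mul_ite, mul_one, mul_zero, ite_smul, zero_smul, smul_ite,
      smul_zero, Finset.sum_ite_eq, Finset.sum_ite_eq', Finset.mem_univ, if_true,
      Finset.sum_ite_irrel, Finset.sum_const_zero, smul_eq_mul]
    rw [Finset.sum_comm]
    simp only [Finset.smul_sum, smul_smul]
  refine (projNorm_le_of_eq A v w B hu).trans ?_
  have hvn : mnorm v ≤ 1 := mnorm_ampliation_coordMatrix_le hn α _ norm_one_le κ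
  have hwn : mnorm w ≤ 1 := mnorm_ampliation_coordMatrix_le hn _ _ (C.norm_le α) Unit
  have hAn : ‖A‖ ≤ n α * ‖r‖ := by
    rw [hA, norm_smul, Complex.norm_natCast]
    exact mul_le_mul_of_nonneg_left (l2_submatrix_le _ _ _) (by positivity)
  have hBn : ‖B‖ ≤ √(n α) := by
    refine l2_le _ (by positivity) fun y => ?_
    rw [Real.sq_sqrt (by positivity)]
    have hBe : ∀ c l u i, (B.mulVec y) ((c, l), (u, i)) = if l = i then y c else 0 := by
      intro c l u i
      simp [hB, Matrix.mulVec, dotProduct, ite_and]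
    simp only [Fintype.sum_prod_type, hBe]
    simp [apply_ite norm, ite_pow, Finset.mul_sum]
  have hv0 := fourier_nonneg v
  have hw0 := fourier_nonneg w
  rw [rpow_three_halves (by positivity)]
  calc ‖A‖ * mnorm v * mnorm w * ‖B‖ ≤ (n α * ‖r‖) * 1 * 1 * √(n α) := by gcongr
    _ = _ := by ring

end tensor

/-! ### Elementary tensors -/

open UniformSpace

section tmul
variable {E F : Type*} [NormedAddCommGroup E] [NormedSpace ℂ E] [MatrixNorm E] [OperatorSpace E]
  [NormedAddCommGroup F] [NormedSpace ℂ F] [MatrixNorm F] [OperatorSpace F]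

theorem AlgTensor.norm_tmul_le (a : E) (b : F) : ‖(AlgTensor.tmul a b : AlgTensor E F)‖ ≤
    mnorm (oneByOne E a) * mnorm (oneByOne F b) := by
  have tm : oneByOne _ (a ⊗ₜ[ℂ] b) = sandwich
      (Matrix.of fun (_ : Unit) (_ : Unit × Unit) => 1) (oneByOne E a ⊗ₖₜ[ℂ] oneByOne F b)
      (Matrix.of fun (_ : Unit × Unit) (_ : Unit) => 1) := by
    ext i j
    simp [sandwich, oneByOne]
  refine (projNorm_le_of_eq _ _ _ _ tm).trans ?_
  have h1 := l2_row_le fun _ : Unit × Unit => (1 : ℂ)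
  have h2 := l2_col_le fun _ : Unit × Unit => (1 : ℂ)
  simp only [norm_one, one_pow, Finset.sum_const, Finset.card_univ, Fintype.card_prod,
    Fintype.card_unit, mul_one, one_smul, Real.sqrt_one] at h1 h2
  have := OperatorSpace.mnorm_nonneg (oneByOne E a)
  have := OperatorSpace.mnorm_nonneg (oneByOne F b)
  calc _ ≤ 1 * mnorm (oneByOne E a) * mnorm (oneByOne F b) * 1 := by gcongr
    _ = _ := by ring

/-- Elementary tensors as a bounded bilinear map. -/
noncomputable def ProjTensor.tmulL (hE : ∀ a : E, mnorm (oneByOne E a) ≤ ‖a‖)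
    (hF : ∀ b : F, mnorm (oneByOne F b) ≤ ‖b‖) : E →L[ℂ] F →L[ℂ] ProjTensor E F :=
  LinearMap.mkContinuous₂ (LinearMap.mk₂ ℂ (fun a b => ProjTensor.tmul a b)
    (fun a a' b => (congrArg (fun t : AlgTensor E F => (t : Completion (AlgTensor E F)))
      (TensorProduct.add_tmul a a' b)).trans (Completion.coe_add _ _))
    (fun c a b => (congrArg (fun t : AlgTensor E F => (t : Completion (AlgTensor E F)))
      (TensorProduct.smul_tmul' c a b).symm).trans (map_smul
        (Completion.toComplL (𝕜 := ℂ) (E := AlgTensor E F)) c (AlgTensor.tmul a b)))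
    (fun a b b' => (congrArg (fun t : AlgTensor E F => (t : Completion (AlgTensor E F)))
      (TensorProduct.tmul_add a b b')).trans (Completion.coe_add _ _))
    (fun c a b => (congrArg (fun t : AlgTensor E F => (t : Completion (AlgTensor E F)))
      (TensorProduct.tmul_smul c a b)).trans (map_smul
        (Completion.toComplL (𝕜 := ℂ) (E := AlgTensor E F)) c (AlgTensor.tmul a b))))
    1 fun a b => by
    have h1 := hE a
    have h2 := hF b
    have h3 := OperatorSpace.mnorm_nonneg (oneByOne F b)
    refine (Completion.norm_coe (AlgTensor.tmul a b : AlgTensor E F)).trans_le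
      ((AlgTensor.norm_tmul_le a b).trans ?_)
    rw [one_mul]
    exact mul_le_mul h1 h2 h3 (norm_nonneg a)

/-- Bounded maps on the projective tensor product that agree on elementary tensors are equal. -/
theorem ProjTensor.hom_ext {V : Type*} [NormedAddCommGroup V] [NormedSpace ℂ V]
    {Φ Ψ : ProjTensor E F →L[ℂ] V}
    (h : ∀ a b, Φ (ProjTensor.tmul a b) = Ψ (ProjTensor.tmul a b)) : Φ = Ψ := by
  refine ContinuousLinearMap.ext fun U => ?_
  refine Completion.induction_on U (isClosed_eq Φ.continuous Ψ.continuous) fun u => ?_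
  refine TensorProduct.induction_on (R := ℂ) (M := E) (N := F)
    (motive := fun u => Φ ((show AlgTensor E F from u : AlgTensor E F) : Completion _) =
      Ψ ((show AlgTensor E F from u : AlgTensor E F) : Completion _)) u ?_ h ?_
  · have : ((show AlgTensor E F from (0 : E ⊗[ℂ] F)) : Completion (AlgTensor E F)) = 0 :=
      Completion.coe_zero
    rw [this, map_zero, map_zero]
  · intro x y hx hy
    have : ((show AlgTensor E F from x + y : AlgTensor E F) : Completion (AlgTensor E F)) =
        ((show AlgTensor E F from x : AlgTensor E F) : Completion (AlgTensor E F)) +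
        ((show AlgTensor E F from y : AlgTensor E F) : Completion (AlgTensor E F)) :=
      Completion.coe_add _ _
    rw [this, map_add, map_add, hx, hy]

end tmul

/-! ### The twisted convolution as a bounded map -/

section conv
variable {I : Type*} {n : I → ℕ} (C : Conjugation n)

instance : CompleteSpace (FourierAlgebra n) :=
  inferInstanceAs (CompleteSpace (Submodule.topologicalClosure _ : Submodule ℂ _))

theorem Conjugation.summable_hsNorm (hn : ∀ α, 0 < n α)
    (u : AlgTensor (FourierAlgebra n) (FourierAlgebra n)) :
    Summable fun α => (n α : ℝ) ^ (3 / 2 : ℝ) * hsNorm (C.coeffTensor α u) :=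
  summable_of_sum_le (fun _ => mul_nonneg (by positivity) (hsNorm_nonneg _))
    fun S => C.sum_hsNorm_coeffTensor_le hn S u

theorem Conjugation.summable_blockElem (hn : ∀ α, 0 < n α)
    (u : AlgTensor (FourierAlgebra n) (FourierAlgebra n)) :
    Summable fun α => ‖blockElem α (C.coeffTensor α u)‖ :=
  Summable.of_nonneg_of_le (fun _ => norm_nonneg _) (fun _ => norm_blockElem_le _ _)
    (C.summable_hsNorm hn u)

theorem coeff_tsum (hn : ∀ α, 0 < n α) {X : ∀ α, Matrix (Fin (n α)) (Fin (n α)) ℂ}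
    (hX : Summable fun α => ‖blockElem α (X α)‖) (β : I) :
    FourierAlgebra.coeff β (∑' α, blockElem α (X α)) = X β := by
  have h := hX.of_norm.hasSum.map (FourierAlgebra.coeff β) (continuous_coeff β)
  have h2 : HasSum (⇑(FourierAlgebra.coeff β) ∘ fun α => blockElem α (X α)) (X β) := by
    convert hasSum_single β (f := ⇑(FourierAlgebra.coeff β) ∘ fun α => blockElem α (X α)) ?_
      using 1
    · exact (FourierAlgebra.coeff_blockElem_self hn β (X β)).symm
    · intro α hα
      exact FourierAlgebra.coeff_blockElem_of_ne hα.symm _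
  exact h.unique h2

/-- The twisted convolution on the algebraic tensor product, as the absolutely convergent sum of its
blocks. -/
noncomputable def Conjugation.convAlg (hn : ∀ α, 0 < n α) :
    AlgTensor (FourierAlgebra n) (FourierAlgebra n) →L[ℂ] FourierAlgebra n :=
  LinearMap.mkContinuous
    { toFun := fun u => ∑' α, blockElem α (C.coeffTensor α u)
      map_add' := fun u v => fourier_ext_coeff hn fun α => by
        rw [map_add, coeff_tsum hn (C.summable_blockElem hn _),
          coeff_tsum hn (C.summable_blockElem hn _), coeff_tsum hn (C.summable_blockElem hn _),
          map_add]
      map_smul' := fun c u => fourier_ext_coeff hn fun α => by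
        rw [RingHom.id_apply, map_smul, coeff_tsum hn (C.summable_blockElem hn _),
          coeff_tsum hn (C.summable_blockElem hn _), map_smul] } 1 fun u => by
    rw [one_mul]
    refine (norm_tsum_le_tsum_norm (C.summable_blockElem hn u)).trans ?_
    refine ((C.summable_blockElem hn u).tsum_le_tsum (fun α => norm_blockElem_le α _)
      (C.summable_hsNorm hn u)).trans ?_
    exact Real.tsum_le_of_sum_le (fun α => mul_nonneg (by positivity) (hsNorm_nonneg _))
      fun S => C.sum_hsNorm_coeffTensor_le hn S u

/-- The twisted convolution, extended to the projective tensor product by continuity. -/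
noncomputable def Conjugation.conv (hn : ∀ α, 0 < n α) :
    ProjTensor (FourierAlgebra n) (FourierAlgebra n) →L[ℂ] FourierAlgebra n :=
  (C.convAlg hn).extend Completion.toComplL

theorem Conjugation.conv_coe (hn : ∀ α, 0 < n α)
    (u : AlgTensor (FourierAlgebra n) (FourierAlgebra n)) :
    C.conv hn (u : Completion (AlgTensor (FourierAlgebra n) (FourierAlgebra n))) =
      C.convAlg hn u :=
  (C.convAlg hn).extend_eq (e := Completion.toComplL) Completion.denseRange_coe
    (Completion.isUniformInducing_coe _) u

theorem Conjugation.coeff_conv_coe (hn : ∀ α, 0 < n α)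
    (u : AlgTensor (FourierAlgebra n) (FourierAlgebra n)) (α : I) :
    FourierAlgebra.coeff α (C.conv hn (u : Completion
      (AlgTensor (FourierAlgebra n) (FourierAlgebra n)))) = C.coeffTensor α u := by
  rw [C.conv_coe]
  exact coeff_tsum hn (C.summable_blockElem hn u) α

end conv

/-! ### The twisted convolution of a compact quantum group -/

section cqg
variable {A : Type*} [Ring A] [StarRing A] [HopfAlgebra ℂ A] [StarModule ℂ A]
  [IsCompactQuantumGroup A] {I : Type*} (R : IrrRepresentatives A I) {h : A →ₗ[ℂ] ℂ}
  (hh : IsHaarState h) (hKac : IsKacType h)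

/-- The conjugation of the irreducible representations of a compact quantum group of Kac type. -/
noncomputable def IrrRepresentatives.conjugation : Conjugation R.dim where
  bar := (exists_conj R hh hKac).choose
  W := (exists_conj R hh hKac).choose_spec.choose
  bar_injective := (exists_conj R hh hKac).choose_spec.choose_spec.1
  mul_conjTranspose := (exists_conj R hh hKac).choose_spec.choose_spec.2.1
  conjTranspose_mul := (exists_conj R hh hKac).choose_spec.choose_spec.2.2.1

theorem IrrRepresentatives.star_u (α : I) (k l : Fin (R.dim α)) :
    star (R.u α k l) = ∑ r, ∑ s, ((R.conjugation hh hKac).W α k r *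
      star ((R.conjugation hh hKac).W α l s)) • R.u ((R.conjugation hh hKac).bar α) r s :=
  (exists_conj R hh hKac).choose_spec.choose_spec.2.2.2 α k l

theorem IrrRepresentatives.dim_pos (α : I) : 0 < R.dim α := (R.irreducible α).1

/-- The embedding of `Pol(G)` into the Fourier algebra as a linear map. -/
noncomputable def polEmbedL : A →ₗ[ℂ] FourierAlgebra R.dim where
  toFun := polEmbed R h
  map_add' := polEmbed_add R hh
  map_smul' := polEmbed_smul R hh

include hh hKac in
theorem polEmbed_u (α : I) (i j : Fin (R.dim α)) :
    polEmbed R h (R.u α i j) = coordMatrix α 1 i j :=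
  toDual_injective (ContinuousLinearMap.ext fun a => by
    rw [polEmbed_coeff R hh hKac, toDual_coordMatrix R.dim_pos]
    simp)

theorem polEmbed_star_u (α : I) (k l : Fin (R.dim α)) : polEmbed R h (star (R.u α k l)) =
    coordMatrix ((R.conjugation hh hKac).bar α) ((R.conjugation hh hKac).W α) k l := by
  refine toDual_injective (ContinuousLinearMap.ext fun a => ?_)
  rw [toDual_coordMatrix R.dim_pos, R.star_u hh hKac]
  set W := (R.conjugation hh hKac).W α
  change FourierAlgebra.toDual R.dim (polEmbedL R hh _) a = _
  have e : ∀ r s, polEmbedL R hh (R.u ((R.conjugation hh hKac).bar α) r s) =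
    polEmbed R h (R.u ((R.conjugation hh hKac).bar α) r s) := fun _ _ => rfl
  simp only [map_sum, map_smul, e, FunLike.coe_sum, Finset.sum_apply,
    FunLike.coe_smul, Pi.smul_apply, polEmbed_coeff R hh hKac]
  simp only [Matrix.mul_apply, Matrix.conjTranspose_apply, Finset.sum_mul, smul_eq_mul]
  rw [Finset.sum_comm]
  exact Finset.sum_congr rfl fun r _ => Finset.sum_congr rfl fun s _ => by ring

/-- The component of `a ⋆ S(b)` is the product on blocks. Both sides are bilinear, so it suffices to
compare them on coefficients `a` and adjoints of coefficients `b`. -/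
theorem coeff_convolution (a b : A) (γ : I) : FourierAlgebra.coeff γ (polEmbed R h
      (convolution h a (HopfAlgebra.antipode ℂ b))) =
    (R.conjugation hh hKac).prodCoeff γ (polEmbed R h a) (polEmbed R h b) := by
  set C := R.conjugation hh hKac with hC
  let L : A →ₗ[ℂ] A →ₗ[ℂ] Matrix (Fin (R.dim γ)) (Fin (R.dim γ)) ℂ := LinearMap.mk₂ ℂ
    (fun a b => FourierAlgebra.coeff γ (polEmbedL R hh
      (convolution h a (HopfAlgebra.antipode ℂ b))))
    (fun a a' b => by rw [convolution_add_left, map_add, map_add])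
    (fun c a b => by rw [convolution_smul_left, map_smul, map_smul])
    (fun a b b' => by rw [map_add, convolution_add_right, map_add, map_add])
    (fun c a b => by rw [map_smul, convolution_smul_right, map_smul, map_smul])
  let L' : A →ₗ[ℂ] A →ₗ[ℂ] Matrix (Fin (R.dim γ)) (Fin (R.dim γ)) ℂ :=
    (C.prodCoeff γ).compl₁₂ (polEmbedL R hh) (polEmbedL R hh)
  suffices L = L' from LinearMap.congr_fun (LinearMap.congr_fun this a) b
  have h1 : Set.EqOn L L' {a | ∃ α k l, a = R.u α k l} := by
    rintro _ ⟨α, i, j, rfl⟩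
    refine LinearMap.ext_on (span_coeff_star R) ?_
    rintro _ ⟨β, k, l, rfl⟩
    change FourierAlgebra.coeff γ (polEmbedL R hh (convolution h (R.u α i j)
      (HopfAlgebra.antipode ℂ (star (R.u β k l))))) =
      C.prodCoeff γ (polEmbed R h (R.u α i j)) (polEmbed R h (star (R.u β k l)))
    rw [polEmbed_u R hh hKac, polEmbed_star_u R hh hKac]
    by_cases hγ : γ = α
    · subst hγ
      by_cases hβ : β = γ
      · subst hβ
        rw [convolution_coeff_self R hh hKac, C.prodCoeff_coordMatrix R.dim_pos]
        split_ifs with hjl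
        · subst hjl
          rw [map_smul, map_smul]
          change _ • FourierAlgebra.coeff β (polEmbed R h (R.u β i k)) = _
          rw [polEmbed_u R hh hKac, coeff_coordMatrix_self R.dim_pos, smul_smul]
          simp
        · rw [map_zero, map_zero, Matrix.single_mul_single_of_ne _ _ _ _ (Ne.symm hjl), smul_zero]
      · rw [convolution_coeff_of_ne R hh hKac (Ne.symm hβ), map_zero, map_zero]
        simp only [Conjugation.prodCoeff, LinearMap.mk₂_apply]
        have : FourierAlgebra.coeff (C.bar γ) (coordMatrix (C.bar β) (C.W β) k l) = 0 :=
          FourierAlgebra.coeff_blockElem_of_ne (fun e => hβ (C.bar_injective e).symm) _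
        rw [this]
        simp
    · have h2 : FourierAlgebra.coeff γ (coordMatrix (n := R.dim) α 1 i j) = 0 :=
        FourierAlgebra.coeff_blockElem_of_ne hγ _
      simp only [Conjugation.prodCoeff, LinearMap.mk₂_apply, h2, Matrix.mul_zero]
      by_cases hβ : α = β
      · subst hβ
        rw [convolution_coeff_self R hh hKac]
        split_ifs
        · rw [map_smul, map_smul]
          change _ • FourierAlgebra.coeff γ (polEmbed R h (R.u α i k)) = _
          rw [polEmbed_u R hh hKac]
          have : FourierAlgebra.coeff γ (coordMatrix (n := R.dim) α 1 i k) = 0 :=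
            FourierAlgebra.coeff_blockElem_of_ne hγ _
          rw [this, smul_zero]
        · rw [map_zero, map_zero]
      · rw [convolution_coeff_of_ne R hh hKac hβ, map_zero, map_zero]
  exact LinearMap.ext_on (span_coeff_irr R) h1

theorem isTwistedConvolution_conv :
    IsTwistedConvolution R h ((R.conjugation hh hKac).conv R.dim_pos) := by
  intro a b
  refine fourier_ext_coeff R.dim_pos fun γ => ?_
  rw [coeff_convolution R hh hKac]
  exact ((R.conjugation hh hKac).coeff_conv_coe R.dim_pos _ γ).trans
    ((R.conjugation hh hKac).coeffTensor_tmul γ _ _)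

include hh hKac in
/-- The polynomial algebra contains all blocks. -/
theorem dense_polEmbed : Dense (Set.range (polEmbed R h)) := by
  have hle : Submodule.span ℂ {g : FourierAlgebra R.dim | ∃ α X, g = blockElem α X} ≤
      LinearMap.range (polEmbedL R hh) := by
    refine Submodule.span_le.mpr ?_
    rintro _ ⟨α, X, rfl⟩
    have h0 : (R.dim α : ℂ) ≠ 0 := by exact_mod_cast (R.dim_pos α).ne'
    rw [Matrix.matrix_eq_sum_single X]
    simp only [map_sum]
    refine Submodule.sum_mem _ fun i _ => Submodule.sum_mem _ fun j _ =>
      ⟨((R.dim α : ℂ) * X i j) • R.u α j i, ?_⟩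
    change polEmbed R h _ = _
    rw [polEmbed_smul R hh, polEmbed_u R hh hKac, coordMatrix, Matrix.of_apply, ← map_smul]
    simp only [Matrix.smul_single, smul_eq_mul, mul_one, Matrix.conjTranspose_one, Matrix.one_mul]
    rw [mul_right_comm, mul_inv_cancel₀ h0, one_mul]
  intro f
  have h1 := mem_closure_span_blockElem f
  rw [← SetLike.mem_coe, Submodule.topologicalClosure_coe] at h1
  exact closure_mono hle h1

include hh hKac in
/-- There is only one twisted convolution, since the polynomial algebra is dense in the Fourier
algebra. -/
theorem IsTwistedConvolution.unique
    {Φ Ψ : ProjTensor (FourierAlgebra R.dim) (FourierAlgebra R.dim) →L[ℂ] FourierAlgebra R.dim}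
    (hΦ : IsTwistedConvolution R h Φ) (hΨ : IsTwistedConvolution R h Ψ) : Φ = Ψ := by
  set τ := ProjTensor.tmulL (mnorm_one_fourier_le (n := R.dim)) (mnorm_one_fourier_le (n := R.dim))
    with hτ
  have hd := dense_polEmbed R hh hKac
  have h1 : ∀ (a : A) (g : FourierAlgebra R.dim), Φ (τ (polEmbed R h a) g) =
      Ψ (τ (polEmbed R h a) g) := by
    intro a
    refine fun g => congrFun (Continuous.ext_on hd (Φ.continuous.comp (τ _).continuous)
      (Ψ.continuous.comp (τ _).continuous) ?_) g
    rintro _ ⟨b, rfl⟩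
    exact (hΦ a b).trans (hΨ a b).symm
  refine ProjTensor.hom_ext fun f g => ?_
  refine congrFun (Continuous.ext_on hd (Φ.continuous.comp (τ.flip g).continuous)
      (Ψ.continuous.comp (τ.flip g).continuous) ?_) f
  rintro _ ⟨a, rfl⟩
  exact h1 a g

end cqg

/-! ### Direct sums -/

section l1
variable {I : Type*} {E : I → Type*} [∀ i, AddCommGroup (E i)] [∀ i, Module ℂ (E i)]
  [∀ i, MatrixNorm (E i)] [∀ i, OperatorSpace (E i)] {k : Type} [Fintype k] [DecidableEq k]

theorem IsCompleteContraction.norm_le {F : Type*} [AddCommGroup F] [Module ℂ F] [MatrixNorm F]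
    {T : F →ₗ[ℂ] Matrix k k ℂ} (hT : IsCompleteContraction T) (x : F) :
    ‖T x‖ ≤ mnorm (oneByOne F x) :=
  (mnorm_one_matrix (T x)).ge.trans (hT Unit (oneByOne F x))

theorem summable_norm_apply {T : ∀ i, E i →ₗ[ℂ] Matrix k k ℂ}
    (hT : ∀ i, IsCompleteContraction (T i)) (x : l1Sum E) :
    Summable fun i => ‖T i ((x : ∀ i, E i) i)‖ :=
  Summable.of_nonneg_of_le (fun _ => norm_nonneg _) (fun i => (hT i).norm_le _) x.2

/-- Every family of complete contractions is bounded by the norm of the `ℓ¹`-sum. -/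
theorem mnorm_tsum_le {ι : Type} [Fintype ι] [DecidableEq ι] (x : Matrix ι ι (l1Sum E)) {k : ℕ}
    {T : ∀ i, E i →ₗ[ℂ] Matrix (Fin k) (Fin k) ℂ} (hT : ∀ i, IsCompleteContraction (T i)) :
    mnorm (Matrix.of fun a b : ι => ∑' i, T i ((x a b : ∀ i, E i) i)) ≤ mnorm x := by
  refine le_csSup ⟨∑ a, ∑ b, ∑' i, mnorm (oneByOne (E i) ((x a b : ∀ i, E i) i)), ?_⟩
    ⟨k, T, hT, rfl⟩
  rintro _ ⟨k, T, hT, rfl⟩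
  refine (OperatorSpace.mnorm_le_sum _).trans ?_
  refine Finset.sum_le_sum fun a _ => Finset.sum_le_sum fun b _ => ?_
  rw [mnorm_one_matrix, Matrix.of_apply]
  exact (norm_tsum_le_tsum_norm (summable_norm_apply hT _)).trans
    ((summable_norm_apply hT _).tsum_le_tsum (fun i => (hT i).norm_le _) (x a b).2)

theorem continuous_mnorm_matrix {ι : Type} [Fintype ι] [DecidableEq ι] :
    Continuous fun M : Matrix ι ι (Matrix k k ℂ) => mnorm M :=
  continuous_norm.comp (continuous_matrix fun p q =>
    Continuous.matrix_elem (Continuous.matrix_elem continuous_id p.1 q.1) p.2 q.2)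

end l1

/-! ### The range of the twisted convolution -/

section main
variable {I : Type*} {n : I → ℕ} (C : Conjugation n) (hn : ∀ α, 0 < n α)

theorem isMatrixSeminorm_projTensor :
    IsMatrixSeminorm (ProjTensor (FourierAlgebra n) (FourierAlgebra n)) :=
  isMatrixSeminorm_completion isMatrixSeminorm_algTensor fun _ => le_rfl

theorem mnorm_one_projTensor_le (U : ProjTensor (FourierAlgebra n) (FourierAlgebra n)) :
    mnorm (oneByOne _ U) ≤ ‖U‖ :=
  (completion_mnorm_le_sum isMatrixSeminorm_algTensor (fun _ => le_rfl) (oneByOne _ U)).trans_eq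
    (by simp [oneByOne])

/-- The components of the twisted convolution are completely contractive on the projective tensor
product. -/
theorem Conjugation.mnorm_sum_coeff_conv_le (S : Finset I) {k : Type} [Fintype k] [DecidableEq k]
    {T : ∀ α, Scaled ((n α : ℝ) ^ (3 / 2 : ℝ)) (HSRow (n α)) →ₗ[ℂ] Matrix k k ℂ}
    (hT : ∀ α, IsCompleteContraction (T α)) {ι : Type} [Fintype ι] [DecidableEq ι]
    (U : Matrix ι ι (ProjTensor (FourierAlgebra n) (FourierAlgebra n))) :
    mnorm (Matrix.of fun a b => ∑ α ∈ S, T α (toScaled _ _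
      (FourierAlgebra.coeff α (C.conv hn (U a b))))) ≤ mnorm U := by
  refine le_of_forall_gt_imp_ge_of_dense fun r hr => ?_
  have hU := mem_closure_ballImage_of_lt isMatrixSeminorm_algTensor (fun _ => le_rfl) hr
  refine closure_minimal ?_ (isClosed_le (f := fun U : Matrix ι ι (ProjTensor (FourierAlgebra n)
    (FourierAlgebra n)) => mnorm (Matrix.of fun a b => ∑ α ∈ S, T α (toScaled _ _
      (FourierAlgebra.coeff α (C.conv hn (U a b)))))) ?_ continuous_const) hU
  · rintro _ ⟨u, hu, rfl⟩
    refine le_trans (le_of_eq ?_) ((C.mnorm_sum_coeffTensor_le hn S hT u).trans hu)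
    congr 1
    refine Matrix.ext fun a b => ?_
    simp only [Matrix.of_apply, Matrix.map_apply]
    refine Finset.sum_congr rfl fun α _ => ?_
    rw [C.coeff_conv_coe]
  · refine continuous_mnorm_matrix.comp (continuous_matrix fun a b => ?_)
    simp only [Matrix.of_apply]
    refine continuous_finsetSum _ fun α _ => ?_
    have hc : Continuous fun U : Matrix ι ι (ProjTensor (FourierAlgebra n) (FourierAlgebra n)) =>
        FourierAlgebra.coeff α (C.conv hn (U a b)) :=
      (continuous_coeff α).comp ((C.conv hn).continuous.comp
        (Continuous.matrix_elem continuous_id a b))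
    refine Continuous.congr ?_ fun U => (apply_toScaled (T α) _).symm
    exact continuous_finsetSum _ fun i _ => continuous_finsetSum _ fun j _ =>
      (Continuous.matrix_elem hc i j).smul continuous_const

/-- The twisted convolution as a map onto its range. -/
noncomputable def Conjugation.toRange : ProjTensor (FourierAlgebra n) (FourierAlgebra n) →ₗ[ℂ]
    QuotientRange (C.conv hn) := (C.conv hn).toLinearMap.rangeRestrict

theorem Conjugation.mnorm_map_toRange_le {ι : Type} [Fintype ι] [DecidableEq ι]
    (U : Matrix ι ι (ProjTensor (FourierAlgebra n) (FourierAlgebra n))) :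
    mnorm (U.map (C.toRange hn)) ≤ mnorm U :=
  quotient_mnorm_le isMatrixSeminorm_projTensor _ rfl

/-- The bound of `Conjugation.mnorm_sum_coeff_conv_le` passes to the quotient. -/
theorem Conjugation.mnorm_sum_coeff_le (S : Finset I) {k : Type} [Fintype k] [DecidableEq k]
    {T : ∀ α, Scaled ((n α : ℝ) ^ (3 / 2 : ℝ)) (HSRow (n α)) →ₗ[ℂ] Matrix k k ℂ}
    (hT : ∀ α, IsCompleteContraction (T α)) {ι : Type} [Fintype ι] [DecidableEq ι]
    (y : Matrix ι ι (QuotientRange (C.conv hn))) :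
    mnorm (Matrix.of fun a b => ∑ α ∈ S, T α (toScaled _ _
      (FourierAlgebra.coeff α (QuotientRange.incl _ (y a b))))) ≤ mnorm y := by
  refine le_of_forall_gt_imp_ge_of_dense fun r hr => ?_
  obtain ⟨U, hU, hUr⟩ := exists_lift_of_mnorm_lt _ hr
  refine le_trans (le_of_eq ?_) ((C.mnorm_sum_coeff_conv_le hn S hT U).trans hUr.le)
  congr 1
  refine Matrix.ext fun a b => ?_
  have h : C.conv hn (U a b) = QuotientRange.incl _ (y a b) := congrFun (congrFun hU a) b
  simp only [Matrix.of_apply, h]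

theorem Conjugation.sum_hsNorm_coeff_le (S : Finset I) (y : QuotientRange (C.conv hn)) :
    ∑ α ∈ S, (n α : ℝ) ^ (3 / 2 : ℝ) *
      hsNorm (FourierAlgebra.coeff α (QuotientRange.incl _ y)) ≤ mnorm (oneByOne _ y) := by
  set X := fun α => FourierAlgebra.coeff α (QuotientRange.incl _ y) with hX
  have h := C.mnorm_sum_coeff_le hn S (T := fun α => hsFunctional _
    (((hsNorm (X α))⁻¹ : ℂ) • X α))
    (fun α => isCompleteContraction_hsFunctional (by positivity) (hsNorm_normalize_le _))
    (oneByOne _ y)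
  refine le_trans ?_ h
  have e := mnorm_one_matrix (∑ α ∈ S, hsFunctional ((n α : ℝ) ^ (3 / 2 : ℝ))
    (((hsNorm (X α))⁻¹ : ℂ) • X α) (toScaled _ _ (X α)))
  refine le_trans ?_ e.ge
  refine le_trans ?_ (norm_entry_le _ 0 0)
  rw [Matrix.sum_apply]
  simp only [hsFunctional_self]
  rw [← Complex.ofReal_sum, Complex.norm_real]
  exact le_abs_self _

theorem Conjugation.summable_hsNorm_coeff (y : QuotientRange (C.conv hn)) :
    Summable fun α => (n α : ℝ) ^ (3 / 2 : ℝ) *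
      hsNorm (FourierAlgebra.coeff α (QuotientRange.incl _ y)) :=
  summable_of_sum_le (fun _ => mul_nonneg (by positivity) (hsNorm_nonneg _))
    fun S => C.sum_hsNorm_coeff_le hn S y

/-- The right inverse of the twisted convolution on a block, in the projective tensor product. -/
noncomputable def Conjugation.liftL (α : I) : Matrix (Fin (n α)) (Fin (n α)) ℂ →ₗ[ℂ]
    ProjTensor (FourierAlgebra n) (FourierAlgebra n) :=
  (Completion.toComplL (𝕜 := ℂ) (E := AlgTensor (FourierAlgebra n) (FourierAlgebra n))).toLinearMap
    ∘ₗ (C.lift α : _ →ₗ[ℂ] AlgTensor (FourierAlgebra n) (FourierAlgebra n))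

include hn in
theorem Conjugation.mnorm_map_liftL_le (α : I) {κ : Type} [Fintype κ] [DecidableEq κ]
    (x : Matrix κ κ (Matrix (Fin (n α)) (Fin (n α)) ℂ)) :
    mnorm (x.map (C.liftL α)) ≤ (n α : ℝ) ^ (3 / 2 : ℝ) *
      ‖HSRow.row (show Matrix κ κ (HSRow (n α)) from x)‖ :=
  (mnorm_map_coe_le (V := AlgTensor (FourierAlgebra n) (FourierAlgebra n))
    isMatrixSeminorm_algTensor (x.map (C.lift α))).trans (C.mnorm_lift_le hn α x)

include hn in
theorem Conjugation.norm_liftL_le (α : I) (X : Matrix (Fin (n α)) (Fin (n α)) ℂ) :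
    ‖C.liftL α X‖ ≤ (n α : ℝ) ^ (3 / 2 : ℝ) * hsNorm X := by
  refine (Completion.norm_coe (E := AlgTensor (FourierAlgebra n) (FourierAlgebra n))
    (C.lift α X)).trans_le ?_
  exact (C.mnorm_lift_le hn α (oneByOne _ X)).trans_eq (mnorm_one_scaled _ X)

theorem Conjugation.coeff_conv_liftL_self (α : I) (X : Matrix (Fin (n α)) (Fin (n α)) ℂ) :
    FourierAlgebra.coeff α (C.conv hn (C.liftL α X)) = X :=
  (C.coeff_conv_coe hn _ α).trans (C.coeffTensor_lift_self hn α X)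

theorem Conjugation.coeff_conv_liftL_of_ne {α β : I} (h : β ≠ α)
    (X : Matrix (Fin (n α)) (Fin (n α)) ℂ) :
    FourierAlgebra.coeff β (C.conv hn (C.liftL α X)) = 0 :=
  (C.coeff_conv_coe hn _ β).trans (C.coeffTensor_lift_of_ne h X)

include hn in
theorem Conjugation.summable_liftL {X : ∀ α, Matrix (Fin (n α)) (Fin (n α)) ℂ}
    (hX : Summable fun α => (n α : ℝ) ^ (3 / 2 : ℝ) * hsNorm (X α)) :
    Summable fun α => ‖C.liftL α (X α)‖ :=
  Summable.of_nonneg_of_le (fun _ => norm_nonneg _) (fun α => C.norm_liftL_le hn α (X α)) hX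

theorem Conjugation.coeff_conv_tsum_liftL {X : ∀ α, Matrix (Fin (n α)) (Fin (n α)) ℂ}
    (hX : Summable fun α => (n α : ℝ) ^ (3 / 2 : ℝ) * hsNorm (X α)) (β : I) :
    FourierAlgebra.coeff β (C.conv hn (∑' α, C.liftL α (X α))) = X β := by
  have h := (C.summable_liftL hn hX).of_norm.hasSum.map
    ((FourierAlgebra.coeff β) ∘ₗ (C.conv hn).toLinearMap)
    ((continuous_coeff β).comp (C.conv hn).continuous)
  refine h.unique ?_
  convert hasSum_single β (f := ⇑((FourierAlgebra.coeff β) ∘ₗ (C.conv hn).toLinearMap) ∘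
    fun α => C.liftL α (X α)) ?_ using 1
  · exact (C.coeff_conv_liftL_self hn β (X β)).symm
  · intro α hα
    exact C.coeff_conv_liftL_of_ne hn hα.symm _

theorem Conjugation.toRange_ext {y z : QuotientRange (C.conv hn)} (h : ∀ α,
    FourierAlgebra.coeff α (QuotientRange.incl _ y) =
      FourierAlgebra.coeff α (QuotientRange.incl _ z)) : y = z :=
  QuotientRange.incl_injective _ (fourier_ext_coeff hn h)

/-- Every element of the range is the image of the sum of the lifts of its components. -/
theorem Conjugation.toRange_tsum_liftL (y : QuotientRange (C.conv hn)) :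
    C.toRange hn (∑' α, C.liftL α (FourierAlgebra.coeff α (QuotientRange.incl _ y))) = y :=
  C.toRange_ext hn fun α => C.coeff_conv_tsum_liftL hn (C.summable_hsNorm_coeff hn y) α

/-- The norm of an element of the range. The upper bound is the norm of the sum of the lifts. -/
theorem Conjugation.mnorm_one_eq_tsum (y : QuotientRange (C.conv hn)) :
    mnorm (oneByOne _ y) = ∑' α, (n α : ℝ) ^ (3 / 2 : ℝ) *
      hsNorm (FourierAlgebra.coeff α (QuotientRange.incl _ y)) := by
  have hs := C.summable_hsNorm_coeff hn y
  refine le_antisymm ?_ (Real.tsum_le_of_sum_le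
    (fun _ => mul_nonneg (by positivity) (hsNorm_nonneg _)) fun S => C.sum_hsNorm_coeff_le hn S y)
  have h1 := C.mnorm_map_toRange_le hn (oneByOne _
    (∑' α, C.liftL α (FourierAlgebra.coeff α (QuotientRange.incl _ y))))
  have e : (oneByOne _ (∑' α, C.liftL α (FourierAlgebra.coeff α
      (QuotientRange.incl _ y)))).map (C.toRange hn) = oneByOne _ y :=
    Matrix.ext fun _ _ => C.toRange_tsum_liftL hn y
  rw [e] at h1
  refine h1.trans ((mnorm_one_projTensor_le _).trans ?_)
  exact (norm_tsum_le_tsum_norm (C.summable_liftL hn hs)).trans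
    ((C.summable_liftL hn hs).tsum_le_tsum (fun α => C.norm_liftL_le hn α _) hs)

variable [∀ α, Fact (0 < (n α : ℝ) ^ (3 / 2 : ℝ))]

/-- An element of the range of the twisted convolution, as the family of its components. -/
noncomputable def Conjugation.components : QuotientRange (C.conv hn) ≃ₗ[ℂ]
    l1Sum fun α : I => Scaled ((n α : ℝ) ^ (3 / 2 : ℝ)) (HSRow (n α)) :=
  LinearEquiv.ofBijective
    { toFun := fun y => ⟨fun α => toScaled _ _ (FourierAlgebra.coeff α (QuotientRange.incl _ y)),
        (C.summable_hsNorm_coeff hn y).congr fun α => (mnorm_one_scaled _ _).symm⟩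
      map_add' := fun y z => Subtype.ext (funext fun α => by
        simp only [map_add]; rfl)
      map_smul' := fun c y => Subtype.ext (funext fun α => by
        simp only [map_smul]; rfl) }
    ⟨fun y z hyz => C.toRange_ext hn fun α => congrFun (congrArg Subtype.val hyz) α, fun x => by
      have hx : Summable fun α => (n α : ℝ) ^ (3 / 2 : ℝ) *
          hsNorm (show Matrix (Fin (n α)) (Fin (n α)) ℂ from x.1 α) :=
        Summable.congr x.2 fun α => mnorm_one_scaled _ _
      refine ⟨C.toRange hn (∑' α, C.liftL α (x.1 α)), Subtype.ext (funext fun α => ?_)⟩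
      exact C.coeff_conv_tsum_liftL hn hx α⟩

/-- A family of complete contractions admissible for the `ℓ¹`-sum is a limit of the finite families
of `Conjugation.mnorm_sum_coeff_le`. -/
theorem Conjugation.mnorm_components_le {ι : Type} [Fintype ι] [DecidableEq ι]
    (y : Matrix ι ι (QuotientRange (C.conv hn))) :
    mnorm (y.map (C.components hn)) ≤ mnorm y := by
  refine Real.sSup_le ?_ ((isMatrixSeminorm_quotient isMatrixSeminorm_projTensor _).nonneg y)
  rintro _ ⟨k, T, hT, rfl⟩
  refine le_of_tendsto (f := fun S : Finset I => mnorm (Matrix.of fun a b => ∑ α ∈ S,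
    T α (((y.map (C.components hn)) a b).1 α))) (x := Filter.atTop)
    (((continuous_mnorm_matrix (k := Fin k) (ι := ι)).tendsto _).comp ?_)
    (Filter.Eventually.of_forall fun S => C.mnorm_sum_coeff_le hn S hT y)
  refine tendsto_pi_nhds.mpr fun a => tendsto_pi_nhds.mpr fun b => ?_
  exact (summable_norm_apply hT _).of_norm.hasSum

/-- The quotient norm is computed by complete contractions `τ` into matrix algebras, and the
compositions of `τ` with the right inverses are admissible for the norm of the `ℓ¹`-sum. -/
theorem Conjugation.le_mnorm_components {ι : Type} [Fintype ι] [DecidableEq ι]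
    (y : Matrix ι ι (QuotientRange (C.conv hn))) :
    mnorm y ≤ mnorm (y.map (C.components hn)) := by
  have hQ := isMatrixSeminorm_quotient isMatrixSeminorm_projTensor (C.conv hn)
  rw [← one_mul (mnorm (y.map (C.components hn))), mul_comm]
  refine le_mul_of_forall_gt fun r hr => ?_
  obtain ⟨k, τ, hτ, h⟩ := hQ.exists_completeContraction y (sub_pos.mpr hr)
  rw [add_sub_cancel, mul_comm] at h
  have hr0 : 0 ≤ r := zero_le_one.trans hr.le
  refine h.trans ?_
  rw [mul_comm, mul_comm _ r]
  refine mul_le_mul_of_nonneg_left ?_ hr0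
  let T : ∀ α, Scaled ((n α : ℝ) ^ (3 / 2 : ℝ)) (HSRow (n α)) →ₗ[ℂ] Matrix (Fin k) (Fin k) ℂ :=
    fun α => τ ∘ₗ C.toRange hn ∘ₗ (C.liftL α : Scaled _ (HSRow (n α)) →ₗ[ℂ] _)
  have hT : ∀ α, IsCompleteContraction (T α) := fun α κ _ _ x =>
    (hτ κ _).trans ((C.mnorm_map_toRange_le hn _).trans (C.mnorm_map_liftL_le hn α x))
  refine le_trans (le_of_eq ?_) (mnorm_tsum_le (y.map (C.components hn)) hT)
  congr 1
  refine Matrix.ext fun a b => ?_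
  -- `τ` is continuous on the tensor product, hence commutes with the sum of the lifts
  let L : ProjTensor (FourierAlgebra n) (FourierAlgebra n) →L[ℂ] Matrix (Fin k) (Fin k) ℂ :=
    (τ ∘ₗ C.toRange hn).mkContinuous 1 fun U => by
      rw [one_mul]
      exact (hτ.norm_le _).trans ((C.mnorm_map_toRange_le hn (oneByOne _ U)).trans
        (mnorm_one_projTensor_le U))
  have h1 := L.map_tsum (C.summable_liftL hn (C.summable_hsNorm_coeff hn (y a b))).of_norm
  refine Eq.trans ?_ h1
  exact (congrArg τ (C.toRange_tsum_liftL hn (y a b))).symm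

theorem Conjugation.isCompleteIsometry_components :
    IsCompleteIsometry (C.components hn).toLinearMap := fun _ _ _ y =>
  le_antisymm (C.mnorm_components_le hn y) (C.le_mnorm_components hn y)

end main
end OpSp

theorem mainTheorem2 {A : Type*} [Ring A] [StarRing A] [HopfAlgebra ℂ A] [StarModule ℂ A]
    [IsCompactQuantumGroup A] (h : A →ₗ[ℂ] ℂ) (hh : IsHaarState h) (hKac : IsKacType h)
    {I : Type*} (R : IrrRepresentatives A I) :
    (∃! Φ : ProjTensor (FourierAlgebra R.dim) (FourierAlgebra R.dim) →L[ℂ] FourierAlgebra R.dim,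
      IsTwistedConvolution R h Φ) ∧
    ∀ Φ : ProjTensor (FourierAlgebra R.dim) (FourierAlgebra R.dim) →L[ℂ] FourierAlgebra R.dim,
      IsTwistedConvolution R h Φ →
      ∃ Θ : ADelta Φ ≃ₗ[ℂ] RowSum R,
        IsCompleteIsometry Θ.toLinearMap ∧
        ∀ X : ∀ α, Matrix (Fin (R.dim α)) (Fin (R.dim α)) ℂ, {α | X α ≠ 0}.Finite →
          ∃ y : ADelta Φ, QuotientRange.incl Φ y = haarMul X ∧
            (∀ α, (Θ y).1 α = X α) ∧
            mnorm (oneByOne _ y) = ∑ᶠ α, (R.dim α : ℝ) ^ (3 / 2 : ℝ) * hsNorm (X α) := by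
  have hconv := isTwistedConvolution_conv R hh hKac
  refine ⟨⟨_, hconv, fun Ψ hΨ => hΨ.unique R hh hKac hconv⟩, fun Φ hΦ => ?_⟩
  obtain rfl := hΦ.unique R hh hKac hconv
  set C := R.conjugation hh hKac
  refine ⟨C.components R.dim_pos, C.isCompleteIsometry_components R.dim_pos, fun X hX => ?_⟩
  have hfin : (Function.support fun α => (R.dim α : ℝ) ^ (3 / 2 : ℝ) * hsNorm (X α)).Finite := by
    refine hX.subset fun α hα h0 => hα ?_
    simp [h0, hsNorm]
  set y := C.toRange R.dim_pos (∑' α, C.liftL α (X α)) with hy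
  have hc : ∀ α, FourierAlgebra.coeff α (QuotientRange.incl _ y) = X α := fun α =>
    C.coeff_conv_tsum_liftL R.dim_pos
      (summable_of_hasFiniteSupport (L := SummationFilter.unconditional _) hfin) α
  refine ⟨y, fourier_ext_coeff R.dim_pos fun α => ?_, hc, ?_⟩
  · rw [hc, coeff_haarMul R.dim_pos hX]
  · rw [C.mnorm_one_eq_tsum, ← tsum_eq_finsum (L := SummationFilter.unconditional I) hfin]
    simp only [hc]
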